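/- Let $n\ge 2$. Let $H\in C^\infty(\mathbb R^n\setminus 0)$ be real valued with $H(t\xi)=tH(\xi)$ for all real $t\ne0$, $\xi\neq 0$. Let $\xi_0\ne0$, $\Theta_0=\xi_0/|\xi_0|$ and $x_0=H'(\xi_0)$. For $\alpha\in S^{n-1}$ let $\check H''(\alpha)$ be the $(n-1)\times(n-1)$ Hessian matrix at $\alpha$ of $H$ restricted to the hyperplane $\xi\cdot\alpha=1$. Let $\Omega\subset S^{n-1}$ be a (relatively open) neighborhood of $\Theta_0$, so small that $\Theta_0$ is the only $\alpha\in\Omega$ with $H'(\alpha)=x_0$, and suppose that $\check H''$ is negative definite on $\Omega$. Put $$\omega(\alpha)=(2\pi)^{-(n-1)/2}\,|\det\check H''(\alpha)|^{1/2}e^{-\frac{i\pi}4\operatorname{sgn}\check H''(\alpha)},\quad \alpha\in\Omega\cup(-\Omega),$$ where $\operatorname{sgn}$ is the number of positive minus the number of negative eigenvalues. Let $\tilde v:\mathbb R^n\to\mathbb C$ be locally integrable and $C^\infty$ on $\mathbb R^n\setminus0$ (for example $\tilde v\in C^\infty(\mathbb R^n)$), let $\tilde v_j\in C_0^\infty(\Omega\cup(-\Omega))$,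 $j\ge0$, and let $(n+1)/2\le s_0<s_1<\dots$, $s_j\to\infty$. Suppose that $\tilde v(\lambda\alpha)\sim\omega(\alpha)\sum_{j\ge0}\lambda^{-s_j}\tilde v_j(\alpha)$ as $\lambda\to+\infty$, in the sense that for all $J,l\ge 0$ and all multi-indices $\nu$ there is a constant $C_{Jl\nu}$ with $$\Bigl|\partial_\lambda^l\partial_\alpha^\nu\Bigl(\tilde v(\lambda\alpha)-\omega(\alpha)\sum_{j=0}^{J-1}\lambda^{-s_j}\tilde v_j(\alpha)\Bigr)\Bigr|\le C_{Jl\nu}\lambda^{-(s_J+l)},\quad \lambda\ge1,\ \alpha\in S^{n-1}.$$ Let $f$ be the distribution on $\mathbb R^n$ given by the oscillatory integral $$f(x)=\frac1{(2\pi)^n}\int_{\mathbb R^n}\tilde v(\xi)e^{i(H(\xi)-\xi\cdot x)}\,d\xi .$$ Put $\kappa_1=s_0-\frac{n+1}2\ge0$, $v_\pm=\tilde v_0(\pm\Theta_0)$ and $$\tilde\mu(\lambda)=(2\pi)^{-(n-1)}\bigl(v_+\lambda_+^{-(\kappa_1+1)}+v_-\lambda_-^{-(\kappa_1+1)}\bigr)\in\mathcal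 S'(\mathbb R),$$ where $\lambda_\pm^a$ are regularized by Hadamard's finite part. Define $f_0$ by $$f_0(p)=\frac{-1}{2(2\pi)^{n-1}\sin(\pi\kappa_1)\Gamma(\kappa_1+1)}\Bigl[p_+^{\kappa_1}\Bigl(q_1v_++\frac{v_-}{q_1}\Bigr)+p_-^{\kappa_1}\Bigl(q_1v_-+\frac{v_+}{q_1}\Bigr)\Bigr],\quad q_1=e^{i\kappa_1\pi/2},$$ if $\kappa_1\notin\{0,1,2,\dots\}$, and by $$f_0(p)=\frac{v_+}{2(2\pi)^{n-1}i^{\kappa_1+1}\kappa_1!}\,p^{\kappa_1}\operatorname{sgn}(p)$$ if $\kappa_1\in\{0,1,2,\dots\}$ and $v_-=(-1)^{\kappa_1+1}v_+$. Then, in each of these two cases: 1. $f_0=\mathcal F^{-1}\tilde\mu$ in $\mathcal S'(\mathbb R)$, where $\mathcal F^{-1}g(p)=\frac1{2\pi}\int g(\lambda)e^{-i\lambda p}d\lambda$; 2. for every integer $m>\kappa_1$, every homogeneous polynomial $P_m$ of degree $m$ with complex coefficients and every $w\in C_0^\infty(\mathbb R^n)$, with $w_\varepsilon(x)=\varepsilon^{-n}w((x-x_0)/\varepsilon)$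 and $\hat w(\Theta,p)=\int_{x\cdot\Theta=p}w$ the Radon transform, $$\lim_{\varepsilon\to0+}\varepsilon^{m-\kappa_1}(f,P_m(\partial_x)w_\varepsilon)=\int_{\mathbb R}f_0(p)\,P_m(\Theta_0)\,\partial_p^m\hat w(\Theta_0,p)\,dp ;$$ 3. the leading singularity of $f$ at $x_0$ is $f(x_0+\varepsilon\check x)\sim\varepsilon^{\kappa_1}f_0(\check x\cdot\Theta_0)$. Here $f(x_0+\varepsilon\check x)\sim\varepsilon^a g(\check x)$, for a distribution $g$ on $\mathbb R^n$, means: there is $m_0\ge0$ such that $\lim_{\varepsilon\to0+}\varepsilon^{m-a}(f,P_m(\partial_x)w_\varepsilon)=(g,P_m(\partial_x)w)$ for all $m\ge m_0$, all homogeneous polynomials $P_m$ of degree $m$ and all $w\in C_0^\infty(\mathbb R^n)$. -/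

import Mathlib

open MeasureTheory Filter Topology TopologicalSpace
open scoped ContDiff Distributions LineDeriv RealInnerProductSpace

noncomputable section

namespace Conormal

/-- Euclidean space `ℝⁿ`. -/
abbrev E (n : ℕ) := EuclideanSpace ℝ (Fin n)

/-- The space `C₀^∞(ℝⁿ)` of complex-valued test functions, with its LF topology. -/
abbrev Test (n : ℕ) := 𝓓((⊤ : Opens (E n)), ℂ)

/-- The space `𝓓'(ℝⁿ)` of complex distributions. -/
abbrev Distr (n : ℕ) := Test n →L[ℂ] ℂ

/-- The distribution `φ ↦ ∫ g φ` of a locally integrable function `g` on `ℝⁿ`. -/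
def distrOfFun {n : ℕ} (g : E n → ℂ) : Distr n :=
  TestFunction.integralAgainstBilinCLM (ContinuousLinearMap.mul ℂ ℂ) volume g

theorem distrOfFun_apply {n : ℕ} {g : E n → ℂ} (hg : LocallyIntegrable g volume) (φ : Test n) :
    distrOfFun g φ = ∫ x, φ x * g x :=
  TestFunction.integralAgainstBilinCLM_eq_integral (hg.locallyIntegrableOn _)

/-! ### Differential operators and dilations on test functions -/

/-- The partial derivative `∂^ν w`, for a multi-index `ν`. -/
def multiDeriv {n : ℕ} (ν : Fin n →₀ ℕ) (w : Test n) : Test n :=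
  (List.finRange n).foldr
    (fun i g => (fun h : Test n => ∂_{(EuclideanSpace.single i (1 : ℝ) : E n)} h)^[ν i] g) w

/-- The constant coefficient differential operator `P(∂ₓ)`. -/
def polyDeriv {n : ℕ} (P : MvPolynomial (Fin n) ℂ) (w : Test n) : Test n :=
  ∑ ν ∈ P.support, P.coeff ν • multiDeriv ν w

theorem hasCompactSupport_dilate {n : ℕ} (x₀ : E n) {ε : ℝ} (hε : ε ≠ 0) (w : Test n) :
    HasCompactSupport (fun x : E n => ((ε ^ n)⁻¹ : ℝ) • w (ε⁻¹ • (x - x₀))) := by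
  have h := w.hasCompactSupport.comp_homeomorph
    ((Homeomorph.subRight x₀).trans (Homeomorph.smulOfNeZero ε⁻¹ (inv_ne_zero hε)))
  exact h.smul_left (f := fun _ => ((ε ^ n)⁻¹ : ℝ))

/-- `w_ε(x) = ε⁻ⁿ w((x - x₀)/ε)` for `ε ≠ 0` (and `0` for `ε = 0`). -/
def dilate {n : ℕ} (x₀ : E n) (ε : ℝ) (w : Test n) : Test n :=
  open scoped Classical in
  if hε : ε ≠ 0 then
    { toFun := fun x => ((ε ^ n)⁻¹ : ℝ) • w (ε⁻¹ • (x - x₀))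
      contDiff' := by
        have h := w.contDiff
        fun_prop
      hasCompactSupport' := hasCompactSupport_dilate x₀ hε w
      tsupport_subset' := fun _ _ => trivial }
  else 0

theorem dilate_apply {n : ℕ} (x₀ : E n) {ε : ℝ} (hε : ε ≠ 0) (w : Test n) (x : E n) :
    dilate x₀ ε w x = ((ε ^ n)⁻¹ : ℝ) • w (ε⁻¹ • (x - x₀)) := by
  simp [dilate, hε]

/-- `f₀` is the leading order singularity of `f` at `x₀`, with exponent `a`:
`f(x₀ + ε x̌) ∼ ε^a f₀(x̌)`. -/
def IsLeadingSingularity {n : ℕ} (f : Distr n) (x₀ : E n) (a : ℝ) (f₀ : Distr n) : Prop :=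
  ∃ m₀ : ℕ, ∀ m : ℕ, m₀ ≤ m → ∀ P : MvPolynomial (Fin n) ℂ, P.IsHomogeneous m →
    ∀ w : Test n,
      Tendsto (fun ε : ℝ => ((ε ^ ((m : ℝ) - a) : ℝ) : ℂ) * f (polyDeriv P (dilate x₀ ε w)))
        (𝓝[>] 0) (𝓝 (f₀ (polyDeriv P w)))

/-! ### Fourier and Radon transforms -/

/-- The Fourier transform `∫ w(x) e^{i ξ·x} dx` on `ℝⁿ`. -/
def fourier {n : ℕ} (w : E n → ℂ) (ξ : E n) : ℂ :=
  ∫ x, w x * Complex.exp (Complex.I * (⟪ξ, x⟫ : ℝ))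

/-- The inverse Fourier transform `(2π)⁻¹ ∫ φ(p) e^{-i λ p} dp` on `ℝ`. -/
def fourierInv₁ (φ : ℝ → ℂ) (lam : ℝ) : ℂ :=
  ((2 * Real.pi)⁻¹ : ℝ) * ∫ p : ℝ, φ p * Complex.exp (-Complex.I * (lam * p : ℝ))

/-- The Radon transform of `w` along the hyperplane `{x : x·θ = p}`, for a unit vector `θ`. -/
def radon {n : ℕ} (w : E n → ℂ) (θ : E n) (p : ℝ) : ℂ :=
  ∫ y : (Submodule.span ℝ {θ})ᗮ, w (p • θ + (y : E n))

/-- `f` is the oscillatory integral `(2π)⁻ⁿ ∫ v(ξ) e^{i(H(ξ) - ξ·x)} dξ`, as a distribution. -/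
def IsOscillatoryIntegral {n : ℕ} (v : E n → ℂ) (H : E n → ℝ) (f : Distr n) : Prop :=
  ∀ φ : Test n, f φ =
    (((2 * Real.pi) ^ n)⁻¹ : ℝ) *
      ∫ ξ, v ξ * Complex.exp (Complex.I * (H ξ : ℝ)) * fourier φ (-ξ)

/-! ### The reduced Hessian and the factor `ω` -/

/-- The Hessian of `H` at the unit vector `α`, restricted to the hyperplane through `α`
orthogonal to `α`, as a matrix in an orthonormal basis of `α^⊥`. -/
def hess {n : ℕ} (H : E n → ℝ) (α : E n) :
    Matrix (Fin (Module.finrank ℝ (Submodule.span ℝ {α})ᗮ))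
      (Fin (Module.finrank ℝ (Submodule.span ℝ {α})ᗮ)) ℝ :=
  Matrix.of fun i j =>
    fderiv ℝ (fderiv ℝ H) α
      (stdOrthonormalBasis ℝ (Submodule.span ℝ {α})ᗮ i : E n)
      (stdOrthonormalBasis ℝ (Submodule.span ℝ {α})ᗮ j : E n)

/-- The number of positive minus the number of negative eigenvalues (with multiplicity)
of a real symmetric matrix. -/
def signature {k : ℕ} (M : Matrix (Fin k) (Fin k) ℝ) : ℤ :=
  open scoped Classical in
  (M.charpoly.roots.countP (fun x => 0 < x) : ℤ) - (M.charpoly.roots.countP (fun x => x < 0) : ℤ)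

/-- `ω(α) = |det Ȟ''(α)|^{1/2} e^{-(iπ/4) sgn Ȟ''(α)} / (2π)^{(n-1)/2}`. -/
def omega {n : ℕ} (H : E n → ℝ) (α : E n) : ℂ :=
  (Real.sqrt |(hess H α).det| : ℂ) *
    Complex.exp (-(Complex.I * Real.pi / 4) * (signature (hess H α) : ℂ)) /
    (((2 * Real.pi) ^ (((n : ℝ) - 1) / 2) : ℝ) : ℂ)

/-! ### The polyhomogeneous amplitude -/

/-- The remainder `v(λα) - ω(α) ∑_{j<J} λ^{-s_j} v_j(α)`. -/
def remainder {n : ℕ} (H : E n → ℝ) (v : E n → ℂ) (s : ℕ → ℝ) (vc : ℕ → E n → ℂ) (J : ℕ)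
    (lam : ℝ) (α : E n) : ℂ :=
  v (lam • α) - omega H α * ∑ j ∈ Finset.range J, ((lam ^ (-(s j)) : ℝ) : ℂ) * vc j α

/-- The function `a` on the unit sphere belongs to `C₀^∞(Ω ∪ (-Ω))`. Only the values of `a` on the
unit sphere matter; smoothness is that of the extension of `a` of degree zero to `ℝⁿ ∖ 0`. -/
def IsSmoothCompactlySupportedIn {n : ℕ} (Ω : Set (E n)) (a : E n → ℂ) : Prop :=
  ContDiffOn ℝ ∞ (fun ξ : E n => a (‖ξ‖⁻¹ • ξ)) {0}ᶜ ∧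
    ∃ K : Set (E n), IsCompact K ∧ K ⊆ Ω ∪ (-Ω) ∧
      ∀ α ∈ Metric.sphere (0 : E n) 1, α ∉ K → a α = 0

/-- `v(λα) ∼ ω(α) ∑_j λ^{-s_j} v_j(α)` as `λ → ∞`, where the expansion can be differentiated in `λ`
and `α` any number of times and is uniform in `α`. The derivatives in `α` along the sphere are those
of the extension of degree zero to `ℝⁿ ∖ 0`. -/
def HasUniformExpansion {n : ℕ} (H : E n → ℝ) (v : E n → ℂ) (s : ℕ → ℝ)
    (vc : ℕ → E n → ℂ) : Prop :=
  ∀ J l k : ℕ, ∃ C : ℝ, ∀ lam : ℝ, 1 ≤ lam → ∀ α ∈ Metric.sphere (0 : E n) 1,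
    ‖iteratedFDeriv ℝ k
        (fun ξ : E n => iteratedDeriv l
          (fun t : ℝ => remainder H v s vc J t (‖ξ‖⁻¹ • ξ)) lam) α‖
      ≤ C * lam ^ (-(s J + l))

/-! ### The homogeneous distributions `λ_±^a` on the line -/

/-- The pairing `(λ_+^a, φ)`: the regularized value (Hadamard finite part) of `∫₀^∞ λ^a φ(λ) dλ`.
For `a ≠ -1, -2, …` it is the analytic continuation in `a`. -/
def powPlus (a : ℝ) (φ : ℝ → ℂ) : ℂ :=
  (∫ x in Set.Ioc (0 : ℝ) 1, ((x ^ a : ℝ) : ℂ) *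
      (φ x - ∑ j ∈ Finset.range ⌊-a⌋₊, iteratedDeriv j φ 0 * (x : ℂ) ^ j / (j.factorial : ℂ))) +
    (∑ j ∈ Finset.range ⌊-a⌋₊,
      if a + j + 1 = 0 then 0
      else iteratedDeriv j φ 0 / ((j.factorial : ℂ) * ((a + j + 1 : ℝ) : ℂ))) +
    ∫ x in Set.Ioi (1 : ℝ), ((x ^ a : ℝ) : ℂ) * φ x

/-- The pairing `(λ_-^a, φ)`, where `λ_-^a` is the reflection of `λ_+^a`. -/
def powMinus (a : ℝ) (φ : ℝ → ℂ) : ℂ := powPlus a (fun x => φ (-x))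

/-- The pairing with
`μ̃ = (2π)^{-(n-1)} (v₊ λ_+^{-(κ+1)} + v₋ λ_-^{-(κ+1)})`. -/
def muTilde (n : ℕ) (κ : ℝ) (vp vm : ℂ) (φ : ℝ → ℂ) : ℂ :=
  (((2 * Real.pi) ^ (n - 1))⁻¹ : ℝ) *
    (vp * powPlus (-(κ + 1)) φ + vm * powMinus (-(κ + 1)) φ)

/-! ### The leading singularity -/

/-- `f₀` for non-integer `κ`. -/
def f0NonInt (n : ℕ) (κ : ℝ) (vp vm : ℂ) (p : ℝ) : ℂ :=
  -1 / ((2 * (2 * Real.pi) ^ (n - 1) * Real.sin (Real.pi * κ) * Real.Gamma (κ + 1) : ℝ) : ℂ) *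
    (((max p 0 ^ κ : ℝ) : ℂ) *
        (Complex.exp (Complex.I * κ * (Real.pi / 2)) * vp +
          vm / Complex.exp (Complex.I * κ * (Real.pi / 2))) +
      ((max (-p) 0 ^ κ : ℝ) : ℂ) *
        (Complex.exp (Complex.I * κ * (Real.pi / 2)) * vm +
          vp / Complex.exp (Complex.I * κ * (Real.pi / 2))))

/-- `f₀` for the integer `κ = k`. -/
def f0Int (n k : ℕ) (vp : ℂ) (p : ℝ) : ℂ :=
  vp / (2 * (2 * Real.pi : ℂ) ^ (n - 1) * Complex.I ^ (k + 1) * (k.factorial : ℂ)) *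
    ((p ^ k * Real.sign p : ℝ) : ℂ)

/-- The three assertions about the leading singularity of `f` at `x₀` in the direction `θ`:
`f₀ = 𝓕⁻¹ μ̃` as tempered distributions; for every integer `m > κ`, every homogeneous `P` of degree
`m` and every test function `w`,
`ε^{m-κ} (f, P(∂)w_ε) → (f₀(p), P(θ) ∂_p^m ŵ(θ, p))`; and `f(x₀ + ε x̌) ∼ ε^κ f₀(x̌·θ)`. -/
def LeadingSingularityGivenBy {n : ℕ} (f : Distr n) (x₀ θ : E n) (κ : ℝ) (vp vm : ℂ)
    (f₀ : ℝ → ℂ) : Prop :=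
  (∀ φ : SchwartzMap ℝ ℂ, ∫ p : ℝ, f₀ p * φ p = muTilde n κ vp vm (fourierInv₁ φ)) ∧
  (∀ m : ℕ, ⌊κ⌋₊ + 1 ≤ m → ∀ P : MvPolynomial (Fin n) ℂ, P.IsHomogeneous m → ∀ w : Test n,
    Tendsto (fun ε : ℝ => ((ε ^ ((m : ℝ) - κ) : ℝ) : ℂ) * f (polyDeriv P (dilate x₀ ε w)))
      (𝓝[>] 0)
      (𝓝 (∫ p : ℝ, f₀ p *
        (MvPolynomial.eval (fun i => ((θ i : ℝ) : ℂ)) P * iteratedDeriv m (radon w θ) p)))) ∧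
  IsLeadingSingularity f x₀ κ (distrOfFun fun x : E n => f₀ ⟪x, θ⟫)

end Conormal

end

/-! Put ψ(ξ) = H(ξ) − ξ·x₀ and let F be the Fourier transform of w, a Schwartz function. On the
Fourier side (f, P(∂)w_ε) equals (2π)⁻ⁿ iᵐ ∫ v P e^{iψ} F(εξ) dξ
(`IsOscillatoryIntegral.polyDeriv_dilate`). Everything therefore rests on the behaviour as ε → 0 of
such integrals with a weight q homogeneous of degree m; the claim about them is `HasRayLimit`.

For large m, insert a finite piece of the expansion of v. The remainder is negligible by absolute
estimates (`TemperedAmplitude.tendsto_zero`). Each remaining term is homogeneous, so the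
substitution ξ → ξ/ε turns it into an integral with phase Λψ, Λ = 1/ε. As ψ has degree one, its
critical points fill rays, and in the support of the amplitude these are the rays through ±Θ only.
Away from them one integrates by parts along ψ'/|ψ'|² (`nonstationary_phase`); a large degree makes
the amplitude vanish at the origin to an order that lets this pass through the singular point. Near
a critical ray write ξ = t(θ + y) with y ⊥ θ and integrate in t first: the result decays in Λψ(θ +
y), so the substitution y = Λ^{-1/2} z and dominated convergence replace ψ by its quadratic part,
with no Morse lemma (`stationary_phase_near`). The model integral is a Fresnel integral (`fresnel`),
whose constant is cancelled by ω (`rayTerm_amp`). Since H is odd, the Hessian at -Θ is the negative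
of that at Θ, and the two rays carry conjugate phases.

For the remaining m > κ one descends: differentiating in ε raises the degree of the weight by one,
and an asymptotic law for the derivative integrates to one for the function (`HasRayLimit.of_succ`).
This works exactly while the power m − κ is positive.

The limit consists of the moments ∫ t^{m-κ-1} F(±tΘ) dt. It is μ̃ paired with λᵐ F(λΘ), up to
constants, because the factor λᵐ makes the finite part an ordinary integral (`muTilde_fourierInv₁`).
By the slice theorem F(λΘ) is the Fourier transform of the Radon transform of w, so assertion 2
follows once 𝓕⁻¹μ̃ = f₀ is known.

That identity is a computation on the line. For exponents in (-1, 0) it is the Laplace transform of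
a power on the imaginary axis; integration by parts in the finite part reaches the other non-integer
exponents (`powPlus_deriv`, `powPlus_fourierS`). For integer κ the integration by parts leaves an
extra term, which cancels in the combination selected by v₋ = (-1)^{κ+1} v₊ (`oddPart_succ`).
Assertion 3 is assertion 2 after Fubini over the hyperplanes x·Θ = p (`radon_polyDeriv`). -/

noncomputable section

namespace Conormal

open scoped SchwartzMap

/-! ### Homogeneous symbols -/

section HomSymb

variable {n : ℕ} {A : Type*} [NormedAddCommGroup A] [NormedSpace ℝ A]

/-- `b` is smooth away from the origin and positively homogeneous of degree `d`. -/
structure HomSymb (d : ℝ) (b : E n → A) : Prop where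
  smooth : ContDiffOn ℝ ∞ b {0}ᶜ
  hom : ∀ t : ℝ, 0 < t → ∀ ξ, b (t • ξ) = (t ^ d : ℝ) • b ξ

/-- The `k`-th vector of the standard basis. -/
abbrev stdVec (k : Fin n) : E n := EuclideanSpace.single k 1

theorem HomSymb.contDiffAt {d : ℝ} {b : E n → A} (hb : HomSymb d b) {ξ : E n} (hξ : ξ ≠ 0) :
    ContDiffAt ℝ ∞ b ξ :=
  hb.smooth.contDiffAt (isOpen_compl_singleton.mem_nhds hξ)

theorem HomSymb.of_contDiffAt {d : ℝ} {b : E n → A} (h : ∀ ξ, ξ ≠ 0 → ContDiffAt ℝ ∞ b ξ)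
    (hom : ∀ t : ℝ, 0 < t → ∀ ξ, b (t • ξ) = (t ^ d : ℝ) • b ξ) : HomSymb d b :=
  ⟨fun ξ hξ => (h ξ hξ).contDiffWithinAt, hom⟩

theorem HomSymb.differentiableAt {d : ℝ} {b : E n → A} (hb : HomSymb d b) {ξ : E n}
    (hξ : ξ ≠ 0) : DifferentiableAt ℝ b ξ :=
  (hb.contDiffAt hξ).differentiableAt (by simp)

theorem HomSymb.map_zero {d : ℝ} {b : E n → A} (hb : HomSymb d b) (hd : d ≠ 0) : b 0 = 0 := by
  have h := hb.hom 2 two_pos 0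
  rw [smul_zero] at h
  have h2 : ((2 : ℝ) ^ d - 1) • b 0 = 0 := by rw [sub_smul, one_smul, ← h, sub_self]
  rcases smul_eq_zero.1 h2 with h3 | h3
  · exfalso
    have : (2 : ℝ) ^ d = 2 ^ (0 : ℝ) := by rw [Real.rpow_zero]; linarith
    exact hd ((Real.rpow_right_inj (by norm_num) (by norm_num)).1 this)
  · exact h3

theorem HomSymb.eq_norm_smul {d : ℝ} {b : E n → A} (hb : HomSymb d b) {ξ : E n} (hξ : ξ ≠ 0) :
    b ξ = (‖ξ‖ ^ d : ℝ) • b (‖ξ‖⁻¹ • ξ) := by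
  rw [← hb.hom _ (norm_pos_iff.2 hξ), smul_smul, mul_inv_cancel₀ (norm_ne_zero_iff.2 hξ), one_smul]

theorem HomSymb.norm_le {d : ℝ} {b : E n → A} (hb : HomSymb d b) :
    ∃ C : ℝ, 0 ≤ C ∧ ∀ ξ, ξ ≠ 0 → ‖b ξ‖ ≤ C * ‖ξ‖ ^ d := by
  have hc : ContinuousOn b (Metric.sphere (0 : E n) 1) :=
    hb.smooth.continuousOn.mono fun x hx => by
      rintro rfl
      simp at hx
  obtain ⟨C, hC⟩ := (isCompact_sphere (0 : E n) 1).exists_bound_of_continuousOn hc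
  refine ⟨max C 0, le_max_right _ _, fun ξ hξ => ?_⟩
  rw [hb.eq_norm_smul hξ, norm_smul, Real.norm_of_nonneg (by positivity), mul_comm]
  gcongr
  exact (hC _ (by simp [norm_smul, norm_ne_zero_iff.2 hξ])).trans (le_max_left _ _)

theorem HomSymb.smul {d d' : ℝ} {c : E n → ℝ} {b : E n → A} (hc : HomSymb d c)
    (hb : HomSymb d' b) : HomSymb (d + d') (fun ξ => c ξ • b ξ) := by
  refine ⟨hc.smooth.smul hb.smooth, fun t ht ξ => ?_⟩
  rw [hc.hom t ht, hb.hom t ht, Real.rpow_add ht, smul_eq_mul, smul_smul, smul_smul]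
  ring_nf

theorem HomSymb.mul {d d' : ℝ} {c b : E n → ℂ} (hc : HomSymb d c)
    (hb : HomSymb d' b) : HomSymb (d + d') (fun ξ => c ξ * b ξ) := by
  refine ⟨hc.smooth.mul hb.smooth, fun t ht ξ => ?_⟩
  rw [hc.hom t ht, hb.hom t ht, Real.rpow_add ht, smul_mul_smul_comm]

/-- Differentiate b(tξ) = t^d b(ξ) in ξ. Homogeneity is demanded at the origin too, where b need not
be differentiable, so only rules for `fderiv` that hold without differentiability are used for it.
-/
theorem HomSymb.fderiv_apply {d : ℝ} {b : E n → A} (hb : HomSymb d b) (v : E n) :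
    HomSymb (d - 1) (fun ξ => fderiv ℝ b ξ v) := by
  refine ⟨?_, fun t ht ξ => ?_⟩
  · intro ξ hξ
    have h := (hb.contDiffAt hξ).fderiv_right (m := ∞) (by simp)
    exact (h.clm_apply contDiffAt_const).contDiffWithinAt
  · have h1 : (fun ξ => b (t • ξ)) = fun ξ => (t ^ d : ℝ) • b ξ := funext (hb.hom t ht)
    have h2 := fderiv_comp_smul (𝕜 := ℝ) (f := b) (x := ξ) t
    have h3 : fderiv ℝ (fun ξ => (t ^ d : ℝ) • b ξ) ξ = (t ^ d : ℝ) • fderiv ℝ b ξ := by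
      exact congrFun (fderiv_const_smul_field (𝕜 := ℝ) (R := ℝ) (t ^ d) (f := b)) ξ
    have h4 : (t ^ d : ℝ) • fderiv ℝ b ξ = t • fderiv ℝ b (t • ξ) := by rw [← h3, ← h2, ← h1]
    have h5 : fderiv ℝ b (t • ξ) = (t ^ (d - 1) : ℝ) • fderiv ℝ b ξ := by
      rw [Real.rpow_sub_one ht.ne', div_eq_inv_mul, mul_smul, h4, smul_smul,
        inv_mul_cancel₀ ht.ne', one_smul]
    simp [h5]

/-- Gives differentiability at the singular point of a homogeneous symbol of degree at least 2, so
that integration by parts over all of ℝⁿ needs no excised ball. -/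
theorem hasFDerivAt_zero_of_norm_le_rpow {d C : ℝ} (hd : 2 ≤ d) {f : E n → ℂ}
    (hf : ∀ x, ‖f x‖ ≤ C * ‖x‖ ^ d) : HasFDerivAt f (0 : E n →L[ℝ] ℂ) 0 := by
  have h0 : f 0 = 0 := by
    have := hf 0
    rw [norm_zero, Real.zero_rpow (by linarith), mul_zero] at this
    exact norm_le_zero_iff.1 this
  have hb : f =O[𝓝 0] fun x => ‖x - 0‖ ^ 2 := by
    refine Asymptotics.IsBigO.of_bound |C| ?_
    filter_upwards [Metric.ball_mem_nhds (0 : E n) one_pos] with x hx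
    have hx1 : ‖x‖ < 1 := by simpa using hx
    refine (hf x).trans ?_
    rw [sub_zero, Real.norm_of_nonneg (by positivity)]
    have : ‖x‖ ^ d ≤ ‖x‖ ^ 2 := by
      rw [← Real.rpow_natCast]
      exact Real.rpow_le_rpow_of_exponent_ge_of_imp (norm_nonneg _) hx1.le (by exact_mod_cast hd)
        (by intros; linarith)
    exact mul_le_mul (le_abs_self C) this (by positivity) (abs_nonneg _)
  exact hb.hasFDerivAt (by norm_num)

theorem rpow_le_one_add_pow {x d : ℝ} (hx : 0 ≤ x) (hd : 0 ≤ d) : x ^ d ≤ 1 + x ^ ⌈d⌉₊ := by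
  rcases le_total x 1 with h | h
  · exact (Real.rpow_le_one hx h hd).trans (by linarith [pow_nonneg hx ⌈d⌉₊])
  · have : x ^ d ≤ x ^ (⌈d⌉₊ : ℝ) := Real.rpow_le_rpow_of_exponent_le h (Nat.le_ceil d)
    rw [Real.rpow_natCast] at this
    linarith

theorem integrable_rpow_mul_norm (F : 𝓢(E n, ℂ)) {d : ℝ} (hd : 0 ≤ d) :
    Integrable (fun ξ => ‖ξ‖ ^ d * ‖F ξ‖) := by
  refine ((F.integrable_pow_mul volume 0).add (F.integrable_pow_mul volume ⌈d⌉₊)).mono' ?_ ?_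
  · have := F.continuous
    exact ((continuous_norm.rpow_const fun _ => Or.inr hd).mul this.norm).aestronglyMeasurable
  · refine Eventually.of_forall fun ξ => ?_
    rw [Real.norm_of_nonneg (by positivity)]
    have := rpow_le_one_add_pow (norm_nonneg ξ) hd
    simp only [pow_zero, one_mul, Pi.add_apply]
    nlinarith [norm_nonneg (F ξ)]

theorem ae_ne_zero (hn : n ≠ 0) : ∀ᵐ ξ : E n, ξ ≠ 0 := by
  have : Nonempty (Fin n) := Fin.pos_iff_nonempty.1 (Nat.pos_of_ne_zero hn)
  exact Measure.ae_ne volume 0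

theorem aestronglyMeasurable_of_continuousOn (hn : n ≠ 0) {f : E n → ℂ}
    (hf : ContinuousOn f {0}ᶜ) : AEStronglyMeasurable f := by
  have h := hf.aestronglyMeasurable (μ := volume) (measurableSet_singleton (0 : E n)).compl
  have h2 : (volume : Measure (E n)).restrict {0}ᶜ = volume :=
    Measure.restrict_eq_self_of_ae_mem (ae_ne_zero hn)
  rwa [h2] at h

theorem HomSymb.integrable_mul (hn : n ≠ 0) {d : ℝ} {b : E n → ℂ} (hb : HomSymb d b)
    (hd : 0 ≤ d) (F : 𝓢(E n, ℂ)) {g : E n → ℂ} (hg : AEStronglyMeasurable g)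
    (hg1 : ∀ ξ, ‖g ξ‖ ≤ 1) : Integrable (fun ξ => b ξ * F ξ * g ξ) := by
  obtain ⟨C, hC, hbC⟩ := hb.norm_le
  refine ((integrable_rpow_mul_norm F hd).const_mul C).mono' ?_ ?_
  · exact ((aestronglyMeasurable_of_continuousOn hn hb.smooth.continuousOn).mul
      F.continuous.aestronglyMeasurable).mul hg
  · filter_upwards [ae_ne_zero hn] with ξ hξ
    rw [norm_mul, norm_mul]
    calc ‖b ξ‖ * ‖F ξ‖ * ‖g ξ‖ ≤ (C * ‖ξ‖ ^ d) * ‖F ξ‖ * 1 := by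
          gcongr
          · exact hbC ξ hξ
          · exact hg1 ξ
      _ = _ := by ring

/-- The oscillating factor `e^{iΛψ}`. -/
def osc (ψ : E n → ℝ) (Λ : ℝ) (ξ : E n) : ℂ := Complex.exp (Complex.I * (Λ * ψ ξ : ℝ))

theorem norm_osc (ψ : E n → ℝ) (Λ : ℝ) (ξ : E n) : ‖osc ψ Λ ξ‖ = 1 := by
  rw [osc, mul_comm, Complex.norm_exp_ofReal_mul_I]

theorem HomSymb.aestronglyMeasurable_osc (hn : n ≠ 0) {d : ℝ} {ψ : E n → ℝ} (hψ : HomSymb d ψ)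
    (Λ : ℝ) : AEStronglyMeasurable (osc ψ Λ) := by
  refine aestronglyMeasurable_of_continuousOn hn ?_
  have := hψ.smooth.continuousOn
  unfold osc
  fun_prop

theorem HomSymb.hasFDerivAt_osc {d : ℝ} {ψ : E n → ℝ} (hψ : HomSymb d ψ) (Λ : ℝ) {ξ : E n}
    (hξ : ξ ≠ 0) :
    HasFDerivAt (osc ψ Λ)
      ((osc ψ Λ ξ * (Complex.I * Λ)) • Complex.ofRealCLM.comp (fderiv ℝ ψ ξ)) ξ := by
  have h1 : HasFDerivAt (fun ξ => ((ψ ξ : ℝ) : ℂ)) (Complex.ofRealCLM.comp (fderiv ℝ ψ ξ)) ξ :=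
    Complex.ofRealCLM.hasFDerivAt.comp ξ (hψ.differentiableAt hξ).hasFDerivAt
  have h2 := (h1.const_mul (Complex.I * Λ)).cexp
  have h3 : osc ψ Λ = fun ξ => Complex.exp (Complex.I * Λ * (ψ ξ : ℂ)) := by
    funext x
    simp [osc, mul_assoc]
  rw [h3]
  convert! h2 using 1
  simp [smul_smul]

/-! ### Non-stationary phase -/

/-- The squared length of the gradient. -/
def gradSq (ψ : E n → ℝ) (ξ : E n) : ℝ := ∑ k, (fderiv ℝ ψ ξ (stdVec k)) ^ 2

theorem gradSq_eq_zero {ψ : E n → ℝ} {ξ : E n} : gradSq ψ ξ = 0 ↔ fderiv ℝ ψ ξ = 0 := by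
  constructor
  · intro h
    have h1 := (Finset.sum_eq_zero_iff_of_nonneg fun k _ => sq_nonneg _).1 h
    refine ContinuousLinearMap.coe_injective
      ((EuclideanSpace.basisFun (Fin n) ℝ).toBasis.ext fun k => ?_)
    have h2 : fderiv ℝ ψ ξ (stdVec k) = 0 := pow_eq_zero_iff two_ne_zero |>.1 (h1 k (Finset.mem_univ k))
    have h3 : (EuclideanSpace.basisFun (Fin n) ℝ).toBasis k = stdVec k := by
      rw [OrthonormalBasis.coe_toBasis, EuclideanSpace.basisFun_apply]
    rw [h3]
    exact h2
  · intro h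
    rw [gradSq, h]
    exact Finset.sum_eq_zero fun k _ => by rw [zero_apply, zero_pow two_ne_zero]

/-- The product of `b` and the `k`-th component of `ψ'/|ψ'|²`. -/
def nsp (ψ : E n → ℝ) (b : E n → ℂ) (k : Fin n) (ξ : E n) : ℂ :=
  (fderiv ℝ ψ ξ (stdVec k) / gradSq ψ ξ) • b ξ

/-- Smoothness survives at critical points because b vanishes near them. The degree stays d because
ψ' and |ψ'|² have degree 0. -/
theorem HomSymb.nsp {ψ : E n → ℝ} (hψ : HomSymb 1 ψ) {d : ℝ} {b : E n → ℂ} (hb : HomSymb d b)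
    (hv : ∀ ξ, ξ ≠ 0 → fderiv ℝ ψ ξ = 0 → b =ᶠ[𝓝 ξ] 0) (k : Fin n) :
    HomSymb d (nsp ψ b k) := by
  have hS : ∀ ξ : E n, ξ ≠ 0 → ContDiffAt ℝ ∞ (gradSq ψ) ξ := fun ξ hξ => by
    unfold gradSq
    exact ContDiffAt.sum fun j _ => ((hψ.fderiv_apply (stdVec j)).contDiffAt hξ).pow 2
  refine HomSymb.of_contDiffAt (fun ξ hξ => ?_) fun t ht ξ => ?_
  · by_cases h : fderiv ℝ ψ ξ = 0
    · refine (contDiffAt_const (c := (0 : ℂ))).congr_of_eventuallyEq ?_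
      filter_upwards [hv ξ hξ h] with x hx
      simp [Conormal.nsp, hx]
    · exact (((hψ.fderiv_apply (stdVec k)).contDiffAt hξ).div (hS ξ hξ)
        (fun h0 => h (gradSq_eq_zero.1 h0))).smul (hb.contDiffAt hξ)
  · have h1 : ∀ j : Fin n, fderiv ℝ ψ (t • ξ) (stdVec j) = fderiv ℝ ψ ξ (stdVec j) := fun j => by
      have := (hψ.fderiv_apply (stdVec j)).hom t ht ξ
      simpa using this
    simp only [Conormal.nsp, gradSq, h1, hb.hom t ht]
    rw [smul_comm]

theorem sum_nsp {ψ : E n → ℝ} {b : E n → ℂ} {ξ : E n} (h : fderiv ℝ ψ ξ = 0 → b ξ = 0) :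
    ∑ k, nsp ψ b k ξ * (fderiv ℝ ψ ξ (stdVec k) : ℂ) = b ξ := by
  by_cases h0 : fderiv ℝ ψ ξ = 0
  · rw [h h0]
    exact Finset.sum_eq_zero fun k _ => by rw [nsp, h h0, smul_zero, zero_mul]
  · have hS : (gradSq ψ ξ : ℂ) ≠ 0 := by
      exact_mod_cast fun h' => h0 (gradSq_eq_zero.1 h')
    have (k : Fin n) : nsp ψ b k ξ * (fderiv ℝ ψ ξ (stdVec k) : ℂ) =
        ((fderiv ℝ ψ ξ (stdVec k) : ℂ)) ^ 2 * (b ξ / gradSq ψ ξ) := by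
      simp only [nsp, Complex.real_smul, Complex.ofReal_div]
      ring
    rw [Finset.sum_congr rfl fun k _ => this k, ← Finset.sum_mul, mul_comm, div_mul_eq_mul_div, div_eq_iff hS]
    simp [gradSq]

/-- The integral of the divergence of the vector field b ψ'/|ψ'|² F e^{iΛψ} is zero. When the
derivative falls on the exponential it returns iΛ b F e^{iΛψ}; the other two terms form the
right-hand side. -/
theorem integral_nsp {ψ : E n → ℝ} (hn : n ≠ 0) (hψ : HomSymb 1 ψ) {d : ℝ} (hd : 2 ≤ d)
    {b : E n → ℂ} (hb : HomSymb d b)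
    (hv : ∀ ξ, ξ ≠ 0 → fderiv ℝ ψ ξ = 0 → b =ᶠ[𝓝 ξ] 0) (F : 𝓢(E n, ℂ)) (Λ : ℝ) :
    Complex.I * Λ * ∫ ξ, b ξ * F ξ * osc ψ Λ ξ =
      -∑ k, ((∫ ξ, fderiv ℝ (nsp ψ b k) ξ (stdVec k) * F ξ * osc ψ Λ ξ) +
        ∫ ξ, nsp ψ b k ξ * (∂_{(stdVec k : E n)} F) ξ * osc ψ Λ ξ) := by
  have hc := fun k => hψ.nsp hb hv k
  have ho := hψ.aestronglyMeasurable_osc hn Λ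
  have ho1 := fun ξ => (norm_osc ψ Λ ξ).le
  have hu : ∀ k, ∫ ξ, fderiv ℝ (fun ξ => nsp ψ b k ξ * F ξ * osc ψ Λ ξ) ξ (stdVec k) = 0 ∧
      (∫ ξ, fderiv ℝ (fun ξ => nsp ψ b k ξ * F ξ * osc ψ Λ ξ) ξ (stdVec k)) =
      (∫ ξ, fderiv ℝ (nsp ψ b k) ξ (stdVec k) * F ξ * osc ψ Λ ξ) +
      (∫ ξ, nsp ψ b k ξ * (∂_{(stdVec k : E n)} F) ξ * osc ψ Λ ξ) +
      ∫ ξ, (fderiv ℝ ψ ξ (stdVec k) • nsp ψ b k ξ) * F ξ * osc ψ Λ ξ * (Complex.I * Λ) := by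
    intro k
    have hdiff : ∀ ξ : E n, ξ ≠ 0 → HasFDerivAt (fun ξ => nsp ψ b k ξ * F ξ * osc ψ Λ ξ)
      ((nsp ψ b k ξ * F ξ) • ((osc ψ Λ ξ * (Complex.I * Λ)) •
          Complex.ofRealCLM.comp (fderiv ℝ ψ ξ)) +
        osc ψ Λ ξ • (nsp ψ b k ξ • fderiv ℝ F ξ + F ξ • fderiv ℝ (nsp ψ b k) ξ)) ξ := fun ξ hξ =>
      (((hc k).differentiableAt hξ).hasFDerivAt.mul (F.hasFDerivAt ξ)).mul
        (hψ.hasFDerivAt_osc Λ hξ)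
    -- Away from 0 differentiability is clear. At 0 it comes from the bound |x|^d with d ≥ 2.
    have hdiff0 : DifferentiableAt ℝ (fun ξ => nsp ψ b k ξ * F ξ * osc ψ Λ ξ) 0 := by
      obtain ⟨C, hC, hbC⟩ := (hc k).norm_le
      obtain ⟨M, hM⟩ : ∃ M : ℝ, ∀ x, ‖F x‖ ≤ M := ⟨_, F.norm_le_seminorm ℝ⟩
      refine (hasFDerivAt_zero_of_norm_le_rpow (d := d) (C := C * M) hd fun x => ?_).differentiableAt
      rw [norm_mul, norm_mul, norm_osc, mul_one]
      have hM0 : 0 ≤ M := (norm_nonneg _).trans (hM 0)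
      by_cases hx : x = 0
      · rw [hx, (hc k).map_zero (by linarith), norm_zero, zero_mul]
        positivity
      · calc ‖nsp ψ b k x‖ * ‖F x‖ ≤ (C * ‖x‖ ^ d) * M := by
              gcongr
              exacts [hbC x hx, hM x]
          _ = _ := by ring
    have hi1 := ((hc k).fderiv_apply (stdVec k)).integrable_mul hn (by linarith) F ho ho1
    have hi2 := (hc k).integrable_mul hn (by linarith) (∂_{(stdVec k : E n)} F) ho ho1
    have hi3 := (((hψ.fderiv_apply (stdVec k)).smul (hc k)).integrable_mul hn
      (by linarith) F ho ho1).mul_const (Complex.I * Λ)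
    have hae : (fun ξ => fderiv ℝ (fun ξ => nsp ψ b k ξ * F ξ * osc ψ Λ ξ) ξ (stdVec k)) =ᵐ[volume]
        fun ξ => fderiv ℝ (nsp ψ b k) ξ (stdVec k) * F ξ * osc ψ Λ ξ +
          nsp ψ b k ξ * (∂_{(stdVec k : E n)} F) ξ * osc ψ Λ ξ +
          (fderiv ℝ ψ ξ (stdVec k) • nsp ψ b k ξ) * F ξ * osc ψ Λ ξ * (Complex.I * Λ) := by
      filter_upwards [ae_ne_zero hn] with ξ hξ
      rw [(hdiff ξ hξ).fderiv]
      simp only [add_apply, smul_apply,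
        ContinuousLinearMap.comp_apply, Complex.ofRealCLM_apply, smul_eq_mul, Complex.real_smul,
        SchwartzMap.lineDerivOp_apply_eq_fderiv]
      ring
    constructor
    · have h := integral_mul_fderiv_eq_neg_fderiv_mul_of_integrable (μ := (volume : Measure (E n)))
        (f := fun ξ => nsp ψ b k ξ * F ξ * osc ψ Λ ξ) (g := fun _ => (1 : ℂ)) (v := stdVec k)
        ?_ (by simp) ?_ ?_ ?_
      · simpa using h
      · simp only [mul_one]
        exact ((hi1.add hi2).add hi3).congr hae.symm
      · simp only [mul_one]
        exact (hc k).integrable_mul hn (by linarith) F ho ho1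
      · intro x _
        by_cases hx : x = 0
        · rw [hx]
          exact hdiff0
        · exact (hdiff x hx).differentiableAt
      · intros
        exact differentiableAt_const _
    · rw [integral_congr_ae hae, ← integral_add hi1 hi2]
      exact integral_add (hi1.add hi2) hi3
  have h3 : ∑ k, ∫ ξ, (fderiv ℝ ψ ξ (stdVec k) • nsp ψ b k ξ) * F ξ * osc ψ Λ ξ *
      (Complex.I * Λ) = Complex.I * Λ * ∫ ξ, b ξ * F ξ * osc ψ Λ ξ := by
    rw [← integral_finsetSum, ← integral_const_mul]
    · refine integral_congr_ae ?_
      filter_upwards [ae_ne_zero hn] with ξ hξ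
      have h4 := sum_nsp (ψ := ψ) (b := b) (ξ := ξ) fun h => (hv ξ hξ h).self_of_nhds
      rw [← Finset.sum_mul, ← Finset.sum_mul, ← Finset.sum_mul]
      have h5 : ∑ k, fderiv ℝ ψ ξ (stdVec k) • nsp ψ b k ξ = b ξ := by
        refine Eq.trans ?_ h4
        refine Finset.sum_congr rfl fun k _ => ?_
        rw [Complex.real_smul, mul_comm]
      rw [h5]
      ring
    · intro k _
      exact (((hψ.fderiv_apply (stdVec k)).smul (hc k)).integrable_mul hn
        (by linarith) F ho ho1).mul_const (Complex.I * Λ)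
  rw [← h3, ← Finset.sum_neg_distrib]
  refine Finset.sum_congr rfl fun k _ => ?_
  have h4 := hu k
  rw [h4.1] at h4
  linear_combination -h4.2

/-- Each integration by parts gains Λ⁻¹ and lowers the degree by at most one. With d ≥ N + 1 the
degree is at least 2 whenever `integral_nsp` is applied and at least 1 when the absolute bound is
taken. -/
theorem nonstationary_phase {ψ : E n → ℝ} (hn : n ≠ 0) (hψ : HomSymb 1 ψ) (N : ℕ) :
    ∀ (d : ℝ), (N : ℝ) + 1 ≤ d → ∀ b : E n → ℂ, HomSymb d b →
      (∀ ξ, ξ ≠ 0 → fderiv ℝ ψ ξ = 0 → b =ᶠ[𝓝 ξ] 0) → ∀ F : 𝓢(E n, ℂ),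
      ∃ C : ℝ, ∀ Λ : ℝ, 0 < Λ → Λ ^ N * ‖∫ ξ, b ξ * F ξ * osc ψ Λ ξ‖ ≤ C := by
  induction N with
  | zero =>
    intro d hd b hb _ F
    refine ⟨∫ ξ, ‖b ξ * F ξ‖, fun Λ _ => ?_⟩
    rw [pow_zero, one_mul]
    refine (norm_integral_le_integral_norm _).trans_eq ?_
    simp only [norm_mul, norm_osc, mul_one]
  | succ N ih =>
    intro d hd b hb hv F
    push_cast at hd
    have hN : (0 : ℝ) ≤ N := N.cast_nonneg
    have hvk : ∀ k, ∀ ξ, ξ ≠ 0 → fderiv ℝ ψ ξ = 0 → nsp ψ b k =ᶠ[𝓝 ξ] 0 := fun k ξ hξ h => by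
      filter_upwards [hv ξ hξ h] with x hx
      simp [nsp, hx]
    choose C1 hC1 using fun k => ih (d - 1) (by linarith) _
      ((hψ.nsp hb hv k).fderiv_apply (stdVec k)) (fun ξ hξ h => by
        filter_upwards [(hvk k ξ hξ h).fderiv (𝕜 := ℝ)] with x hx
        simp [hx]) F
    choose C2 hC2 using fun k => ih d (by linarith) _ (hψ.nsp hb hv k) (hvk k)
      (∂_{(stdVec k : E n)} F)
    refine ⟨∑ k, (C1 k + C2 k), fun Λ hΛ => ?_⟩
    have h := congrArg norm (integral_nsp hn hψ (by linarith) hb hv F Λ)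
    rw [norm_mul, norm_mul, Complex.norm_I, one_mul, Complex.norm_real,
      Real.norm_of_nonneg hΛ.le, norm_neg] at h
    rw [pow_succ, mul_assoc, h]
    refine (mul_le_mul_of_nonneg_left (norm_sum_le _ _) (by positivity)).trans ?_
    rw [Finset.mul_sum]
    refine Finset.sum_le_sum fun k _ => ?_
    refine (mul_le_mul_of_nonneg_left (norm_add_le _ _) (by positivity)).trans ?_
    rw [mul_add]
    exact add_le_add (hC1 k Λ hΛ) (hC2 k Λ hΛ)

end HomSymb

end Conormal

namespace Conormal

open scoped SchwartzMap

/-! ### Orthogonal decomposition along a unit vector -/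

section Decomposition

variable {n : ℕ}

/-- The hyperplane orthogonal to `θ`. -/
abbrev Hyp (θ : E n) : Submodule ℝ (E n) := (Submodule.span ℝ {θ})ᗮ

theorem inner_hyp (θ : E n) (y : Hyp θ) : ⟪θ, (y : E n)⟫ = 0 :=
  (Submodule.mem_orthogonal_singleton_iff_inner_right.1 y.2)

theorem finrank_hyp (hn : n ≠ 0) {θ : E n} (hθ : ‖θ‖ = 1) : Module.finrank ℝ (Hyp θ) = n - 1 := by
  have : Fact (Module.finrank ℝ (E n) = (n - 1) + 1) :=
    ⟨by rw [finrank_euclideanSpace_fin]; omega⟩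
  exact Submodule.finrank_orthogonal_span_singleton (by rintro rfl; simp at hθ)

/-- The measurable equivalence `(t, u) ↦ t θ + u`. -/
def splitEquiv (θ : E n) (hθ : ‖θ‖ = 1) : ℝ × Hyp θ ≃ᵐ E n :=
  ((LinearIsometryEquiv.toSpanUnitSingleton θ hθ).toHomeomorph.toMeasurableEquiv.prodCongr
    (MeasurableEquiv.refl (Hyp θ))).trans
  ((MeasurableEquiv.toLp 2 (Submodule.span ℝ {θ} × Hyp θ)).trans
    (Submodule.span ℝ {θ}).orthogonalDecomposition.symm.toHomeomorph.toMeasurableEquiv)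

theorem splitEquiv_apply (θ : E n) (hθ : ‖θ‖ = 1) (p : ℝ × Hyp θ) :
    splitEquiv θ hθ p = p.1 • θ + (p.2 : E n) := by
  simp [splitEquiv, MeasurableEquiv.prodCongr]

theorem measurePreserving_splitEquiv (θ : E n) (hθ : ‖θ‖ = 1) :
    MeasurePreserving (splitEquiv θ hθ) (volume.prod volume) volume := by
  refine MeasurePreserving.trans (β := Submodule.span ℝ {θ} × Hyp θ) (μb := volume.prod volume)
    ?_ ?_
  · exact (LinearIsometryEquiv.toSpanUnitSingleton θ hθ).measurePreserving.prod
      (MeasurePreserving.id volume)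
  · exact MeasurePreserving.trans (WithLp.volume_preserving_toLp _ _)
      (Submodule.span ℝ {θ}).orthogonalDecomposition.symm.measurePreserving

theorem integrable_split {θ : E n} (hθ : ‖θ‖ = 1) {f : E n → ℂ} (hf : Integrable f) :
    Integrable (fun p : ℝ × Hyp θ => f (p.1 • θ + (p.2 : E n))) (volume.prod volume) := by
  have h := ((measurePreserving_splitEquiv θ hθ).integrable_comp_emb
    (splitEquiv θ hθ).measurableEmbedding (g := f)).2 hf
  simpa only [Function.comp_def, splitEquiv_apply] using h

theorem integral_split_prod {θ : E n} (hθ : ‖θ‖ = 1) (f : E n → ℂ) :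
    ∫ ξ, f ξ = ∫ p : ℝ × Hyp θ, f (p.1 • θ + (p.2 : E n)) ∂(volume.prod volume) := by
  rw [← (measurePreserving_splitEquiv θ hθ).integral_comp (splitEquiv θ hθ).measurableEmbedding f]
  simp only [splitEquiv_apply]

theorem integral_split {θ : E n} (hθ : ‖θ‖ = 1) {f : E n → ℂ} (hf : Integrable f) :
    ∫ ξ, f ξ = ∫ t : ℝ, ∫ u : Hyp θ, f (t • θ + (u : E n)) := by
  rw [integral_split_prod hθ, integral_prod _ (integrable_split hθ hf)]

/-- The substitution u = t y on each slice turns the slices into rays through the affine hyperplane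
θ + θ^⊥. The slice t = 0 has measure zero. -/
theorem integral_split_cone {θ : E n} (hθ : ‖θ‖ = 1) {f : E n → ℂ} (hf : Integrable f) :
    ∫ ξ, f ξ = ∫ t : ℝ, ∫ y : Hyp θ, (|t| ^ Module.finrank ℝ (Hyp θ) : ℝ) • f (t • (θ + (y : E n))) := by
  rw [integral_split hθ hf]
  refine integral_congr_ae ?_
  filter_upwards [Measure.ae_ne volume (0 : ℝ)] with t ht
  have h := Measure.integral_comp_smul (volume : Measure (Hyp θ))
    (fun u : Hyp θ => f (t • θ + (u : E n))) t
  rw [integral_smul]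
  simp only [smul_add]
  simp only [Submodule.coe_smul] at h
  rw [h, smul_smul, abs_inv, abs_pow, mul_inv_cancel₀ (by positivity), one_smul]

end Decomposition

/-! ### Decay of Schwartz functions along rays -/

section Rays

variable {n : ℕ}

theorem exists_schwartz_decay {W : Type*} [NormedAddCommGroup W] [NormedSpace ℝ W]
    (F : 𝓢(W, ℂ)) (M : ℕ) :
    ∃ C : ℝ, 0 ≤ C ∧ ∀ x, ‖F x‖ ≤ C * (1 + ‖x‖) ^ (-(M : ℝ)) := by
  refine ⟨2 ^ M * ((Finset.Iic (M, 0)).sup fun m => SchwartzMap.seminorm ℝ m.1 m.2) F,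
    by positivity, fun x => ?_⟩
  · have h := SchwartzMap.one_add_le_sup_seminorm_apply (𝕜 := ℝ) (m := (M, 0)) (k := M) (n := 0)
      le_rfl le_rfl F x
    rw [norm_iteratedFDeriv_zero] at h
    rw [Real.rpow_neg (by positivity), Real.rpow_natCast, ← div_eq_mul_inv,
      le_div_iff₀ (by positivity), mul_comm]
    exact h

theorem integrableOn_rpow_mul_one_add {e M : ℝ} (he : -1 < e) (hM : e + 1 < M) :
    IntegrableOn (fun t : ℝ => t ^ e * (1 + t) ^ (-M)) (Set.Ioi 0) := by
  have hmeas : ∀ s : Set ℝ, AEStronglyMeasurable (fun t : ℝ => t ^ e * (1 + t) ^ (-M))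
      (volume.restrict s) := fun s => by
    refine Measurable.aestronglyMeasurable ?_
    fun_prop
  rw [← Set.Ioc_union_Ioi_eq_Ioi zero_le_one]
  refine IntegrableOn.union ?_ ?_
  · have h : IntegrableOn (fun t : ℝ => t ^ e) (Set.Ioc 0 1) :=
      (intervalIntegrable_iff_integrableOn_Ioc_of_le zero_le_one).1
        (intervalIntegral.intervalIntegrable_rpow' he)
    refine h.mono' (hmeas _) ?_
    filter_upwards [ae_restrict_mem measurableSet_Ioc] with t ht
    rw [Real.norm_of_nonneg (by have := ht.1.le; positivity)]
    refine mul_le_of_le_one_right (Real.rpow_nonneg ht.1.le _) ?_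
    exact Real.rpow_le_one_of_one_le_of_nonpos (by linarith [ht.1]) (by linarith)
  · have h : IntegrableOn (fun t : ℝ => t ^ (e - M)) (Set.Ioi 1) :=
      integrableOn_Ioi_rpow_of_lt (by linarith) zero_lt_one
    refine h.mono' (hmeas _) ?_
    filter_upwards [ae_restrict_mem measurableSet_Ioi] with t ht
    have ht0 : 0 < t := zero_lt_one.trans ht
    rw [Real.norm_of_nonneg (by positivity), sub_eq_add_neg, Real.rpow_add ht0]
    gcongr ?_ * ?_
    exact Real.rpow_le_rpow_of_nonpos ht0 (by linarith) (by linarith)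

theorem norm_ray_le {F : 𝓢(E n, ℂ)} {C : ℝ} {M : ℕ} (hC : 0 ≤ C)
    (h : ∀ x, ‖F x‖ ≤ C * (1 + ‖x‖) ^ (-(M : ℝ))) {u : E n} (hu : 1 ≤ ‖u‖) {t : ℝ} (ht : 0 < t) :
    ‖F (t • u)‖ ≤ C * (1 + t) ^ (-(M : ℝ)) := by
  refine (h _).trans (mul_le_mul_of_nonneg_left ?_ hC)
  refine Real.rpow_le_rpow_of_nonpos (by linarith) ?_ (neg_nonpos.2 (Nat.cast_nonneg M))
  rw [norm_smul, Real.norm_of_nonneg ht.le]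
  nlinarith

/-- One majorant serves all u with ‖u‖ ≥ 1, hence every point θ + y of the hyperplane. All later
dominated convergence and Fubini arguments along rays use it. -/
theorem exists_ray_bound (F : 𝓢(E n, ℂ)) {e : ℝ} (he : -1 < e) :
    ∃ w : ℝ → ℝ, IntegrableOn w (Set.Ioi 0) ∧ ∀ u : E n, 1 ≤ ‖u‖ → ∀ t : ℝ, 0 < t →
      t ^ e * ‖F (t • u)‖ ≤ w t := by
  obtain ⟨C, hC, h⟩ := exists_schwartz_decay F (⌈e⌉₊ + 2)
  refine ⟨fun t => C * (t ^ e * (1 + t) ^ (-((⌈e⌉₊ + 2 : ℕ) : ℝ))),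
    (integrableOn_rpow_mul_one_add he ?_).const_mul C, fun u hu t ht => ?_⟩
  · push_cast
    linarith [Nat.le_ceil e]
  · calc t ^ e * ‖F (t • u)‖ ≤ t ^ e * (C * (1 + t) ^ (-((⌈e⌉₊ + 2 : ℕ) : ℝ))) := by
          gcongr
          exact norm_ray_le hC h hu ht
      _ = _ := by ring

/-- The oscillating factor `e^{itp}`. -/
def expI (x : ℝ) : ℂ := Complex.exp (Complex.I * x)

theorem norm_expI (x : ℝ) : ‖expI x‖ = 1 := by
  rw [expI, mul_comm, Complex.norm_exp_ofReal_mul_I]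

@[fun_prop]
theorem continuous_expI : Continuous expI := by
  unfold expI
  fun_prop

theorem integrableOn_ray (F : 𝓢(E n, ℂ)) {e : ℝ} (he : -1 < e) {u : E n} (hu : 1 ≤ ‖u‖) (p : ℝ) :
    IntegrableOn (fun t : ℝ => ((t ^ e : ℝ) : ℂ) * F (t • u) * expI (t * p)) (Set.Ioi 0) := by
  obtain ⟨w, hw, hwb⟩ := exists_ray_bound F he
  refine hw.mono' ?_ ?_
  · have h1 : Measurable fun t : ℝ => ((t ^ e : ℝ) : ℂ) := by fun_prop
    have h2 : Continuous fun t : ℝ => F (t • u) := by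
      have := F.continuous
      fun_prop
    have h3 : Continuous fun t : ℝ => expI (t * p) := by fun_prop
    exact (h1.aestronglyMeasurable.mul h2.aestronglyMeasurable).mul h3.aestronglyMeasurable
  · filter_upwards [ae_restrict_mem measurableSet_Ioi] with t ht
    rw [norm_mul, norm_mul, norm_expI, mul_one, Complex.norm_real,
      Real.norm_of_nonneg (Real.rpow_nonneg (le_of_lt ht) _)]
    exact hwb u hu t ht

/-- The Fourier transform along the ray `{t u : t > 0}` of `t^e F`. -/
def rayFourier (F : 𝓢(E n, ℂ)) (e : ℝ) (u : E n) (p : ℝ) : ℂ :=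
  ∫ t in Set.Ioi (0 : ℝ), ((t ^ e : ℝ) : ℂ) * F (t • u) * expI (t * p)

theorem hasTemperateGrowth_coord (k : Fin n) :
    Function.HasTemperateGrowth (fun x : E n => ((x k : ℝ) : ℂ)) :=
  (Complex.ofRealCLM.comp (EuclideanSpace.proj k : E n →L[ℝ] ℝ)).hasTemperateGrowth

/-- Multiplication of a Schwartz function by the `k`-th coordinate. -/
def mulCoord (k : Fin n) (F : 𝓢(E n, ℂ)) : 𝓢(E n, ℂ) :=
  SchwartzMap.smulLeftCLM ℂ (fun x : E n => ((x k : ℝ) : ℂ)) F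

theorem mulCoord_apply (k : Fin n) (F : 𝓢(E n, ℂ)) (x : E n) : mulCoord k F x = x k * F x := by
  rw [mulCoord, SchwartzMap.smulLeftCLM_apply_apply (hasTemperateGrowth_coord k), smul_eq_mul]

theorem fderiv_apply_eq_sum (f : E n → ℂ) (x v : E n) :
    fderiv ℝ f x v = ∑ k, (v k : ℂ) * fderiv ℝ f x (stdVec k) := by
  conv_lhs => rw [← (EuclideanSpace.basisFun (Fin n) ℝ).sum_repr v]
  simp [map_sum]

/-- The Euler operator `F ↦ ∑ xₖ ∂ₖ F`. -/
def euler (F : 𝓢(E n, ℂ)) : 𝓢(E n, ℂ) := ∑ k, mulCoord k (∂_{(stdVec k : E n)} F)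

theorem euler_apply (F : 𝓢(E n, ℂ)) (x : E n) : euler F x = fderiv ℝ F x x := by
  rw [fderiv_apply_eq_sum, euler, sum_apply]
  simp only [mulCoord_apply, SchwartzMap.lineDerivOp_apply_eq_fderiv]

theorem hasDerivAt_ray (F : 𝓢(E n, ℂ)) (u : E n) (t : ℝ) :
    HasDerivAt (fun t : ℝ => F (t • u)) (fderiv ℝ F (t • u) u) t := by
  have h : HasDerivAt (fun t : ℝ => t • u) u t := by
    simpa using (hasDerivAt_id t).smul_const u
  exact (F.hasFDerivAt (t • u)).comp_hasDerivAt t h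

theorem tendsto_rpow_mul_ray (F : 𝓢(E n, ℂ)) (e : ℝ) {u : E n} (hu : 1 ≤ ‖u‖) :
    Tendsto (fun t : ℝ => t ^ e * ‖F (t • u)‖) atTop (𝓝 0) := by
  obtain ⟨C, hC, h⟩ := exists_schwartz_decay F (⌈e⌉₊ + 1)
  have h1 : Tendsto (fun t : ℝ => C * t ^ (-(1 : ℝ))) atTop (𝓝 0) := by
    simpa using (tendsto_rpow_neg_atTop one_pos).const_mul C
  refine squeeze_zero' ?_ ?_ h1
  · filter_upwards [eventually_ge_atTop 0] with t ht
    positivity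
  · filter_upwards [eventually_ge_atTop 1] with t ht
    have ht0 : 0 < t := by linarith
    calc t ^ e * ‖F (t • u)‖ ≤ t ^ e * (C * t ^ (-((⌈e⌉₊ + 1 : ℕ) : ℝ))) := by
          gcongr
          refine (norm_ray_le hC h hu ht0).trans (mul_le_mul_of_nonneg_left ?_ hC)
          exact Real.rpow_le_rpow_of_nonpos ht0 (by linarith)
            (neg_nonpos.2 (Nat.cast_nonneg _))
      _ = C * t ^ (e - (⌈e⌉₊ + 1 : ℕ)) := by rw [sub_eq_add_neg, Real.rpow_add ht0]; ring
      _ ≤ C * t ^ (-(1 : ℝ)) := by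
          gcongr
          · push_cast
            linarith [Nat.le_ceil e]

/-- Integrate the t-derivative of t^e F(tu) e^{itp}. Since t d/dt F(tu) is the Euler operator
applied to F at tu, the result is again a ray transform of a fixed Schwartz function, so that
iterated bounds stay uniform in u. The boundary term at 0 vanishes because e > 0. -/
theorem rayFourier_step (F : 𝓢(E n, ℂ)) {e : ℝ} (he : 0 < e) {u : E n} (hu : 1 ≤ ‖u‖) (p : ℝ) :
    (p : ℂ) * rayFourier F e u p = Complex.I * rayFourier ((e : ℂ) • F + euler F) (e - 1) u p := by
  have hd : ∀ t ∈ Set.Ioi (0 : ℝ), HasDerivAt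
      (fun t : ℝ => ((t ^ e : ℝ) : ℂ) * F (t • u) * expI (t * p))
      (((t ^ (e - 1) : ℝ) : ℂ) * ((e : ℂ) • F + euler F) (t • u) * expI (t * p) +
        Complex.I * p * (((t ^ e : ℝ) : ℂ) * F (t • u) * expI (t * p))) t := by
    intro t ht
    have ht0 : t ≠ 0 := ne_of_gt ht
    have h1 := (Real.hasDerivAt_rpow_const (p := e) (Or.inl ht0)).ofReal_comp
    have h2 : HasDerivAt (fun t : ℝ => expI (t * p)) (expI (t * p) * (Complex.I * p)) t := by
      have h3 : HasDerivAt (fun t : ℝ => Complex.I * ((t * p : ℝ) : ℂ)) (Complex.I * p) t := by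
        have := ((hasDerivAt_id t).mul_const p).ofReal_comp.const_mul Complex.I
        simpa using this
      exact h3.cexp
    have h4 := (h1.mul (hasDerivAt_ray F u t)).mul h2
    refine h4.congr_deriv ?_
    have h5 : (t ^ e : ℝ) = t ^ (e - 1) * t := by
      rw [Real.rpow_sub_one ht0, div_mul_cancel₀ _ ht0]
    rw [add_apply, smul_apply, euler_apply, (fderiv ℝ F (t • u)).map_smul, h5]
    simp only [Pi.mul_apply, h5, Complex.real_smul, smul_eq_mul, Complex.ofReal_mul]
    ring
  have hi1 := integrableOn_ray ((e : ℂ) • F + euler F) (e := e - 1) (by linarith) hu p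
  have hi2 := (integrableOn_ray F (e := e) (by linarith) hu p).const_mul (Complex.I * p)
  have h0 : ((((0 : ℝ) ^ e : ℝ) : ℂ) * F ((0 : ℝ) • u) * expI (0 * p)) = 0 := by
    rw [Real.zero_rpow he.ne']
    simp
  have hint := integral_Ioi_of_hasDerivAt_of_tendsto (a := 0) (m := 0)
    (f := fun t : ℝ => ((t ^ e : ℝ) : ℂ) * F (t • u) * expI (t * p)) ?_ hd (hi1.add hi2) ?_
  · rw [h0, sub_zero] at hint
    have h6 := (integral_add hi1 hi2).symm.trans hint
    rw [integral_const_mul] at h6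
    have hI : Complex.I * Complex.I = -1 := Complex.I_mul_I
    simp only [rayFourier]
    linear_combination (-Complex.I) * h6 + p * (∫ t in Set.Ioi (0 : ℝ),
      ((t ^ e : ℝ) : ℂ) * F (t • u) * expI (t * p)) * hI
  · refine Continuous.continuousWithinAt ?_
    have h7 : Continuous fun t : ℝ => ((t ^ e : ℝ) : ℂ) :=
      Complex.continuous_ofReal.comp (continuous_id.rpow_const fun _ => Or.inr he.le)
    have := F.continuous
    fun_prop
  · rw [tendsto_zero_iff_norm_tendsto_zero]
    refine (tendsto_rpow_mul_ray F e hu).congr' ?_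
    filter_upwards [eventually_ge_atTop 0] with t ht
    rw [norm_mul, norm_mul, norm_expI, mul_one, Complex.norm_real,
      Real.norm_of_nonneg (Real.rpow_nonneg ht _)]

theorem rayFourier_bound_pow (N : ℕ) : ∀ e : ℝ, (N : ℝ) ≤ e → ∀ F : 𝓢(E n, ℂ),
    ∃ C : ℝ, ∀ u : E n, 1 ≤ ‖u‖ → ∀ p : ℝ, |p| ^ N * ‖rayFourier F e u p‖ ≤ C := by
  induction N with
  | zero =>
    intro e he F
    have he' : -1 < e := by push_cast at he; linarith
    obtain ⟨w, hw, hwb⟩ := exists_ray_bound F he'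
    refine ⟨∫ t in Set.Ioi (0 : ℝ), w t, fun u hu p => ?_⟩
    rw [pow_zero, one_mul]
    refine norm_integral_le_of_norm_le hw ?_
    filter_upwards [ae_restrict_mem measurableSet_Ioi] with t ht
    rw [norm_mul, norm_mul, norm_expI, mul_one, Complex.norm_real,
      Real.norm_of_nonneg (Real.rpow_nonneg (le_of_lt ht) _)]
    exact hwb u hu t ht
  | succ N ih =>
    intro e he F
    push_cast at he
    obtain ⟨C, hC⟩ := ih (e - 1) (by linarith) ((e : ℂ) • F + euler F)
    refine ⟨C, fun u hu p => ?_⟩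
    have hN : (0 : ℝ) ≤ N := N.cast_nonneg
    have h := congrArg norm (rayFourier_step F (e := e) (by linarith) hu p)
    rw [norm_mul, norm_mul, Complex.norm_I, one_mul, Complex.norm_real, Real.norm_eq_abs] at h
    rw [pow_succ, mul_assoc, h]
    exact hC u hu p

theorem rayFourier_bound (F : 𝓢(E n, ℂ)) (N : ℕ) {e : ℝ} (he : (N : ℝ) ≤ e) :
    ∃ C : ℝ, 0 ≤ C ∧ ∀ u : E n, 1 ≤ ‖u‖ → ∀ p : ℝ,
      ‖rayFourier F e u p‖ ≤ C * (1 + |p| ^ N)⁻¹ := by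
  have hN : (0 : ℝ) ≤ N := N.cast_nonneg
  obtain ⟨C0, h0⟩ := rayFourier_bound_pow 0 e (by push_cast; linarith) F
  obtain ⟨C1, h1⟩ := rayFourier_bound_pow N e he F
  refine ⟨max (C0 + C1) 0, le_max_right _ _, fun u hu p => ?_⟩
  rw [← div_eq_mul_inv, le_div_iff₀ (by positivity)]
  have a := h0 u hu p
  have b := h1 u hu p
  rw [pow_zero, one_mul] at a
  exact le_max_of_le_left (by linarith)

end Rays

end Conormal

namespace Conormal

open scoped SchwartzMap

/-! ### The Fresnel integral -/

section Fresnel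

theorem one_add_pow_two_mul_le {x : ℝ} (hx : 0 ≤ x) (N : ℕ) :
    (1 + x) ^ (2 * N) ≤ 4 ^ N * (1 + (x ^ 2) ^ N) := by
  rcases le_total x 1 with h | h
  · calc (1 + x) ^ (2 * N) ≤ (2 : ℝ) ^ (2 * N) := by gcongr; linarith
      _ = 4 ^ N * 1 := by rw [pow_mul]; norm_num
      _ ≤ _ := by gcongr; linarith [pow_nonneg (sq_nonneg x) N]
  · calc (1 + x) ^ (2 * N) ≤ (2 * x) ^ (2 * N) := by gcongr; linarith
      _ = 4 ^ N * (x ^ 2) ^ N := by rw [mul_pow, pow_mul, pow_mul]; norm_num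
      _ ≤ _ := by gcongr; linarith

variable {V : Type*} [NormedAddCommGroup V] [InnerProductSpace ℝ V] [FiniteDimensional ℝ V]
  [MeasurableSpace V] [BorelSpace V]

/-- The function decays like ‖z‖^{-2N}, and 2N exceeds the dimension. It is the majorant for the
rescaled transversal integral. -/
theorem integrable_inv_one_add_pow {N : ℕ} (hN : Module.finrank ℝ V < 2 * N) {c : ℝ} (hc : 0 < c) :
    Integrable (fun z : V => (1 + (c * ‖z‖ ^ 2) ^ N)⁻¹) := by
  have h := (integrable_one_add_norm (E := V) (μ := volume) (r := ((2 * N : ℕ) : ℝ))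
    (by exact_mod_cast hN)).const_mul (4 ^ N * (1 + (c ^ N)⁻¹))
  refine h.mono' ?_ (Eventually.of_forall fun z => ?_)
  · refine Continuous.aestronglyMeasurable ?_
    refine Continuous.inv₀ (by fun_prop) fun z => ?_
    positivity
  · rw [Real.norm_of_nonneg (by positivity), Real.rpow_neg (by positivity), Real.rpow_natCast,
      ← div_eq_mul_inv, le_div_iff₀ (by positivity), inv_mul_le_iff₀ (by positivity)]
    refine (one_add_pow_two_mul_le (norm_nonneg z) N).trans ?_
    rw [mul_left_comm]
    gcongr
    have h1 : 0 < c ^ N := by positivity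
    have h2 : (0 : ℝ) ≤ (‖z‖ ^ 2) ^ N := by positivity
    rw [mul_pow]
    have h3 : (1 + c ^ N * (‖z‖ ^ 2) ^ N) * (1 + (c ^ N)⁻¹) =
      1 + (‖z‖ ^ 2) ^ N + (c ^ N)⁻¹ + c ^ N * (‖z‖ ^ 2) ^ N := by
      field_simp
      ring
    rw [h3]
    have : 0 < (c ^ N)⁻¹ := by positivity
    nlinarith

variable {n : ℕ}

theorem tendsto_rayFourier (F : 𝓢(E n, ℂ)) {e : ℝ} (he : -1 < e) {ι : Type*} {l : Filter ι}
    [l.IsCountablyGenerated] {u : ι → E n} {u₀ : E n} {p : ι → ℝ} {p₀ : ℝ}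
    (hu1 : ∀ᶠ i in l, 1 ≤ ‖u i‖) (hu : Tendsto u l (𝓝 u₀)) (hp : Tendsto p l (𝓝 p₀)) :
    Tendsto (fun i => rayFourier F e (u i) (p i)) l (𝓝 (rayFourier F e u₀ p₀)) := by
  obtain ⟨w, hw, hwb⟩ := exists_ray_bound F he
  refine tendsto_integral_filter_of_dominated_convergence w ?_ ?_ hw ?_
  · filter_upwards [hu1] with i hi
    exact (integrableOn_ray F he hi (p i)).aestronglyMeasurable
  · filter_upwards [hu1] with i hi
    filter_upwards [ae_restrict_mem measurableSet_Ioi] with t ht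
    rw [norm_mul, norm_mul, norm_expI, mul_one, Complex.norm_real,
      Real.norm_of_nonneg (Real.rpow_nonneg (le_of_lt ht) _)]
    exact hwb _ hi t ht
  · refine Eventually.of_forall fun t => ?_
    refine (tendsto_const_nhds.mul ((F.continuous.tendsto _).comp (hu.const_smul t))).mul ?_
    exact (continuous_expI.tendsto _).comp (hp.const_mul t)

theorem continuous_rayFourier (F : 𝓢(E n, ℂ)) {e : ℝ} (he : -1 < e) {X : Type*}
    [TopologicalSpace X] [FirstCountableTopology X] {u : X → E n} {p : X → ℝ}
    (hu1 : ∀ x, 1 ≤ ‖u x‖) (hu : Continuous u) (hp : Continuous p) :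
    Continuous fun x => rayFourier F e (u x) (p x) :=
  continuous_iff_continuousAt.2 fun x =>
    tendsto_rayFourier F he (Eventually.of_forall hu1) (hu.tendsto x) (hp.tendsto x)

/-- The Gaussian factor makes the double integral in u and t absolutely convergent. After Fubini the
inner integral is a Gaussian with complex parameter (δ + iσt)/2. -/
theorem fresnel_damped (F : 𝓢(E n, ℂ)) {e : ℝ} (he : -1 < e) {θ : E n} (hθ : 1 ≤ ‖θ‖) (σ : ℝ)
    {δ : ℝ} (hδ : 0 < δ) :
    ∫ u : V, ((Real.exp (-(δ / 2) * ‖u‖ ^ 2) : ℝ) : ℂ) * rayFourier F e θ (-(σ * ‖u‖ ^ 2 / 2)) =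
      ∫ t in Set.Ioi (0 : ℝ), ((t ^ e : ℝ) : ℂ) * F (t • θ) *
        (Real.pi / ((δ + Complex.I * σ * t) / 2)) ^ (Module.finrank ℝ V / 2 : ℂ) := by
  have hg : Integrable (fun u : V => Real.exp (-(δ / 2) * ‖u‖ ^ 2)) := by
    have := GaussianFourier.integrable_cexp_neg_mul_sq_norm_add (V := V) (b := ((δ / 2 : ℝ) : ℂ))
      (by simpa using hδ) 0 (0 : V)
    refine (this.norm).congr (Eventually.of_forall fun u => ?_)
    simp only [Complex.norm_exp]
    norm_cast
    simp
  have h0 := integrableOn_ray F he hθ 0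
  have hF : IntegrableOn (fun t : ℝ => ((t ^ e : ℝ) : ℂ) * F (t • θ)) (Set.Ioi 0) := by
    simpa [expI] using h0
  have hprod : Integrable (Function.uncurry fun (u : V) (t : ℝ) =>
      ((Real.exp (-(δ / 2) * ‖u‖ ^ 2) : ℝ) : ℂ) *
        (((t ^ e : ℝ) : ℂ) * F (t • θ) * expI (t * (-(σ * ‖u‖ ^ 2 / 2)))))
      (volume.prod (volume.restrict (Set.Ioi 0))) := by
    have h1 := (hg.ofReal (𝕜 := ℂ)).mul_prod hF
    have h2 : Continuous fun z : V × ℝ => expI (z.2 * (-(σ * ‖z.1‖ ^ 2 / 2))) := by fun_prop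
    refine (h1.mul_bdd (c := 1) h2.aestronglyMeasurable
      (Eventually.of_forall fun z => (norm_expI _).le)).congr (Eventually.of_forall fun z => ?_)
    simp only [Function.uncurry]
    simp only [mul_assoc, Complex.coe_algebraMap]
  simp only [rayFourier, ← integral_const_mul]
  rw [integral_integral_swap hprod]
  refine setIntegral_congr_fun measurableSet_Ioi fun t ht => ?_
  have h3 := GaussianFourier.integral_cexp_neg_mul_sq_norm (V := V)
    (b := (δ + Complex.I * σ * t) / 2) (by simpa using hδ)
  rw [← h3, ← integral_const_mul]
  refine integral_congr_ae (Eventually.of_forall fun u => ?_)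
  simp only [expI, Complex.ofReal_exp]
  rw [mul_left_comm, ← Complex.exp_add]
  congr 2
  push_cast
  ring

/-- Uniform in the damping δ, since |δ + iσt| ≥ t; this is what allows δ → 0 under the t-integral.
-/
theorem norm_pi_div_cpow_le {δ σ t : ℝ} (hσ : |σ| = 1) (ht : 0 < t) (k : ℕ) :
    ‖(Real.pi / ((δ + Complex.I * σ * t) / 2) : ℂ) ^ (k / 2 : ℂ)‖ ≤
      (2 * Real.pi / t) ^ ((k : ℝ) / 2) := by
  have h : ((k : ℂ) / 2) = (((k : ℝ) / 2 : ℝ) : ℂ) := by push_cast; rfl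
  rw [h, Complex.norm_cpow_real]
  refine Real.rpow_le_rpow (norm_nonneg _) ?_ (by positivity)
  have h1 : t ≤ ‖(δ + Complex.I * σ * t : ℂ)‖ := by
    have h2 := Complex.abs_im_le_norm (δ + Complex.I * σ * t : ℂ)
    have h3 : (δ + Complex.I * σ * t : ℂ).im = σ * t := by simp
    rwa [h3, abs_mul, hσ, one_mul, abs_of_pos ht] at h2
  rw [norm_div, norm_div, Complex.norm_real, Real.norm_of_nonneg Real.pi_pos.le]
  simp only [Complex.norm_ofNat]
  rw [div_div_eq_mul_div, mul_comm]
  gcongr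

/-- The base is (2π/t)(−σi), and the principal logarithm of −σi is −σπi/2. This is the origin of the
Maslov phase e^{-iσπk/4}. -/
theorem pi_div_cpow_eq {σ t : ℝ} (hσ : σ = 1 ∨ σ = -1) (ht : 0 < t) (k : ℕ) :
    (Real.pi / ((Complex.I * σ * t) / 2) : ℂ) ^ (k / 2 : ℂ) =
      (((2 * Real.pi) ^ ((k : ℝ) / 2) * t ^ (-((k : ℝ) / 2)) : ℝ) : ℂ) *
        Complex.exp (-(Complex.I * σ * Real.pi * k / 4)) := by
  have h1 : (Real.pi / ((Complex.I * σ * t) / 2) : ℂ) =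
      ((2 * Real.pi / t : ℝ) : ℂ) * (-(σ * Complex.I)) := by
    have ht' : (t : ℂ) ≠ 0 := by exact_mod_cast ht.ne'
    rcases hσ with rfl | rfl <;> push_cast <;> field_simp <;> simp [Complex.I_sq]
  have hpos : 0 < 2 * Real.pi / t := by positivity
  have h2 : (-(σ * Complex.I) : ℂ) ≠ 0 := by rcases hσ with rfl | rfl <;> simp
  have h3 : Complex.log (-(σ * Complex.I)) = -(σ * (Real.pi / 2) * Complex.I) := by
    rcases hσ with rfl | rfl
    · simp [Complex.log_neg_I]
    · simp [Complex.log_I]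
  have h4 : (2 * Real.pi) ^ ((k : ℝ) / 2) * t ^ (-((k : ℝ) / 2)) =
      Real.exp (Real.log (2 * Real.pi / t) * (k / 2)) := by
    rw [← Real.rpow_def_of_pos hpos, Real.div_rpow (by positivity) ht.le, Real.rpow_neg ht.le]
    exact (div_eq_mul_inv _ _).symm
  rw [h1, Complex.cpow_def_of_ne_zero (mul_ne_zero (by exact_mod_cast hpos.ne') h2),
    Complex.log_ofReal_mul hpos h2, h3, h4, Complex.ofReal_exp, ← Complex.exp_add]
  congr 1
  push_cast
  ring

/-- Let δ → 0 in `fresnel_damped`. On the left the decay of `rayFourier` dominates, since it is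
integrable in u for 2N > k; on the right the Gaussian factor costs t^{-k/2}, which t^e absorbs. -/
theorem fresnel (F : 𝓢(E n, ℂ)) {N : ℕ} (hN : Module.finrank ℝ V < 2 * N) {e : ℝ} (he : N ≤ e)
    {θ : E n} (hθ : 1 ≤ ‖θ‖) {σ : ℝ} (hσ : σ = 1 ∨ σ = -1) :
    ∫ u : V, rayFourier F e θ (-(σ * ‖u‖ ^ 2 / 2)) =
      (((2 * Real.pi) ^ ((Module.finrank ℝ V : ℝ) / 2) : ℝ) : ℂ) *
        Complex.exp (-(Complex.I * σ * Real.pi * (Module.finrank ℝ V : ℕ) / 4)) *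
        ∫ t in Set.Ioi (0 : ℝ), ((t ^ (e - (Module.finrank ℝ V : ℝ) / 2) : ℝ) : ℂ) * F (t • θ) := by
  set k := Module.finrank ℝ V with hk
  have hNk : (k : ℝ) / 2 < N := by
    have : (k : ℝ) < 2 * N := by exact_mod_cast hN
    linarith
  have he1 : -1 < e := by linarith [N.cast_nonneg (α := ℝ)]
  have hek : -1 < e - (k : ℝ) / 2 := by linarith
  have hσ1 : |σ| = 1 := by rcases hσ with rfl | rfl <;> simp
  obtain ⟨C, hC, hCb⟩ := rayFourier_bound F N he
  have hcont : Continuous fun u : V => rayFourier F e θ (-(σ * ‖u‖ ^ 2 / 2)) :=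
    continuous_rayFourier F he1 (fun _ => hθ) continuous_const (by fun_prop)
  have hL : Tendsto (fun δ : ℝ => ∫ u : V, ((Real.exp (-(δ / 2) * ‖u‖ ^ 2) : ℝ) : ℂ) *
      rayFourier F e θ (-(σ * ‖u‖ ^ 2 / 2))) (𝓝[>] 0)
      (𝓝 (∫ u : V, rayFourier F e θ (-(σ * ‖u‖ ^ 2 / 2)))) := by
    refine tendsto_integral_filter_of_dominated_convergence
      (fun u => C * (1 + (1 / 2 * ‖u‖ ^ 2) ^ N)⁻¹) ?_ ?_
      ((integrable_inv_one_add_pow hN one_half_pos).const_mul C) ?_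
    · refine Eventually.of_forall fun δ => ?_
      exact Continuous.aestronglyMeasurable (by fun_prop)
    · filter_upwards [self_mem_nhdsWithin] with δ hδ
      refine Eventually.of_forall fun u => ?_
      rw [norm_mul, Complex.norm_real, Real.norm_of_nonneg (Real.exp_pos _).le]
      have h1 : Real.exp (-(δ / 2) * ‖u‖ ^ 2) ≤ 1 := by
        rw [Real.exp_le_one_iff]
        have : (0 : ℝ) < δ := hδ
        have : 0 ≤ δ / 2 * ‖u‖ ^ 2 := by positivity
        linarith
      have h2 := hCb θ hθ (-(σ * ‖u‖ ^ 2 / 2))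
      have h3 : |-(σ * ‖u‖ ^ 2 / 2)| = 1 / 2 * ‖u‖ ^ 2 := by
        rw [abs_neg, abs_div, abs_mul, hσ1, abs_of_nonneg (sq_nonneg _), abs_two]
        ring
      rw [h3] at h2
      exact (mul_le_of_le_one_left (norm_nonneg _) h1).trans h2
    · refine Eventually.of_forall fun u => ?_
      have h1 : Tendsto (fun δ : ℝ => ((Real.exp (-(δ / 2) * ‖u‖ ^ 2) : ℝ) : ℂ)) (𝓝[>] 0) (𝓝 1) := by
        have : Continuous fun δ : ℝ => ((Real.exp (-(δ / 2) * ‖u‖ ^ 2) : ℝ) : ℂ) := by fun_prop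
        have h := (this.tendsto 0).mono_left (nhdsWithin_le_nhds (s := Set.Ioi 0))
        simpa using h
      simpa using h1.mul_const (rayFourier F e θ (-(σ * ‖u‖ ^ 2 / 2)))
  have hR : Tendsto (fun δ : ℝ => ∫ t in Set.Ioi (0 : ℝ), ((t ^ e : ℝ) : ℂ) * F (t • θ) *
        (Real.pi / ((δ + Complex.I * σ * t) / 2)) ^ (k / 2 : ℂ)) (𝓝[>] 0)
      (𝓝 (∫ t in Set.Ioi (0 : ℝ), ((t ^ e : ℝ) : ℂ) * F (t • θ) *
        (Real.pi / ((Complex.I * σ * t) / 2)) ^ (k / 2 : ℂ))) := by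
    obtain ⟨w, hw, hwb⟩ := exists_ray_bound F hek
    -- The imaginary part of the base is nonzero, so the principal power is continuous up to δ = 0.
    have hbase : ∀ δ t : ℝ, 0 ≤ δ → 0 < t →
        (Real.pi / ((δ + Complex.I * σ * t) / 2) : ℂ) ∈ Complex.slitPlane := by
      intro δ t hδ ht
      have hz : (δ + Complex.I * σ * t : ℂ).im = σ * t := by simp
      have hz0 : σ * t ≠ 0 := by
        rcases hσ with rfl | rfl
        · simpa using ht.ne'
        · simpa using ht.ne'
      rw [Complex.mem_slitPlane_iff]
      right
      rw [div_div_eq_mul_div, Complex.div_im]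
      have hne : (δ + Complex.I * σ * t : ℂ) ≠ 0 := fun h => hz0 (by rw [← hz, h]; simp)
      have hn0 : Complex.normSq (δ + Complex.I * σ * t : ℂ) ≠ 0 := by
        simpa [Complex.normSq_eq_zero] using hne
      have h1 : ((Real.pi : ℂ) * 2).im = 0 := by simp
      have h2 : ((Real.pi : ℂ) * 2).re = Real.pi * 2 := by simp
      rw [h1, h2, hz, zero_mul, zero_div, zero_sub, neg_ne_zero]
      exact div_ne_zero (mul_ne_zero (by positivity) hz0) hn0
    refine tendsto_integral_filter_of_dominated_convergence
      (fun t => (2 * Real.pi) ^ ((k : ℝ) / 2) * w t) ?_ ?_ (hw.const_mul _) ?_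
    · refine Eventually.of_forall fun δ => Measurable.aestronglyMeasurable ?_
      have h1 : Measurable fun t : ℝ => F (t • θ) := by
        have := F.continuous
        exact Continuous.measurable (by fun_prop)
      fun_prop
    · refine Eventually.of_forall fun δ => ?_
      filter_upwards [ae_restrict_mem measurableSet_Ioi] with t ht
      have ht0 : 0 < t := ht
      rw [norm_mul, norm_mul, Complex.norm_real, Real.norm_of_nonneg (by positivity)]
      have h1 := norm_pi_div_cpow_le (δ := δ) hσ1 ht0 k
      have h2 := hwb θ hθ t ht0
      rw [Real.div_rpow (by positivity) ht0.le] at h1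
      have h3 : t ^ e = t ^ (e - (k : ℝ) / 2) * t ^ ((k : ℝ) / 2) := by
        rw [← Real.rpow_add ht0]; ring_nf
      calc t ^ e * ‖F (t • θ)‖ * ‖_‖ ≤ t ^ e * ‖F (t • θ)‖ *
            ((2 * Real.pi) ^ ((k : ℝ) / 2) / t ^ ((k : ℝ) / 2)) := by gcongr
        _ = (2 * Real.pi) ^ ((k : ℝ) / 2) * (t ^ (e - (k : ℝ) / 2) * ‖F (t • θ)‖) := by
          rw [h3]; field_simp
        _ ≤ _ := by gcongr
    · filter_upwards [ae_restrict_mem measurableSet_Ioi] with t ht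
      have ht0 : 0 < t := ht
      have hne : (Complex.I * σ * t : ℂ) ≠ 0 := by
        rcases hσ with rfl | rfl <;> simp [ht0.ne']
      have hc : ContinuousAt (fun δ : ℝ => (Real.pi / ((δ + Complex.I * σ * t) / 2) : ℂ) ^
          (k / 2 : ℂ)) 0 := by
        refine ContinuousAt.cpow ?_ continuousAt_const (hbase 0 t le_rfl ht0)
        refine ContinuousAt.div continuousAt_const (by fun_prop) ?_
        simpa using hne
      have h := (hc.tendsto.mono_left (nhdsWithin_le_nhds (s := Set.Ioi 0))).const_mul
        (((t ^ e : ℝ) : ℂ) * F (t • θ))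
      simpa using h
  have heq : ∀ᶠ δ in 𝓝[>] (0 : ℝ), (∫ u : V, ((Real.exp (-(δ / 2) * ‖u‖ ^ 2) : ℝ) : ℂ) *
      rayFourier F e θ (-(σ * ‖u‖ ^ 2 / 2))) = ∫ t in Set.Ioi (0 : ℝ), ((t ^ e : ℝ) : ℂ) *
        F (t • θ) * (Real.pi / ((δ + Complex.I * σ * t) / 2)) ^ (k / 2 : ℂ) := by
    filter_upwards [self_mem_nhdsWithin] with δ hδ
    exact fresnel_damped F he1 hθ σ hδ
  rw [tendsto_nhds_unique (hL.congr' heq) hR, ← integral_const_mul]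
  refine setIntegral_congr_fun measurableSet_Ioi fun t ht => ?_
  have ht0 : 0 < t := ht
  have h3 : t ^ (e - (k : ℝ) / 2) = t ^ e * t ^ (-((k : ℝ) / 2)) := by
    rw [← Real.rpow_add ht0]; ring_nf
  simp only [pi_div_cpow_eq hσ ht0, h3, Complex.ofReal_mul]
  ring

end Fresnel

end Conormal

namespace Conormal

open scoped SchwartzMap

/-! ### Stationary phase near a nondegenerate critical ray -/

section Near

/-- The mean value inequality for s ↦ ψ(θ + sy) − s² B(y,y)/2 on [0,1], whose derivative is
controlled by the differentiability of ψ' at θ alone. -/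
theorem taylor_two_of_critical {W : Type*} [NormedAddCommGroup W] [NormedSpace ℝ W] {ψ : W → ℝ}
    {θ : W} (hψ : ContDiffAt ℝ ∞ ψ θ) (h0 : ψ θ = 0) (h1 : fderiv ℝ ψ θ = 0) {η : ℝ} (hη : 0 < η) :
    ∃ δ > 0, ∀ y, ‖y‖ < δ →
      |ψ (θ + y) - 1 / 2 * fderiv ℝ (fderiv ℝ ψ) θ y y| ≤ η * ‖y‖ ^ 2 := by
  have hd : ∀ᶠ x in 𝓝 θ, DifferentiableAt ℝ ψ x := by
    filter_upwards [(hψ.of_le (m := 1) (by exact_mod_cast le_top)).eventually (by simp)] with x hx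
    exact hx.differentiableAt (by simp)
  have hB : HasFDerivAt (fderiv ℝ ψ) (fderiv ℝ (fderiv ℝ ψ) θ) θ :=
    ((hψ.fderiv_right (m := ∞) (by simp)).differentiableAt
      (by simp)).hasFDerivAt
  have hlo := hB.isLittleO.def hη
  rw [h1] at hlo
  obtain ⟨δ, hδ, hball⟩ := Metric.eventually_nhds_iff.1 (hlo.and hd)
  refine ⟨δ, hδ, fun y hy => ?_⟩
  have hs : ∀ s ∈ Set.Icc (0 : ℝ) 1, dist (θ + s • y) θ < δ := fun s hs => by
    rw [dist_eq_norm, add_sub_cancel_left, norm_smul, Real.norm_of_nonneg hs.1]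
    exact (mul_le_of_le_one_left (norm_nonneg _) hs.2).trans_lt hy
  set B := fderiv ℝ (fderiv ℝ ψ) θ
  have hder : ∀ s ∈ Set.Icc (0 : ℝ) 1, HasDerivWithinAt
      (fun s : ℝ => ψ (θ + s • y) - 1 / 2 * (s ^ 2 * B y y))
      (fderiv ℝ ψ (θ + s • y) y - s * B y y) (Set.Icc 0 1) s := fun s hs' => by
    have e1 : HasDerivAt (fun s : ℝ => θ + s • y) y s := by
      simpa using ((hasDerivAt_id s).smul_const y).const_add θ
    have e2 := (hball (hs s hs')).2.hasFDerivAt.comp_hasDerivAt s e1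
    have e3 := ((hasDerivAt_pow 2 s).mul_const (B y y)).const_mul (1 / 2 : ℝ)
    refine ((e2.sub e3).congr_deriv ?_).hasDerivWithinAt
    simp
    ring
  have hbd : ∀ s ∈ Set.Ico (0 : ℝ) 1, ‖fderiv ℝ ψ (θ + s • y) y - s * B y y‖ ≤ η * ‖y‖ ^ 2 :=
    fun s hs' => by
    have h2 := (hball (hs s ⟨hs'.1, hs'.2.le⟩)).1
    rw [add_sub_cancel_left, sub_zero] at h2
    have h3 : fderiv ℝ ψ (θ + s • y) y - s * B y y = (fderiv ℝ ψ (θ + s • y) - B (s • y)) y := by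
      simp
    rw [h3]
    refine (ContinuousLinearMap.le_opNorm _ _).trans ?_
    rw [sq, ← mul_assoc]
    gcongr
    refine h2.trans ?_
    gcongr
    rw [norm_smul, Real.norm_of_nonneg hs'.1]
    exact mul_le_of_le_one_left (norm_nonneg _) hs'.2.le
  have h4 := norm_image_sub_le_of_norm_deriv_le_segment_01' hder hbd
  simpa [h0] using h4

variable {n : ℕ}

theorem one_le_norm_add_hyp {θ : E n} (hθ : ‖θ‖ = 1) (y : Hyp θ) : 1 ≤ ‖θ + (y : E n)‖ := by
  have h := norm_add_sq_eq_norm_sq_add_norm_sq_real (inner_hyp θ y)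
  rw [hθ] at h
  nlinarith [norm_nonneg (θ + (y : E n)), mul_self_nonneg ‖(y : E n)‖]

theorem add_hyp_ne_zero {θ : E n} (hθ : ‖θ‖ = 1) (y : Hyp θ) : θ + (y : E n) ≠ 0 := fun h => by
  have := one_le_norm_add_hyp hθ y
  rw [h, norm_zero] at this
  linarith

theorem HomSymb.continuous_hyp {A : Type*} [NormedAddCommGroup A] [NormedSpace ℝ A] {θ : E n}
    (hθ : ‖θ‖ = 1) {d : ℝ} {b : E n → A} (hb : HomSymb d b) :
    Continuous fun y : Hyp θ => b (θ + (y : E n)) :=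
  hb.smooth.continuousOn.comp_continuous (by fun_prop) fun y => add_hyp_ne_zero hθ y

theorem osc_ray {ψ : E n → ℝ} (hψ : HomSymb 1 ψ) (Λ : ℝ) {t : ℝ} (ht : 0 < t) (ξ : E n) :
    osc ψ Λ (t • ξ) = expI (t * (Λ * ψ ξ)) := by
  rw [osc, expI, hψ.hom t ht, Real.rpow_one, smul_eq_mul]
  congr 3
  ring

/-- The cone of the vectors `t θ + u`, `t > 0`, with `u` orthogonal to `θ` and `‖u‖ ≤ δ t`,
contains the support of `b`. -/
def SupportedInCone (θ : E n) (δ : ℝ) (b : E n → ℂ) : Prop :=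
  ∀ (t : ℝ) (u : Hyp θ), b (t • θ + (u : E n)) ≠ 0 → 0 < t ∧ ‖u‖ ≤ δ * t

/-- In the coordinates ξ = t(θ + y) the phase is tΛψ(θ + y), linear in t. The amplitude and the
Jacobian contribute t^{d+k}, so the t-integral is a ray transform; the support condition removes t ≤
0. -/
theorem integral_cone_eq {θ : E n} (hn : n ≠ 0) (hθ : ‖θ‖ = 1) {ψ : E n → ℝ} (hψ : HomSymb 1 ψ)
    {δ : ℝ} {d : ℝ} (hd : 0 ≤ d) {b : E n → ℂ} (hb : HomSymb d b) (hs : SupportedInCone θ δ b)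
    (F : 𝓢(E n, ℂ)) (Λ : ℝ) :
    ∫ ξ, b ξ * F ξ * osc ψ Λ ξ = ∫ y : Hyp θ, b (θ + (y : E n)) *
      rayFourier F (d + Module.finrank ℝ (Hyp θ)) (θ + (y : E n)) (Λ * ψ (θ + (y : E n))) := by
  set k := Module.finrank ℝ (Hyp θ) with hk
  have he : (-1 : ℝ) < d + k := by linarith [k.cast_nonneg (α := ℝ)]
  have hint := hb.integrable_mul hn hd F (hψ.aestronglyMeasurable_osc hn Λ)
    (fun ξ => (norm_osc ψ Λ ξ).le)
  have hbc := hb.continuous_hyp hθ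
  have hbs : ∀ y : Hyp θ, b (θ + (y : E n)) ≠ 0 → ‖y‖ ≤ δ := fun y hy => by
    have := (hs 1 y (by simpa using hy)).2
    simpa using this
  have hbi : Integrable fun y : Hyp θ => b (θ + (y : E n)) := by
    refine hbc.integrable_of_hasCompactSupport ?_
    refine HasCompactSupport.of_support_subset_isCompact (isCompact_closedBall (0 : Hyp θ) δ) ?_
    intro y hy
    simpa using hbs y hy
  rw [integral_split_cone hθ hint]
  have hzero : ∀ t : ℝ, t ∉ Set.Ioi (0 : ℝ) → (∫ y : Hyp θ, (|t| ^ k : ℝ) •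
      (b (t • (θ + (y : E n))) * F (t • (θ + (y : E n))) * osc ψ Λ (t • (θ + (y : E n))))) = 0 := by
    intro t ht
    rw [← integral_zero (Hyp θ) ℂ]
    congr 1
    funext y
    have hb0 : b (t • (θ + (y : E n))) = 0 := by
      by_contra hne
      rw [smul_add] at hne
      exact ht (hs t (t • y) (by simpa using hne)).1
    simp only [hb0, zero_mul, smul_zero]
  rw [← setIntegral_eq_integral_of_forall_compl_eq_zero hzero]
  have hcongr : ∀ t ∈ Set.Ioi (0 : ℝ), (∫ y : Hyp θ, (|t| ^ k : ℝ) •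
      (b (t • (θ + (y : E n))) * F (t • (θ + (y : E n))) * osc ψ Λ (t • (θ + (y : E n))))) =
      ∫ y : Hyp θ, b (θ + (y : E n)) * (((t ^ (d + k) : ℝ) : ℂ) * F (t • (θ + (y : E n))) *
        expI (t * (Λ * ψ (θ + (y : E n))))) := by
    intro t ht
    have ht0 : 0 < t := ht
    refine integral_congr_ae (Eventually.of_forall fun y => ?_)
    simp only [osc_ray hψ Λ ht0, hb.hom t ht0, abs_of_pos ht0, Real.rpow_add ht0,
      Real.rpow_natCast, Complex.real_smul]
    push_cast
    ring
  rw [setIntegral_congr_fun measurableSet_Ioi hcongr]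
  simp only [rayFourier, ← integral_const_mul]
  obtain ⟨w, hw, hwb⟩ := exists_ray_bound F he
  refine integral_integral_swap ?_
  have hdom : Integrable (fun z : ℝ × Hyp θ => w z.1 * ‖b (θ + (z.2 : E n))‖)
      ((volume.restrict (Set.Ioi 0)).prod volume) := Integrable.mul_prod hw hbi.norm
  refine hdom.mono' ?_ ?_
  · have h1 : Continuous fun z : ℝ × Hyp θ => b (θ + (z.2 : E n)) := hbc.comp continuous_snd
    have h2 : Continuous fun z : ℝ × Hyp θ => F (z.1 • (θ + (z.2 : E n))) :=
      F.continuous.comp (by fun_prop)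
    have h3 : Continuous fun z : ℝ × Hyp θ => ψ (θ + (z.2 : E n)) :=
      (hψ.continuous_hyp hθ).comp continuous_snd
    have h4 : Continuous fun z : ℝ × Hyp θ => expI (z.1 * (Λ * ψ (θ + (z.2 : E n)))) :=
      continuous_expI.comp (continuous_fst.mul (continuous_const.mul h3))
    have h5 : Measurable fun z : ℝ × Hyp θ => ((z.1 ^ (d + k) : ℝ) : ℂ) := by fun_prop
    exact h1.aestronglyMeasurable.mul
      ((h5.aestronglyMeasurable.mul h2.aestronglyMeasurable).mul h4.aestronglyMeasurable)
  · have h6 : ∀ᵐ z ∂((volume.restrict (Set.Ioi (0 : ℝ))).prod (volume : Measure (Hyp θ))),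
        0 < z.1 :=
      Measure.quasiMeasurePreserving_fst.ae (ae_restrict_mem measurableSet_Ioi)
    filter_upwards [h6] with z hz
    simp only [Function.uncurry]
    rw [norm_mul, norm_mul, norm_mul, norm_expI, mul_one, Complex.norm_real,
      Real.norm_of_nonneg (Real.rpow_nonneg hz.le _), mul_comm]
    gcongr
    exact hwb _ (one_le_norm_add_hyp hθ z.2) _ hz

theorem integral_comp_equiv {V : Type*} [NormedAddCommGroup V] [InnerProductSpace ℝ V]
    [FiniteDimensional ℝ V] [MeasurableSpace V] [BorelSpace V] (T : V ≃L[ℝ] V) (g : V → ℂ) :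
    ∫ z, g (T z) = (|LinearMap.det (T : V →ₗ[ℝ] V)|⁻¹ : ℝ) • ∫ z, g z := by
  have hdet : LinearMap.det (T : V →ₗ[ℝ] V) ≠ 0 := (LinearEquiv.isUnit_det' T.toLinearEquiv).ne_zero
  have h := Measure.map_linearMap_addHaar_eq_smul_addHaar (volume : Measure V) hdet
  have h2 := T.toHomeomorph.measurableEmbedding.integral_map (μ := (volume : Measure V)) g
  have h3 : Measure.map (⇑T.toHomeomorph) (volume : Measure V) =
      Measure.map (⇑(T : V →ₗ[ℝ] V)) volume := rfl
  rw [h3, h, integral_smul_measure, abs_inv, ENNReal.toReal_ofReal (by positivity)] at h2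
  exact h2.symm

/-- After the t-integration the variable y enters through Λψ(θ + y), in which the ray transform
decays. Setting y = Λ^{-1/2} z absorbs the power of Λ, and Λψ(θ + Λ^{-1/2} z) tends to −σ‖Tz‖²/2. A
lower bound c‖y‖² for |ψ| on the cone gives a majorant independent of Λ; the linear change T then
leads to `fresnel`. -/
theorem stationary_phase_near (hn : 2 ≤ n) {θ : E n} (hθ : ‖θ‖ = 1) {ψ : E n → ℝ}
    (hψ : HomSymb 1 ψ) (h0 : ψ θ = 0) (h1 : fderiv ℝ ψ θ = 0) {σ : ℝ} (hσ : σ = 1 ∨ σ = -1)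
    (T : Hyp θ ≃L[ℝ] Hyp θ)
    (hT : ∀ z : Hyp θ, fderiv ℝ (fderiv ℝ ψ) θ z z = -σ * ‖T z‖ ^ 2) :
    ∃ δ > 0, ∀ d : ℝ, 0 ≤ d → ∀ b : E n → ℂ, HomSymb d b → SupportedInCone θ δ b →
      ∀ F : 𝓢(E n, ℂ), Tendsto (fun Λ : ℝ => ((Λ ^ (((n : ℝ) - 1) / 2) : ℝ) : ℂ) *
        ∫ ξ, b ξ * F ξ * osc ψ Λ ξ) atTop
        (𝓝 ((|LinearMap.det (T : Hyp θ →ₗ[ℝ] Hyp θ)|⁻¹ : ℝ) *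
          ((((2 * Real.pi) ^ (((n : ℝ) - 1) / 2) : ℝ) : ℂ) *
            Complex.exp (-(Complex.I * σ * Real.pi * (n - 1) / 4)) * b θ *
            ∫ t in Set.Ioi (0 : ℝ), ((t ^ (d + ((n : ℝ) - 1) / 2) : ℝ) : ℂ) * F (t • θ)))) := by
  have hn0 : n ≠ 0 := by omega
  have hfr := finrank_hyp hn0 hθ
  set k := Module.finrank ℝ (Hyp θ) with hk
  have hkn : (k : ℝ) = (n : ℝ) - 1 := by rw [hfr, Nat.cast_sub (by omega)]; simp
  have hknC : (k : ℂ) = (n : ℂ) - 1 := by rw [hfr, Nat.cast_sub (by omega)]; simp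
  -- Allows the decay exponent N = k in `fresnel`; it needs k = n − 1 ≥ 1.
  have hk1 : k < 2 * k := by omega
  have hσ1 : |σ| = 1 := by rcases hσ with rfl | rfl <;> simp
  have hθ0 : θ ≠ 0 := by rintro rfl; simp at hθ
  -- A lower bound for ‖Tz‖/‖z‖; the summand 1 avoids a separate case for norm zero.
  set c0 : ℝ := (‖(T.symm : Hyp θ →L[ℝ] Hyp θ)‖ + 1)⁻¹ with hc0
  have hc0p : 0 < c0 := by positivity
  have hTc : ∀ z : Hyp θ, c0 * ‖z‖ ≤ ‖T z‖ := fun z => by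
    rw [hc0, inv_mul_le_iff₀ (by positivity)]
    have := (T.symm : Hyp θ →L[ℝ] Hyp θ).le_opNorm (T z)
    simp only [ContinuousLinearEquiv.coe_coe, ContinuousLinearEquiv.symm_apply_apply] at this
    nlinarith [norm_nonneg (T z)]
  -- The quadratic part is at least c0²‖y‖²/2 in absolute value, so an error of c0²‖y‖²/4 leaves
  -- c0²‖y‖²/4.
  obtain ⟨δ', hδ', hδT⟩ := taylor_two_of_critical (hψ.contDiffAt hθ0) h0 h1
    (η := c0 ^ 2 / 4) (by positivity)
  have hlow : ∀ y : Hyp θ, ‖y‖ < δ' → c0 ^ 2 / 4 * ‖y‖ ^ 2 ≤ |ψ (θ + (y : E n))| := by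
    intro y hy
    have e1 := hδT y hy
    have e2 : |1 / 2 * fderiv ℝ (fderiv ℝ ψ) θ y y| = 1 / 2 * ‖T y‖ ^ 2 := by
      rw [hT, abs_mul, abs_mul, abs_neg, hσ1, one_mul, abs_of_nonneg (sq_nonneg ‖T y‖),
        abs_of_pos one_half_pos]
    have e3 : (c0 * ‖y‖) ^ 2 ≤ ‖T y‖ ^ 2 := by
      have := hTc y
      gcongr
    have e4 := abs_sub_abs_le_abs_sub (1 / 2 * fderiv ℝ (fderiv ℝ ψ) θ y y) (ψ (θ + (y : E n)))
    rw [abs_sub_comm] at e4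
    rw [e2] at e4
    have e5 : ‖(y : E n)‖ = ‖y‖ := rfl
    rw [e5] at e1
    rw [mul_pow] at e3
    linarith
  -- Half the radius puts the closed support cone inside the open ball where the Taylor estimate
  -- holds.
  refine ⟨δ' / 2, by positivity, fun d hd b hb hs F => ?_⟩
  set e : ℝ := d + k with he_def
  have hke : (k : ℝ) ≤ e := by linarith
  have he : -1 < e := by linarith [k.cast_nonneg (α := ℝ)]
  obtain ⟨C, hC, hCb⟩ := rayFourier_bound F k hke
  have hbc := hb.continuous_hyp hθ
  have hψc := hψ.continuous_hyp hθ
  have hbs : ∀ y : Hyp θ, b (θ + (y : E n)) ≠ 0 → ‖y‖ ≤ δ' / 2 := fun y hy => by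
    have := (hs 1 y (by simpa using hy)).2
    simpa using this
  obtain ⟨M, hM⟩ : ∃ M : ℝ, ∀ y : Hyp θ, ‖b (θ + (y : E n))‖ ≤ M := by
    refine hbc.bounded_above_of_compact_support ?_
    refine HasCompactSupport.of_support_subset_isCompact
      (isCompact_closedBall (0 : Hyp θ) (δ' / 2)) ?_
    intro y hy
    simpa using hbs y hy
  have hM0 : 0 ≤ M := (norm_nonneg _).trans (hM 0)
  have hcont : ∀ Λ R : ℝ, Continuous fun z : Hyp θ => b (θ + ((R • z : Hyp θ) : E n)) *
      rayFourier F e (θ + ((R • z : Hyp θ) : E n)) (Λ * ψ (θ + ((R • z : Hyp θ) : E n))) := by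
    intro Λ R
    have hR : Continuous fun z : Hyp θ => R • z := by fun_prop
    refine (hbc.comp hR).mul ?_
    exact continuous_rayFourier F he (fun z => one_le_norm_add_hyp hθ _) (by fun_prop)
      ((hψc.comp hR).const_mul Λ)
  have hscale : ∀ Λ : ℝ, 0 < Λ → ((Λ ^ (((n : ℝ) - 1) / 2) : ℝ) : ℂ) *
      ∫ ξ, b ξ * F ξ * osc ψ Λ ξ =
      ∫ z : Hyp θ, b (θ + (((Λ ^ (-(1 / 2) : ℝ)) • z : Hyp θ) : E n)) *
        rayFourier F e (θ + (((Λ ^ (-(1 / 2) : ℝ)) • z : Hyp θ) : E n))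
          (Λ * ψ (θ + (((Λ ^ (-(1 / 2) : ℝ)) • z : Hyp θ) : E n))) := by
    intro Λ hΛ
    rw [integral_cone_eq hn0 hθ hψ hd hb hs F Λ]
    have h := Measure.integral_comp_smul (volume : Measure (Hyp θ))
      (fun y : Hyp θ => b (θ + (y : E n)) *
        rayFourier F e (θ + (y : E n)) (Λ * ψ (θ + (y : E n)))) (Λ ^ (-(1 / 2) : ℝ))
    rw [h, Complex.real_smul, ← hkn, ← hk]
    congr 2
    rw [← Real.rpow_natCast, ← Real.rpow_mul hΛ.le, ← Real.rpow_neg hΛ.le,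
      abs_of_pos (Real.rpow_pos_of_pos hΛ _)]
    congr 1
    ring
  have hR0 : Tendsto (fun Λ : ℝ => Λ ^ (-(1 / 2) : ℝ)) atTop (𝓝 0) :=
    tendsto_rpow_neg_atTop one_half_pos
  have hlim : Tendsto (fun Λ : ℝ => ∫ z : Hyp θ,
      b (θ + (((Λ ^ (-(1 / 2) : ℝ)) • z : Hyp θ) : E n)) *
        rayFourier F e (θ + (((Λ ^ (-(1 / 2) : ℝ)) • z : Hyp θ) : E n))
          (Λ * ψ (θ + (((Λ ^ (-(1 / 2) : ℝ)) • z : Hyp θ) : E n)))) atTop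
      (𝓝 (∫ z : Hyp θ, b θ * rayFourier F e θ (-(σ * ‖T z‖ ^ 2 / 2)))) := by
    refine tendsto_integral_filter_of_dominated_convergence
      (fun z => M * (C * (1 + (c0 ^ 2 / 4 * ‖z‖ ^ 2) ^ k)⁻¹)) ?_ ?_
      (((integrable_inv_one_add_pow hk1 (by positivity)).const_mul C).const_mul M) ?_
    · exact Eventually.of_forall fun Λ => (hcont _ _).aestronglyMeasurable
    · filter_upwards [eventually_gt_atTop 0] with Λ hΛ
      refine Eventually.of_forall fun z => ?_
      by_cases hbz : b (θ + (((Λ ^ (-(1 / 2) : ℝ)) • z : Hyp θ) : E n)) = 0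
      · rw [hbz, zero_mul, norm_zero]
        positivity
      · have e1 := hlow _ ((hbs _ hbz).trans_lt (by linarith))
        have e2 : Λ * (Λ ^ (-(1 / 2) : ℝ)) ^ 2 = 1 := by
          rw [← Real.rpow_natCast, ← Real.rpow_mul hΛ.le]
          norm_num
          rw [Real.rpow_neg_one, mul_inv_cancel₀ hΛ.ne']
        have e3 : c0 ^ 2 / 4 * ‖z‖ ^ 2 ≤
            |Λ * ψ (θ + (((Λ ^ (-(1 / 2) : ℝ)) • z : Hyp θ) : E n))| := by
          rw [abs_mul, abs_of_pos hΛ]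
          calc c0 ^ 2 / 4 * ‖z‖ ^ 2 = Λ * (c0 ^ 2 / 4 * ‖(Λ ^ (-(1 / 2) : ℝ)) • z‖ ^ 2) := by
                rw [norm_smul, Real.norm_of_nonneg (by positivity), mul_pow]
                linear_combination (-(c0 ^ 2 / 4 * ‖z‖ ^ 2)) * e2
            _ ≤ _ := by gcongr
        rw [norm_mul]
        gcongr
        · exact hM _
        · refine (hCb _ (one_le_norm_add_hyp hθ _) _).trans ?_
          gcongr
    · refine Eventually.of_forall fun z => ?_
      have hRz : Tendsto (fun Λ : ℝ => (Λ ^ (-(1 / 2) : ℝ)) • z) atTop (𝓝 0) := by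
        simpa using hR0.smul_const z
      have hu : Tendsto (fun Λ : ℝ => θ + (((Λ ^ (-(1 / 2) : ℝ)) • z : Hyp θ) : E n)) atTop
          (𝓝 θ) := by
        have h2 : Continuous fun y : Hyp θ => θ + (y : E n) := by fun_prop
        have h3 := (h2.tendsto 0).comp hRz
        rwa [Submodule.coe_zero, add_zero] at h3
      have hbl : Tendsto (fun Λ : ℝ => b (θ + (((Λ ^ (-(1 / 2) : ℝ)) • z : Hyp θ) : E n))) atTop
          (𝓝 (b θ)) := (hb.contDiffAt hθ0).continuousAt.tendsto.comp hu
      refine hbl.mul (tendsto_rayFourier F he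
        (Eventually.of_forall fun Λ => one_le_norm_add_hyp hθ _) hu ?_)
      rw [Metric.tendsto_nhds]
      intro η hη
      -- For fixed z the Taylor error is multiplied by Λ‖Λ^{-1/2} z‖² = ‖z‖², which this tolerance
      -- compensates; the +1 covers z = 0.
      obtain ⟨δ₂, hδ₂, hT₂⟩ := taylor_two_of_critical (hψ.contDiffAt hθ0) h0 h1
        (η := η / (‖z‖ ^ 2 + 1)) (by positivity)
      have hRz0 : ∀ᶠ Λ : ℝ in atTop, ‖(Λ ^ (-(1 / 2) : ℝ)) • z‖ < δ₂ := by
        have := hRz.norm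
        rw [norm_zero] at this
        exact this.eventually (gt_mem_nhds hδ₂)
      filter_upwards [eventually_gt_atTop 0, hRz0] with Λ hΛ hz
      have e1 := hT₂ (((Λ ^ (-(1 / 2) : ℝ)) • z : Hyp θ) : E n) hz
      rw [hT] at e1
      have e2 : Λ * (Λ ^ (-(1 / 2) : ℝ)) ^ 2 = 1 := by
        rw [← Real.rpow_natCast, ← Real.rpow_mul hΛ.le]
        norm_num
        rw [Real.rpow_neg_one, mul_inv_cancel₀ hΛ.ne']
      have e3 : ‖T ((Λ ^ (-(1 / 2) : ℝ)) • z)‖ ^ 2 = (Λ ^ (-(1 / 2) : ℝ)) ^ 2 * ‖T z‖ ^ 2 := by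
        rw [map_smul, norm_smul, Real.norm_of_nonneg (by positivity), mul_pow]
      have e4 : ‖(((Λ ^ (-(1 / 2) : ℝ)) • z : Hyp θ) : E n)‖ ^ 2 =
          (Λ ^ (-(1 / 2) : ℝ)) ^ 2 * ‖z‖ ^ 2 := by
        change ‖(Λ ^ (-(1 / 2) : ℝ)) • z‖ ^ 2 = _
        rw [norm_smul, Real.norm_of_nonneg (by positivity), mul_pow]
      rw [e3, e4] at e1
      rw [Real.dist_eq]
      have e5 : Λ * ψ (θ + (((Λ ^ (-(1 / 2) : ℝ)) • z : Hyp θ) : E n)) -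
          -(σ * ‖T z‖ ^ 2 / 2) = Λ * (ψ (θ + (((Λ ^ (-(1 / 2) : ℝ)) • z : Hyp θ) : E n)) -
            1 / 2 * (-σ * ((Λ ^ (-(1 / 2) : ℝ)) ^ 2 * ‖T z‖ ^ 2))) := by
        linear_combination (-(σ * ‖T z‖ ^ 2 / 2)) * e2
      rw [e5, abs_mul, abs_of_pos hΛ]
      calc Λ * |_| ≤ Λ * (η / (‖z‖ ^ 2 + 1) * ((Λ ^ (-(1 / 2) : ℝ)) ^ 2 * ‖z‖ ^ 2)) := by
            gcongr
        _ = η / (‖z‖ ^ 2 + 1) * ‖z‖ ^ 2 := by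
            linear_combination (η / (‖z‖ ^ 2 + 1) * ‖z‖ ^ 2) * e2
        _ < η := by
            rw [div_mul_eq_mul_div, div_lt_iff₀ (by positivity)]
            nlinarith
  have hval : ∫ z : Hyp θ, b θ * rayFourier F e θ (-(σ * ‖T z‖ ^ 2 / 2)) =
      ((|LinearMap.det (T : Hyp θ →ₗ[ℝ] Hyp θ)|⁻¹ : ℝ) *
          ((((2 * Real.pi) ^ (((n : ℝ) - 1) / 2) : ℝ) : ℂ) *
            Complex.exp (-(Complex.I * σ * Real.pi * (n - 1) / 4)) * b θ *
            ∫ t in Set.Ioi (0 : ℝ), ((t ^ (d + ((n : ℝ) - 1) / 2) : ℝ) : ℂ) * F (t • θ))) := by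
    have h2 := integral_comp_equiv T
      (fun u : Hyp θ => b θ * rayFourier F e θ (-(σ * ‖u‖ ^ 2 / 2)))
    rw [h2, integral_const_mul, fresnel F hk1 hke hθ.ge hσ, ← hk, hkn, hknC, Complex.real_smul]
    have h3 : e - ((n : ℝ) - 1) / 2 = d + ((n : ℝ) - 1) / 2 := by rw [he_def, hkn]; ring
    rw [h3]
    ring
  rw [← hval]
  refine hlim.congr' ?_
  filter_upwards [eventually_gt_atTop 0] with Λ hΛ
  exact (hscale Λ hΛ).symm

end Near

end Conormal

namespace Conormal

open scoped SchwartzMap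

/-! ### The reduced Hessian -/

section Hessian

variable {n : ℕ}

/-- The Gram matrix of a bilinear form in the standard orthonormal basis of a subspace. -/
def gram (W : Submodule ℝ (E n)) (L : E n →L[ℝ] E n →L[ℝ] ℝ) :
    Matrix (Fin (Module.finrank ℝ W)) (Fin (Module.finrank ℝ W)) ℝ :=
  Matrix.of fun i j => L (stdOrthonormalBasis ℝ W i : E n) (stdOrthonormalBasis ℝ W j : E n)

theorem hess_eq_gram (H : E n → ℝ) (α : E n) : hess H α = gram (Hyp α) (fderiv ℝ (fderiv ℝ H) α) :=
  rfl

theorem gram_neg (W : Submodule ℝ (E n)) (L : E n →L[ℝ] E n →L[ℝ] ℝ) : gram W (-L) = -gram W L := by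
  ext i j
  simp [gram]

theorem signature_of_posDef {k : ℕ} {M : Matrix (Fin k) (Fin k) ℝ} (hM : M.PosDef) :
    signature M = k := by
  have h := hM.1.roots_charpoly_eq_eigenvalues
  have h1 : M.charpoly.roots.countP (fun x => 0 < x) = k := by
    rw [Multiset.countP_eq_card.2]
    · rw [h]
      simp
    · intro a ha
      rw [h] at ha
      obtain ⟨i, -, rfl⟩ := Multiset.mem_map.1 ha
      exact hM.eigenvalues_pos i
  have h2 : M.charpoly.roots.countP (fun x => x < 0) = 0 := by
    rw [Multiset.countP_eq_zero]
    intro a ha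
    rw [h] at ha
    obtain ⟨i, -, rfl⟩ := Multiset.mem_map.1 ha
    exact not_lt.2 (hM.eigenvalues_pos i).le
  unfold signature
  convert! congrArg₂ (fun a b : ℕ => (a : ℤ) - b) h1 h2 using 1

theorem signature_of_neg_posDef {k : ℕ} {M : Matrix (Fin k) (Fin k) ℝ} (hM : (-M).PosDef) :
    signature M = -k := by
  have hH : M.IsHermitian := by simpa using hM.1.neg
  have h := hH.roots_charpoly_eq_eigenvalues
  have hneg : ∀ i, hH.eigenvalues i < 0 := fun i => by
    have hv := hH.mulVec_eigenvectorBasis i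
    have hne : (hH.eigenvectorBasis i : Fin k → ℝ) ≠ 0 := by
      intro h0
      have h1 := hH.eigenvectorBasis.orthonormal.1 i
      have h2 : hH.eigenvectorBasis i = 0 := by
        ext j
        exact congrFun h0 j
      rw [h2, norm_zero] at h1
      exact zero_ne_one h1
    have hp := hM.dotProduct_mulVec_pos hne
    rw [Matrix.neg_mulVec, hv, dotProduct_neg, dotProduct_smul] at hp
    have hq : 0 ≤ star (hH.eigenvectorBasis i : Fin k → ℝ) ⬝ᵥ (hH.eigenvectorBasis i : Fin k → ℝ) :=
      Finset.sum_nonneg fun j _ => mul_self_nonneg _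
    simp only [smul_eq_mul] at hp
    by_contra hc
    nlinarith [mul_nonneg (not_lt.1 hc) hq]
  have h1 : M.charpoly.roots.countP (fun x => x < 0) = k := by
    rw [Multiset.countP_eq_card.2]
    · rw [h]
      simp
    · intro a ha
      rw [h] at ha
      obtain ⟨i, -, rfl⟩ := Multiset.mem_map.1 ha
      exact hneg i
  have h2 : M.charpoly.roots.countP (fun x => 0 < x) = 0 := by
    rw [Multiset.countP_eq_zero]
    intro a ha
    rw [h] at ha
    obtain ⟨i, -, rfl⟩ := Multiset.mem_map.1 ha
    exact not_lt.2 (hneg i).le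
  unfold signature
  convert! congrArg₂ (fun a b : ℕ => (a : ℤ) - b) h2 h1 using 1
  simp

theorem apply_eq_dotProduct_gram (W : Submodule ℝ (E n)) (L : E n →L[ℝ] E n →L[ℝ] ℝ) (z : W) :
    L z z = ((stdOrthonormalBasis ℝ W).toBasis.repr z : _ → ℝ) ⬝ᵥ
      (gram W L).mulVec ((stdOrthonormalBasis ℝ W).toBasis.repr z) := by
  set b := stdOrthonormalBasis ℝ W
  have hz : (z : E n) = ∑ i, b.toBasis.repr z i • (b i : E n) := by
    conv_lhs => rw [← b.toBasis.sum_repr z]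
    simp
  conv_lhs => rw [hz]
  simp only [map_sum, map_smul, sum_apply, smul_apply, smul_eq_mul, dotProduct, Matrix.mulVec, gram,
    Matrix.of_apply, Finset.mul_sum]
  rw [Finset.sum_comm]
  refine Finset.sum_congr rfl fun i _ => Finset.sum_congr rfl fun j _ => ?_
  ring

/-- A positive definite matrix factors as BᵀB, and T is the map with matrix B. Only T with this
quadratic form and this determinant is needed, not a diagonalization. -/
theorem exists_equiv_of_gram (W : Submodule ℝ (E n)) (L : E n →L[ℝ] E n →L[ℝ] ℝ) {σ : ℝ}
    (hσ : σ = 1 ∨ σ = -1) (hpos : (-σ • gram W L).PosDef) :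
    ∃ T : W ≃L[ℝ] W, (∀ z : W, L z z = -σ * ‖T z‖ ^ 2) ∧
      |LinearMap.det (T : W →ₗ[ℝ] W)| = Real.sqrt |(gram W L).det| := by
  obtain ⟨B, hB⟩ : ∃ B : Matrix (Fin (Module.finrank ℝ W)) (Fin (Module.finrank ℝ W)) ℝ,
      -σ • gram W L = B.transpose * B := by
    open scoped MatrixOrder in
    obtain ⟨B, hB⟩ := CStarAlgebra.nonneg_iff_eq_star_mul_self.mp hpos.posSemidef.nonneg
    refine ⟨B, hB.trans ?_⟩
    rw [Matrix.star_eq_conjTranspose, Matrix.conjTranspose_eq_transpose_of_trivial]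
  set b := stdOrthonormalBasis ℝ W with hb
  set f : W →ₗ[ℝ] W := Matrix.toLin b.toBasis b.toBasis B with hf
  have hdetf : LinearMap.det f = B.det := LinearMap.det_toLin _ _
  have hdet2 : B.det ^ 2 = |(gram W L).det| := by
    have h1 : (-σ • gram W L).det = B.det ^ 2 := by
      rw [hB, Matrix.det_mul, Matrix.det_transpose, sq]
    have h2 : |(-σ • gram W L).det| = |(gram W L).det| := by
      rw [Matrix.det_smul, abs_mul, abs_pow, abs_neg]
      rcases hσ with rfl | rfl <;> simp
    rw [← h2, h1, abs_of_nonneg (sq_nonneg _)]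
  have hne : LinearMap.det f ≠ 0 := by
    intro h0
    rw [hdetf] at h0
    have h1 := hpos.det_pos
    rw [hB, Matrix.det_mul, h0, mul_zero] at h1
    exact lt_irrefl _ h1
  refine ⟨(LinearMap.equivOfDetNeZero f hne).toContinuousLinearEquiv, fun z => ?_, ?_⟩
  · have hT : ((LinearMap.equivOfDetNeZero f hne).toContinuousLinearEquiv z) = f z := rfl
    rw [hT, apply_eq_dotProduct_gram]
    have h1 : ‖f z‖ ^ 2 = (b.toBasis.repr (f z) : _ → ℝ) ⬝ᵥ (b.toBasis.repr (f z) : _ → ℝ) := by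
      rw [← b.repr.norm_map (f z), EuclideanSpace.norm_sq_eq]
      simp [dotProduct, sq]
    have h2 : (b.toBasis.repr (f z) : _ → ℝ) = B.mulVec (b.toBasis.repr z) := by
      rw [← LinearMap.toMatrix_mulVec_repr b.toBasis b.toBasis f z, hf, LinearMap.toMatrix_toLin]
    have h3 : gram W L = -σ • (B.transpose * B) := by
      rw [← hB, smul_smul]
      rcases hσ with rfl | rfl <;> simp
    rw [h1, h2, h3, Matrix.smul_mulVec, dotProduct_smul, ← Matrix.mulVec_mulVec,
      Matrix.dotProduct_mulVec, Matrix.vecMul_transpose, smul_eq_mul]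
  · have hT : (((LinearMap.equivOfDetNeZero f hne).toContinuousLinearEquiv : W ≃L[ℝ] W) :
        W →ₗ[ℝ] W) = f := rfl
    rw [hT, hdetf, ← hdet2, Real.sqrt_sq_eq_abs]

/-- The matrix of `L + α ⊗ α` in the standard basis of `ℝⁿ`. -/
def borderedMatrix (L : E n →L[ℝ] E n →L[ℝ] ℝ) (α : E n) : Matrix (Fin n) (Fin n) ℝ :=
  Matrix.of fun i j => L (stdVec j) (stdVec i) + α j * α i

/-- The Gram matrix uses an orthonormal basis of α^⊥ chosen with no continuity in α, so smoothness
of its determinant is not visible. The form L + α⊗α has the same determinant in a fixed basis: in an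
orthonormal basis adapted to α its matrix is block triangular with diagonal blocks the transposed
Gram matrix and 1, because Lα = 0. -/
theorem det_borderedMatrix {L : E n →L[ℝ] E n →L[ℝ] ℝ} {α : E n} (hα : ‖α‖ = 1) (hL : L α = 0) :
    (borderedMatrix L α).det = (gram (Hyp α) L).det := by
  set e := EuclideanSpace.basisFun (Fin n) ℝ with he
  let S : E n →ₗ[ℝ] E n := ∑ i, ((LinearMap.toSpanSingleton ℝ (E n) (stdVec i)).comp
    (((ContinuousLinearMap.apply ℝ ℝ (stdVec i : E n)).comp L +
      (α i) • (innerSL ℝ α)).toLinearMap))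
  have hS : ∀ x y, ⟪y, S x⟫ = L x y + ⟪α, x⟫ * ⟪α, y⟫ := by
    intro x y
    have hy : y = ∑ i, y i • (stdVec i : E n) := by
      conv_lhs => rw [← e.sum_repr y]
      simp [he]
    have h1 : L x y = ∑ i, y i * L x (stdVec i) := by
      conv_lhs => rw [hy]
      simp
    have h2 : ⟪α, y⟫ = ∑ i, y i * α i := by
      rw [PiLp.inner_apply]
      simp
    have h3 : ⟪y, S x⟫ = ∑ i, (L x (stdVec i) + α i * ⟪α, x⟫) * y i := by
      simp only [S, LinearMap.sum_apply, LinearMap.comp_apply, inner_sum,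
        LinearMap.toSpanSingleton_apply, inner_smul_right]
      refine Finset.sum_congr rfl fun i _ => ?_
      rw [EuclideanSpace.inner_single_right]
      simp
    rw [h1, h2, h3, Finset.mul_sum, ← Finset.sum_add_distrib]
    refine Finset.sum_congr rfl fun i _ => ?_
    ring
  have hd1 : LinearMap.det S = (borderedMatrix L α).det := by
    rw [← LinearMap.det_toMatrix e.toBasis]
    congr 1
    ext i j
    rw [LinearMap.toMatrix_apply]
    have : (e.toBasis.repr (S (e.toBasis j))) i = ⟪e i, S (e j)⟫ := by
      rw [← e.repr_apply_apply]
      simp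
    rw [this, hS, he]
    simp [borderedMatrix, EuclideanSpace.inner_single_right]
  set w := stdOrthonormalBasis ℝ (Hyp α) with hw
  let v : Fin (Module.finrank ℝ (Hyp α)) ⊕ Unit → E n := Sum.elim (fun i => (w i : E n)) fun _ => α
  have hwα : ∀ i, ⟪α, (w i : E n)⟫ = 0 := fun i => inner_hyp α (w i)
  have hv : Orthonormal ℝ v := by
    rw [orthonormal_iff_ite]
    rintro (i | i) (j | j)
    · have := orthonormal_iff_ite.1 w.orthonormal i j
      simpa [v] using this
    · simp [v, real_inner_comm, hwα]
    · simp [v, hwα]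
    · simp [v, hα]
  have hspan : ⊤ ≤ Submodule.span ℝ (Set.range v) := by
    have hn : n ≠ 0 := by
      rintro rfl
      rw [Subsingleton.elim α 0, norm_zero] at hα
      exact zero_ne_one hα
    have hcard : Fintype.card (Fin (Module.finrank ℝ (Hyp α)) ⊕ Unit) =
        Module.finrank ℝ (E n) := by
      rw [Fintype.card_sum, Fintype.card_fin, finrank_hyp hn hα, finrank_euclideanSpace_fin,
        Fintype.card_unit]
      omega
    exact (hv.linearIndependent.span_eq_top_of_card_eq_finrank' hcard).ge
  let u := OrthonormalBasis.mk hv hspan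
  have hu : ∀ i, u i = v i := fun i => by simp [u]
  rw [← hd1, ← LinearMap.det_toMatrix u.toBasis]
  have hblock : LinearMap.toMatrix u.toBasis u.toBasis S =
      Matrix.fromBlocks (gram (Hyp α) L).transpose 0
        (Matrix.of fun _ j => L (w j) α) 1 := by
    ext i j
    rw [LinearMap.toMatrix_apply]
    have : (u.toBasis.repr (S (u.toBasis j))) i = ⟪u i, S (u j)⟫ := by
      rw [← u.repr_apply_apply]
      simp
    rw [this, hS, hu, hu]
    rcases i with i | i <;> rcases j with j | j
    · have := hwα i
      simp [v, gram, ← hw, this]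
    · simp [v, hwα, hL]
    · simp [v, hwα]
    · simp [v, hα, hL]
  rw [hblock, Matrix.det_fromBlocks_zero₁₂, Matrix.det_one, mul_one, Matrix.det_transpose]

end Hessian

end Conormal

namespace Conormal

open scoped SchwartzMap

/-! ### The phase function -/

section Phase

variable {n : ℕ}

/-- The phase `H(ξ) - ξ·x₀`, with the value `0` at the origin. -/
def phase (H : E n → ℝ) (x₀ : E n) : E n → ℝ :=
  Set.indicator {0}ᶜ fun ξ => H ξ - ⟪ξ, x₀⟫

variable {H : E n → ℝ} {x₀ : E n}

theorem phase_of_ne {ξ : E n} (hξ : ξ ≠ 0) : phase H x₀ ξ = H ξ - ⟪ξ, x₀⟫ :=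
  Set.indicator_of_mem (s := {0}ᶜ) hξ _

theorem phase_zero : phase H x₀ 0 = 0 := Set.indicator_of_notMem (by simp) _

theorem phase_eventuallyEq {ξ : E n} (hξ : ξ ≠ 0) :
    phase H x₀ =ᶠ[𝓝 ξ] fun ξ => H ξ - ⟪ξ, x₀⟫ := by
  filter_upwards [isOpen_compl_singleton.mem_nhds hξ] with x hx
  exact phase_of_ne hx

theorem contDiffAt_of_ne (hH : ContDiffOn ℝ ∞ H {0}ᶜ) {ξ : E n} (hξ : ξ ≠ 0) :
    ContDiffAt ℝ ∞ H ξ :=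
  hH.contDiffAt (isOpen_compl_singleton.mem_nhds hξ)

/-- The value of H at the origin is arbitrary. `phase` is set to 0 there because homogeneity is
required at every point. -/
theorem homSymb_phase (hH : ContDiffOn ℝ ∞ H {0}ᶜ)
    (hom : ∀ (t : ℝ) (ξ : E n), t ≠ 0 → ξ ≠ 0 → H (t • ξ) = t * H ξ) :
    HomSymb 1 (phase H x₀) := by
  refine HomSymb.of_contDiffAt (fun ξ hξ => ?_) fun t ht ξ => ?_
  · refine ContDiffAt.congr_of_eventuallyEq ?_ (phase_eventuallyEq hξ)
    exact (contDiffAt_of_ne hH hξ).sub (contDiffAt_id.inner ℝ contDiffAt_const)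
  · by_cases hξ : ξ = 0
    · simp [hξ, phase_zero]
    · rw [phase_of_ne hξ, phase_of_ne (smul_ne_zero ht.ne' hξ), hom t ξ ht.ne' hξ,
        real_inner_smul_left, Real.rpow_one, smul_eq_mul, mul_sub]

theorem hasFDerivAt_inner_right (x₀ ξ : E n) :
    HasFDerivAt (fun ξ : E n => ⟪ξ, x₀⟫) (innerSL ℝ x₀) ξ := by
  have h : (fun ξ : E n => ⟪ξ, x₀⟫) = fun ξ => innerSL ℝ x₀ ξ := by
    funext ξ
    rw [innerSL_apply_apply, real_inner_comm]
  rw [h]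
  exact (innerSL ℝ x₀).hasFDerivAt

theorem fderiv_phase (hH : ContDiffOn ℝ ∞ H {0}ᶜ) {ξ : E n} (hξ : ξ ≠ 0) :
    fderiv ℝ (phase H x₀) ξ = fderiv ℝ H ξ - innerSL ℝ x₀ := by
  rw [(phase_eventuallyEq hξ).fderiv_eq]
  exact (((contDiffAt_of_ne hH hξ).differentiableAt (by simp)).hasFDerivAt.sub
    (hasFDerivAt_inner_right x₀ ξ)).fderiv

theorem fderiv_fderiv_phase (hH : ContDiffOn ℝ ∞ H {0}ᶜ) {ξ : E n} (hξ : ξ ≠ 0) :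
    fderiv ℝ (fderiv ℝ (phase H x₀)) ξ = fderiv ℝ (fderiv ℝ H) ξ := by
  have h : fderiv ℝ (phase H x₀) =ᶠ[𝓝 ξ] fun ξ => fderiv ℝ H ξ - innerSL ℝ x₀ := by
    filter_upwards [isOpen_compl_singleton.mem_nhds hξ] with x hx
    exact fderiv_phase hH hx
  rw [h.fderiv_eq, fderiv_sub_const]

theorem fderiv_phase_eq_zero_iff (hH : ContDiffOn ℝ ∞ H {0}ᶜ) {ξ : E n} (hξ : ξ ≠ 0) :
    fderiv ℝ (phase H x₀) ξ = 0 ↔ HasGradientAt H x₀ ξ := by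
  rw [fderiv_phase hH hξ, sub_eq_zero, hasGradientAt_iff_hasFDerivAt]
  have hd := ((contDiffAt_of_ne hH hξ).differentiableAt (by simp : (∞ : WithTop ℕ∞) ≠ 0)).hasFDerivAt
  have e : (InnerProductSpace.toDual ℝ (E n)) x₀ = innerSL ℝ x₀ := by
    ext y
    simp
  rw [e]
  exact ⟨fun h => h ▸ hd, fun h => hd.unique h⟩

theorem fderiv_comp_neg_apply {F G : Type*} [NormedAddCommGroup F] [NormedSpace ℝ F]
    [NormedAddCommGroup G] [NormedSpace ℝ G] (g : F → G) (x : F) :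
    fderiv ℝ (fun y => g (-y)) x = -fderiv ℝ g (-x) := by
  simpa using fderiv_comp_smul (𝕜 := ℝ) (f := g) (x := x) (-1)

theorem fderiv_neg_eq (hom : ∀ (t : ℝ) (ξ : E n), t ≠ 0 → ξ ≠ 0 → H (t • ξ) = t * H ξ) {ξ : E n}
    (hξ : ξ ≠ 0) : fderiv ℝ H (-ξ) = fderiv ℝ H ξ := by
  have h : H =ᶠ[𝓝 ξ] fun x => -H (-x) := by
    filter_upwards [isOpen_compl_singleton.mem_nhds hξ] with x hx
    have := hom (-1) x (by norm_num) hx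
    rw [neg_one_smul] at this
    rw [this]
    ring
  conv_rhs => rw [h.fderiv_eq]
  rw [fderiv_fun_neg, fderiv_comp_neg_apply, neg_neg]

theorem fderiv_fderiv_neg_eq
    (hom : ∀ (t : ℝ) (ξ : E n), t ≠ 0 → ξ ≠ 0 → H (t • ξ) = t * H ξ) {ξ : E n}
    (hξ : ξ ≠ 0) : fderiv ℝ (fderiv ℝ H) (-ξ) = -fderiv ℝ (fderiv ℝ H) ξ := by
  have h : fderiv ℝ H =ᶠ[𝓝 ξ] fun x => fderiv ℝ H (-x) := by
    filter_upwards [isOpen_compl_singleton.mem_nhds hξ] with x hx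
    exact (fderiv_neg_eq hom hx).symm
  rw [h.fderiv_eq, fderiv_comp_neg_apply, neg_neg]

theorem HomSymb.fderiv_smul {ψ : E n → ℝ} (hψ : HomSymb 1 ψ) {t : ℝ} (ht : 0 < t) (ξ : E n) :
    fderiv ℝ ψ (t • ξ) = fderiv ℝ ψ ξ := by
  ext v
  simpa using (hψ.fderiv_apply v).hom t ht ξ

/-- The gradient has degree 0, hence is constant along the ray through ξ. The Hessian thus
degenerates in the radial direction, and only its restriction to the orthogonal hyperplane matters.
-/
theorem HomSymb.fderiv_fderiv_self {ψ : E n → ℝ} (hψ : HomSymb 1 ψ) {ξ : E n} (hξ : ξ ≠ 0) :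
    fderiv ℝ (fderiv ℝ ψ) ξ ξ = 0 := by
  have hd : DifferentiableAt ℝ (fderiv ℝ ψ) ξ :=
    ((hψ.contDiffAt hξ).fderiv_right (m := ∞) (by simp)).differentiableAt (by simp)
  have h1 : HasDerivAt (fun t : ℝ => t • ξ) ξ 1 := by
    simpa using (hasDerivAt_id (1 : ℝ)).smul_const ξ
  have h2 : HasDerivAt (fun t : ℝ => fderiv ℝ ψ (t • ξ)) (fderiv ℝ (fderiv ℝ ψ) ξ ξ) 1 :=
    HasFDerivAt.comp_hasDerivAt (1 : ℝ) (by simpa using hd.hasFDerivAt) h1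
  have h3 : (fun t : ℝ => fderiv ℝ ψ (t • ξ)) =ᶠ[𝓝 1] fun _ => fderiv ℝ ψ ξ := by
    filter_upwards [isOpen_Ioi.mem_nhds (show (0 : ℝ) < 1 from one_pos)] with t ht
    exact hψ.fderiv_smul ht ξ
  exact h2.unique ((hasDerivAt_const (1 : ℝ) (fderiv ℝ ψ ξ)).congr_of_eventuallyEq h3)

/-- Euler's identity ψ(ξ) = ψ'(ξ)ξ: the phase itself vanishes on critical rays, so no oscillating
factor survives in the limit. -/
theorem HomSymb.eq_zero_of_fderiv {ψ : E n → ℝ} (hψ : HomSymb 1 ψ) {ξ : E n} (hξ : ξ ≠ 0)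
    (h : fderiv ℝ ψ ξ = 0) : ψ ξ = 0 := by
  have h1 : HasDerivAt (fun t : ℝ => t • ξ) ξ 1 := by
    simpa using (hasDerivAt_id (1 : ℝ)).smul_const ξ
  have h2 : HasDerivAt (fun t : ℝ => ψ (t • ξ)) (fderiv ℝ ψ ξ ξ) 1 :=
    HasFDerivAt.comp_hasDerivAt (1 : ℝ)
      (by simpa using (hψ.differentiableAt hξ).hasFDerivAt) h1
  have h3 : (fun t : ℝ => ψ (t • ξ)) =ᶠ[𝓝 1] fun t => t * ψ ξ := by
    filter_upwards [isOpen_Ioi.mem_nhds (show (0 : ℝ) < 1 from one_pos)] with t ht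
    rw [hψ.hom t ht, Real.rpow_one, smul_eq_mul]
  have h4 : HasDerivAt (fun t : ℝ => ψ (t • ξ)) (ψ ξ) 1 := by
    refine HasDerivAt.congr_of_eventuallyEq ?_ h3
    simpa using (hasDerivAt_id (1 : ℝ)).mul_const (ψ ξ)
  rw [h4.unique h2, h]
  simp

theorem fderiv_fderiv_self (hH : ContDiffOn ℝ ∞ H {0}ᶜ)
    (hom : ∀ (t : ℝ) (ξ : E n), t ≠ 0 → ξ ≠ 0 → H (t • ξ) = t * H ξ) {ξ : E n} (hξ : ξ ≠ 0) :
    fderiv ℝ (fderiv ℝ H) ξ ξ = 0 := by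
  rw [← fderiv_fderiv_phase (x₀ := 0) hH hξ]
  exact (homSymb_phase hH hom).fderiv_fderiv_self hξ

theorem hyp_neg (α : E n) : Hyp (-α) = Hyp α := by
  unfold Hyp
  rw [← Set.neg_singleton, Submodule.span_neg]

/-- H is odd, so its Hessian is odd too: negative definiteness on Ω becomes positive definiteness on
−Ω. -/
theorem posDef_hess_neg (hom : ∀ (t : ℝ) (ξ : E n), t ≠ 0 → ξ ≠ 0 → H (t • ξ) = t * H ξ)
    {α : E n} (hα : α ≠ 0) (h : (-(hess H α)).PosDef) : (hess H (-α)).PosDef := by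
  -- The size of the matrix depends on the subspace, so the equality of the hyperplanes of α and −α
  -- is used through a generalized W instead of a rewrite.
  have key : ∀ W, W = Hyp α → (gram W (-fderiv ℝ (fderiv ℝ H) α)).PosDef := by
    rintro _ rfl
    rw [gram_neg]
    exact h
  rw [hess_eq_gram, fderiv_fderiv_neg_eq hom hα]
  exact key _ (hyp_neg α)

theorem det_hess_eq (hH : ContDiffOn ℝ ∞ H {0}ᶜ)
    (hom : ∀ (t : ℝ) (ξ : E n), t ≠ 0 → ξ ≠ 0 → H (t • ξ) = t * H ξ) {α : E n} (hα : ‖α‖ = 1) :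
    (hess H α).det = (borderedMatrix (fderiv ℝ (fderiv ℝ H) α) α).det := by
  have h0 : α ≠ 0 := by rintro rfl; simp at hα
  rw [det_borderedMatrix hα (fderiv_fderiv_self hH hom h0), hess_eq_gram]

theorem contDiffAt_det_hess (hH : ContDiffOn ℝ ∞ H {0}ᶜ)
    (hom : ∀ (t : ℝ) (ξ : E n), t ≠ 0 → ξ ≠ 0 → H (t • ξ) = t * H ξ) {ξ : E n} (hξ : ξ ≠ 0) :
    ContDiffAt ℝ ∞ (fun ξ => (hess H (‖ξ‖⁻¹ • ξ)).det) ξ := by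
  have hu : ContDiffAt ℝ ∞ (fun ξ : E n => ‖ξ‖⁻¹ • ξ) ξ :=
    ((contDiffAt_norm ℝ hξ).inv (norm_ne_zero_iff.2 hξ)).smul contDiffAt_id
  have hne : ‖ξ‖⁻¹ • ξ ≠ 0 := smul_ne_zero (inv_ne_zero (norm_ne_zero_iff.2 hξ)) hξ
  have h2 : ContDiffAt ℝ ∞ (fun ξ : E n => fderiv ℝ (fderiv ℝ H) (‖ξ‖⁻¹ • ξ)) ξ := by
    have h3 : ContDiffAt ℝ ∞ (fderiv ℝ (fderiv ℝ H)) (‖ξ‖⁻¹ • ξ) :=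
      ((contDiffAt_of_ne hH hne).fderiv_right (m := ∞) (by simp)).fderiv_right (m := ∞) (by simp)
    exact ContDiffAt.comp (g := fderiv ℝ (fderiv ℝ H)) (f := fun ξ => ‖ξ‖⁻¹ • ξ) ξ h3 hu
  have h4 : ContDiffAt ℝ ∞ (fun ξ : E n =>
      (borderedMatrix (fderiv ℝ (fderiv ℝ H) (‖ξ‖⁻¹ • ξ)) (‖ξ‖⁻¹ • ξ)).det) ξ := by
    simp only [Matrix.det_apply]
    refine ContDiffAt.sum fun τ _ => ContDiffAt.const_smul _ (contDiffAt_prod fun i _ => ?_)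
    have hcoord : ∀ j : Fin n, ContDiffAt ℝ ∞ (fun ξ : E n => (‖ξ‖⁻¹ • ξ) j) ξ := fun j =>
      (EuclideanSpace.proj j : E n →L[ℝ] ℝ).contDiff.contDiffAt.comp ξ hu
    simp only [borderedMatrix, Matrix.of_apply]
    exact ((h2.clm_apply contDiffAt_const).clm_apply contDiffAt_const).add
      ((hcoord _).mul (hcoord _))
  refine h4.congr_of_eventuallyEq ?_
  filter_upwards [isOpen_compl_singleton.mem_nhds hξ] with x hx
  refine det_hess_eq hH hom ?_
  rw [norm_smul, norm_inv, norm_norm, inv_mul_cancel₀ (norm_ne_zero_iff.2 hx)]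

/-! ### The amplitude -/

/-- The constant `(2π)^{-(n-1)/2} e^{iσπ(n-1)/4}`. -/
def omegaConst (n : ℕ) (σ : ℝ) : ℂ :=
  Complex.exp (Complex.I * σ * Real.pi * (n - 1) / 4) /
    (((2 * Real.pi) ^ (((n : ℝ) - 1) / 2) : ℝ) : ℂ)

/-- The signature is constantly −(n−1) on Ω, so the only part of ω that varies there is the square
root of the determinant. -/
theorem omega_eq_of_neg (hn : n ≠ 0) {α : E n} (hα : ‖α‖ = 1) (h : (-(hess H α)).PosDef) :
    omega H α = Real.sqrt |(hess H α).det| * omegaConst n 1 := by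
  have hk : ((Module.finrank ℝ (Hyp α) : ℕ) : ℂ) = n - 1 := by
    rw [finrank_hyp hn hα, Nat.cast_sub (by omega)]
    simp
  rw [omega, omegaConst, signature_of_neg_posDef h, mul_div_assoc]
  push_cast
  rw [hk]
  congr 3
  ring

theorem omega_eq_of_pos (hn : n ≠ 0) {α : E n} (hα : ‖α‖ = 1) (h : (hess H α).PosDef) :
    omega H α = Real.sqrt |(hess H α).det| * omegaConst n (-1) := by
  have hk : ((Module.finrank ℝ (Hyp α) : ℕ) : ℂ) = n - 1 := by
    rw [finrank_hyp hn hα, Nat.cast_sub (by omega)]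
    simp
  rw [omega, omegaConst, signature_of_posDef h, mul_div_assoc]
  push_cast
  rw [hk]
  congr 3
  ring

/-- The homogeneous function of degree `-s` with the values `ω a` on the unit sphere. -/
def amp (H : E n → ℝ) (s : ℝ) (a : E n → ℂ) (ξ : E n) : ℂ :=
  ((‖ξ‖ ^ (-s) : ℝ) : ℂ) * (omega H (‖ξ‖⁻¹ • ξ) * a (‖ξ‖⁻¹ • ξ))

theorem norm_unit {ξ : E n} (hξ : ξ ≠ 0) : ‖‖ξ‖⁻¹ • ξ‖ = 1 := by
  rw [norm_smul, norm_inv, norm_norm, inv_mul_cancel₀ (norm_ne_zero_iff.2 hξ)]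

theorem continuousAt_unit {ξ : E n} (hξ : ξ ≠ 0) : ContinuousAt (fun ξ : E n => ‖ξ‖⁻¹ • ξ) ξ :=
  (continuous_norm.continuousAt.inv₀ (norm_ne_zero_iff.2 hξ)).smul continuousAt_id

theorem amp_eventuallyEq_zero {s : ℝ} {a : E n → ℂ} {K : Set (E n)} (hK : IsCompact K)
    (ha : ∀ α ∈ Metric.sphere (0 : E n) 1, α ∉ K → a α = 0) {ξ : E n} (hξ : ξ ≠ 0)
    (h : ‖ξ‖⁻¹ • ξ ∉ K) : amp H s a =ᶠ[𝓝 ξ] 0 := by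
  filter_upwards [(continuousAt_unit hξ).eventually (hK.isClosed.isOpen_compl.mem_nhds h),
    isOpen_compl_singleton.mem_nhds hξ] with x hx hx0
  simp only [amp, Pi.zero_apply]
  rw [ha _ (by simpa using norm_unit hx0) hx, mul_zero, mul_zero]

/-- Over directions in K the determinant is nonzero, so ω is locally a smooth square root times a
constant. Over other directions the amplitude vanishes in a neighbourhood, so the behaviour of ω
there is irrelevant. -/
theorem homSymb_amp (hn : n ≠ 0) (hH : ContDiffOn ℝ ∞ H {0}ᶜ)
    (hom : ∀ (t : ℝ) (ξ : E n), t ≠ 0 → ξ ≠ 0 → H (t • ξ) = t * H ξ) {Ω : Set (E n)}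
    (hΩ : ∃ U : Set (E n), IsOpen U ∧ Ω = U ∩ Metric.sphere 0 1)
    (hneg : ∀ α ∈ Ω, (-(hess H α)).PosDef) {a : E n → ℂ} (ha : IsSmoothCompactlySupportedIn Ω a)
    {s : ℝ} (hs : s ≠ 0) : HomSymb (-s) (amp H s a) := by
  obtain ⟨U, hU, rfl⟩ := hΩ
  obtain ⟨hsm, K, hK, hKΩ, haK⟩ := ha
  refine HomSymb.of_contDiffAt (fun ξ hξ => ?_) fun t ht ξ => ?_
  · by_cases h : ‖ξ‖⁻¹ • ξ ∈ K
    · have hp : ContDiffAt ℝ ∞ (fun ξ : E n => ((‖ξ‖ ^ (-s) : ℝ) : ℂ)) ξ :=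
        Complex.ofRealCLM.contDiff.contDiffAt.comp ξ
          ((contDiffAt_norm ℝ hξ).rpow_const_of_ne (norm_ne_zero_iff.2 hξ))
      have hac : ContDiffAt ℝ ∞ (fun ξ : E n => a (‖ξ‖⁻¹ • ξ)) ξ :=
        hsm.contDiffAt (isOpen_compl_singleton.mem_nhds hξ)
      refine hp.mul (ContDiffAt.mul ?_ hac)
      have key : (hess H (‖ξ‖⁻¹ • ξ)).det ≠ 0 → ∀ σ : ℝ,
          ContDiffAt ℝ ∞ (fun ξ : E n => (Real.sqrt |(hess H (‖ξ‖⁻¹ • ξ)).det| : ℂ) *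
            omegaConst n σ) ξ := fun h0 σ => by
        refine ContDiffAt.mul ?_ contDiffAt_const
        have hdet := contDiffAt_det_hess hH hom hξ
        exact Complex.ofRealCLM.contDiff.contDiffAt.comp ξ
          ((hdet.abs h0).sqrt (abs_ne_zero.2 h0))
      rcases hKΩ h with hΩ | hΩ
      · refine (key ?_ 1).congr_of_eventuallyEq ?_
        · have h1 := (hneg _ hΩ).det_pos
          intro h0
          rw [Matrix.det_neg, h0, mul_zero] at h1
          exact lt_irrefl _ h1
        · filter_upwards [(continuousAt_unit hξ).eventually (hU.mem_nhds hΩ.1),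
            isOpen_compl_singleton.mem_nhds hξ] with x hx hx0
          have h1 : ‖x‖⁻¹ • x ∈ U ∩ Metric.sphere 0 1 := ⟨hx, by simpa using norm_unit hx0⟩
          exact omega_eq_of_neg hn (norm_unit hx0) (hneg _ h1)
      · have hpos : ∀ x : E n, x ≠ 0 → -(‖x‖⁻¹ • x) ∈ U →
            (hess H (‖x‖⁻¹ • x)).PosDef := fun x hx0 hx => by
          have h1 : -(‖x‖⁻¹ • x) ∈ U ∩ Metric.sphere 0 1 := ⟨hx, by simpa using norm_unit hx0⟩
          have h2 := posDef_hess_neg hom (neg_ne_zero.2 (by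
            rw [← norm_ne_zero_iff, norm_unit hx0]
            exact one_ne_zero)) (hneg _ h1)
          rwa [neg_neg] at h2
        refine (key (hpos ξ hξ hΩ.1).det_pos.ne' (-1)).congr_of_eventuallyEq ?_
        filter_upwards [(continuousAt_unit hξ).neg.eventually (hU.mem_nhds hΩ.1),
            isOpen_compl_singleton.mem_nhds hξ] with x hx hx0
        exact omega_eq_of_pos hn (norm_unit hx0) (hpos x hx0 hx)
    · exact contDiffAt_const.congr_of_eventuallyEq (amp_eventuallyEq_zero hK haK hξ h)
  · by_cases hξ : ξ = 0
    -- For s ≠ 0 the convention 0^(-s) = 0 gives homogeneity at the origin.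
    · simp [hξ, amp, Real.zero_rpow (neg_ne_zero.2 hs)]
    · have h1 : ‖t • ξ‖⁻¹ • t • ξ = ‖ξ‖⁻¹ • ξ := by
        rw [norm_smul, Real.norm_of_nonneg ht.le, mul_inv, smul_smul, mul_right_comm,
          inv_mul_cancel₀ ht.ne', one_mul]
      rw [amp, amp, h1, norm_smul, Real.norm_of_nonneg ht.le,
        Real.mul_rpow ht.le (norm_nonneg _), Complex.real_smul]
      push_cast
      ring

end Phase

end Conormal

namespace Conormal

open scoped SchwartzMap

/-! ### Conical cutoffs and the stationary phase expansion -/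

section Cutoff

variable {n : ℕ}

/-- A smooth cutoff, homogeneous of degree zero, to the cone of directions at angle less than
`arccos c` from `θ`. -/
def coneCutoff (θ : E n) (c : ℝ) (ξ : E n) : ℝ :=
  Real.smoothTransition (2 * (⟪ξ, θ⟫ / ‖ξ‖ - c) / (1 - c))

theorem coneCutoff_eq_zero {θ : E n} {c : ℝ} (hc : c < 1) {ξ : E n} (h : ⟪ξ, θ⟫ / ‖ξ‖ ≤ c) :
    coneCutoff θ c ξ = 0 :=
  Real.smoothTransition.zero_of_nonpos
    (div_nonpos_of_nonpos_of_nonneg (by linarith) (by linarith))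

theorem coneCutoff_eq_one {θ : E n} {c : ℝ} (hc : c < 1) {ξ : E n}
    (h : (1 + c) / 2 ≤ ⟪ξ, θ⟫ / ‖ξ‖) : coneCutoff θ c ξ = 1 :=
  Real.smoothTransition.one_of_one_le (by rw [le_div_iff₀ (by linarith)]; linarith)

theorem homSymb_coneCutoff (θ : E n) (c : ℝ) : HomSymb 0 fun ξ => (coneCutoff θ c ξ : ℂ) := by
  refine HomSymb.of_contDiffAt (fun ξ hξ => ?_) fun t ht ξ => ?_
  · have h1 : ContDiffAt ℝ ∞ (fun ξ : E n => 2 * (⟪ξ, θ⟫ / ‖ξ‖ - c) / (1 - c)) ξ :=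
      (contDiffAt_const.mul (((contDiffAt_id.inner ℝ contDiffAt_const).div
        (contDiffAt_norm ℝ hξ) (norm_ne_zero_iff.2 hξ)).sub contDiffAt_const)).div_const _
    exact Complex.ofRealCLM.contDiff.contDiffAt.comp ξ
      (Real.smoothTransition.contDiff.contDiffAt.comp ξ h1)
  · rw [Real.rpow_zero, one_smul, coneCutoff, coneCutoff, real_inner_smul_left, norm_smul,
      Real.norm_of_nonneg ht.le, mul_div_mul_left _ _ ht.ne']

/-- The number (1 + δ²)^{-1/2} is the cosine of the half-angle arctan δ of the cone ‖u‖ ≤ δt. -/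
theorem supportedInCone_coneCutoff_mul {θ : E n} (hθ : ‖θ‖ = 1) {δ : ℝ} (hδ : 0 < δ)
    (b : E n → ℂ) :
    SupportedInCone θ δ fun ξ => (coneCutoff θ (Real.sqrt (1 + δ ^ 2))⁻¹ ξ : ℂ) * b ξ := by
  intro t u h
  have hs1 : 1 < Real.sqrt (1 + δ ^ 2) := by
    rw [Real.lt_sqrt zero_le_one]
    nlinarith [sq_pos_of_pos hδ]
  have hin : ⟪t • θ + (u : E n), θ⟫ = t := by
    rw [inner_add_left, real_inner_smul_left, real_inner_self_eq_norm_sq, hθ, real_inner_comm,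
      inner_hyp θ u]
    simp
  have hnorm : ‖t • θ + (u : E n)‖ ^ 2 = t ^ 2 + ‖u‖ ^ 2 := by
    rw [norm_add_sq_real, real_inner_smul_left, inner_hyp θ u, norm_smul, hθ, Submodule.coe_norm]
    simp
  have h1 : (Real.sqrt (1 + δ ^ 2))⁻¹ < t / ‖t • θ + (u : E n)‖ := by
    by_contra hcon
    refine h ?_
    beta_reduce
    rw [coneCutoff_eq_zero (inv_lt_one_of_one_lt₀ hs1) (by rw [hin]; exact not_lt.1 hcon)]
    simp
  have h2 : 0 < t / ‖t • θ + (u : E n)‖ := lt_trans (by positivity) h1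
  have hN : 0 < ‖t • θ + (u : E n)‖ := by
    rcases (norm_nonneg (t • θ + (u : E n))).eq_or_lt with h0 | h0
    · rw [← h0, div_zero] at h2
      exact absurd h2 (lt_irrefl _)
    · exact h0
  have ht : 0 < t := by
    have := mul_pos h2 hN
    rwa [div_mul_cancel₀ _ hN.ne'] at this
  refine ⟨ht, ?_⟩
  rw [inv_eq_one_div, div_lt_div_iff₀ (by positivity) hN, one_mul] at h1
  have h3 : t ^ 2 + ‖u‖ ^ 2 < t ^ 2 * (1 + δ ^ 2) := by
    have := pow_lt_pow_left₀ h1 hN.le two_ne_zero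
    rwa [hnorm, mul_pow, Real.sq_sqrt (by positivity)] at this
  have h4 : ‖u‖ ^ 2 ≤ (δ * t) ^ 2 := by nlinarith
  exact le_of_sq_le_sq h4 (by positivity)

/-- Near the ray of θ one cutoff is 1 and the opposite one is 0, so b minus both of its cut-off
parts vanishes near the critical rays. The sign condition on c' keeps the opposite cutoff off the
half space of θ. -/
theorem eventually_coneCutoff {θ : E n} (hθ : ‖θ‖ = 1) {c c' : ℝ} (hc : c < 1) (hc' : c' < 1)
    (h0' : 0 < c') {ξ : E n} (hξ : ξ ≠ 0) (h : ‖ξ‖⁻¹ • ξ = θ) :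
    ∀ᶠ x in 𝓝 ξ, coneCutoff θ c x = 1 ∧ coneCutoff (-θ) c' x = 0 := by
  have hcont : ContinuousAt (fun x : E n => ⟪x, θ⟫ / ‖x‖) ξ :=
    (continuousAt_id.inner continuousAt_const).div continuous_norm.continuousAt
      (norm_ne_zero_iff.2 hξ)
  have hval : ⟪ξ, θ⟫ / ‖ξ‖ = 1 := by
    rw [← hθ, div_eq_inv_mul, ← real_inner_smul_left, h, real_inner_self_eq_norm_sq, hθ, one_pow]
  have hlt : max ((1 + c) / 2) 0 < ⟪ξ, θ⟫ / ‖ξ‖ := by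
    rw [hval]
    exact max_lt (by linarith) one_pos
  filter_upwards [hcont.eventually (lt_mem_nhds hlt)] with x hx
  refine ⟨coneCutoff_eq_one hc ((le_max_left _ _).trans hx.le), coneCutoff_eq_zero hc' ?_⟩
  rw [inner_neg_right, neg_div]
  have := (le_max_right ((1 + c) / 2) 0).trans hx.le
  linarith

theorem coneCutoff_self {θ : E n} (hθ : ‖θ‖ = 1) {c : ℝ} (hc : c < 1) : coneCutoff θ c θ = 1 := by
  refine coneCutoff_eq_one hc ?_
  rw [real_inner_self_eq_norm_sq, hθ]
  norm_num
  linarith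

theorem tendsto_of_pow_mul_norm_le {g : ℝ → ℂ} {N : ℕ} {C a : ℝ} (ha : a < N)
    (h : ∀ Λ : ℝ, 0 < Λ → Λ ^ N * ‖g Λ‖ ≤ C) :
    Tendsto (fun Λ : ℝ => ((Λ ^ a : ℝ) : ℂ) * g Λ) atTop (𝓝 0) := by
  rw [tendsto_zero_iff_norm_tendsto_zero]
  have h1 : Tendsto (fun Λ : ℝ => Λ ^ (-(N - a)) * C) atTop (𝓝 (0 * C)) :=
    (tendsto_rpow_neg_atTop (by linarith)).mul_const C
  rw [zero_mul] at h1
  refine squeeze_zero' (Eventually.of_forall fun _ => norm_nonneg _) ?_ h1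
  filter_upwards [eventually_gt_atTop 0] with Λ hΛ
  rw [norm_mul, Complex.norm_real, Real.norm_of_nonneg (by positivity)]
  calc Λ ^ a * ‖g Λ‖ = Λ ^ (-(N - a)) * (Λ ^ N * ‖g Λ‖) := by
        rw [← mul_assoc, ← Real.rpow_natCast, ← Real.rpow_add hΛ]
        congr 2
        ring
    _ ≤ _ := by gcongr; exact h Λ hΛ

/-- The contribution of the critical ray through `θ` to the stationary phase expansion. -/
def rayTerm (θ : E n) (σ D d : ℝ) (b F : E n → ℂ) : ℂ :=
  (D⁻¹ : ℝ) * ((((2 * Real.pi) ^ (((n : ℝ) - 1) / 2) : ℝ) : ℂ) *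
    Complex.exp (-(Complex.I * σ * Real.pi * (n - 1) / 4)) * b θ *
    ∫ t in Set.Ioi (0 : ℝ), ((t ^ (d + ((n : ℝ) - 1) / 2) : ℝ) : ℂ) * F (t • θ))

/-- Split b by cutoffs to narrow cones about ±θ. The cut-off parts fall under
`stationary_phase_near` with σ = 1 and σ = −1; the rest vanishes near every critical point. -/
theorem stationary_phase (hn : 2 ≤ n) {θ : E n} (hθ : ‖θ‖ = 1) {ψ : E n → ℝ}
    (hψ : HomSymb 1 ψ) (h1 : fderiv ℝ ψ θ = 0) (h1' : fderiv ℝ ψ (-θ) = 0)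
    (T : Hyp θ ≃L[ℝ] Hyp θ) (T' : Hyp (-θ) ≃L[ℝ] Hyp (-θ))
    (hT : ∀ z : Hyp θ, fderiv ℝ (fderiv ℝ ψ) θ z z = -1 * ‖T z‖ ^ 2)
    (hT' : ∀ z : Hyp (-θ), fderiv ℝ (fderiv ℝ ψ) (-θ) z z = -(-1) * ‖T' z‖ ^ 2)
    {d : ℝ} (hd : (n : ℝ) + 1 ≤ d) {b : E n → ℂ} (hb : HomSymb d b)
    (hcrit : ∀ ξ, ξ ≠ 0 → fderiv ℝ ψ ξ = 0 →
      (‖ξ‖⁻¹ • ξ = θ ∨ ‖ξ‖⁻¹ • ξ = -θ) ∨ b =ᶠ[𝓝 ξ] 0) (F : 𝓢(E n, ℂ)) :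
    Tendsto (fun Λ : ℝ => ((Λ ^ (((n : ℝ) - 1) / 2) : ℝ) : ℂ) * ∫ ξ, b ξ * F ξ * osc ψ Λ ξ) atTop
      (𝓝 (rayTerm θ 1 |LinearMap.det (T : Hyp θ →ₗ[ℝ] Hyp θ)| d b F +
        rayTerm (-θ) (-1) |LinearMap.det (T' : Hyp (-θ) →ₗ[ℝ] Hyp (-θ))| d b F)) := by
  have hn0 : n ≠ 0 := by omega
  have hθn : ‖-θ‖ = 1 := by rwa [norm_neg]
  have hne : θ ≠ 0 := by rintro rfl; simp at hθ
  obtain ⟨δ, hδ, H1⟩ := stationary_phase_near hn hθ hψ (hψ.eq_zero_of_fderiv hne h1) h1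
    (Or.inl rfl) T hT
  obtain ⟨δ', hδ', H2⟩ := stationary_phase_near hn hθn hψ
    (hψ.eq_zero_of_fderiv (neg_ne_zero.2 hne) h1') h1' (Or.inr rfl) T' hT'
  have hlt : ∀ {δ : ℝ}, 0 < δ → (Real.sqrt (1 + δ ^ 2))⁻¹ < 1 := fun {δ} hδ => by
    refine inv_lt_one_of_one_lt₀ ?_
    rw [Real.lt_sqrt zero_le_one]
    nlinarith [sq_pos_of_pos hδ]
  set c := (Real.sqrt (1 + δ ^ 2))⁻¹ with hc
  set c' := (Real.sqrt (1 + δ' ^ 2))⁻¹ with hc'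
  have hc0 : 0 < c := by positivity
  have hc0' : 0 < c' := by positivity
  have hd0 : 0 ≤ d := by linarith [(Nat.cast_nonneg n : (0 : ℝ) ≤ n)]
  have hs1 : HomSymb d fun ξ => (coneCutoff θ c ξ : ℂ) * b ξ := by
    simpa using (homSymb_coneCutoff θ c).mul hb
  have hs2 : HomSymb d fun ξ => (coneCutoff (-θ) c' ξ : ℂ) * b ξ := by
    simpa using (homSymb_coneCutoff (-θ) c').mul hb
  have hs3 : HomSymb d fun ξ => b ξ - (coneCutoff θ c ξ : ℂ) * b ξ -
      (coneCutoff (-θ) c' ξ : ℂ) * b ξ :=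
    ⟨(hb.smooth.sub hs1.smooth).sub hs2.smooth, fun t ht ξ => by
      rw [smul_sub, smul_sub, ← hb.hom t ht, ← hs1.hom t ht ξ, ← hs2.hom t ht ξ]⟩
  have L1 := H1 d hd0 _ hs1 (supportedInCone_coneCutoff_mul hθ hδ b) F
  have L2 := H2 d hd0 _ hs2 (supportedInCone_coneCutoff_mul hθn hδ' b) F
  have L3 : Tendsto (fun Λ : ℝ => ((Λ ^ (((n : ℝ) - 1) / 2) : ℝ) : ℂ) *
      ∫ ξ, (b ξ - (coneCutoff θ c ξ : ℂ) * b ξ - (coneCutoff (-θ) c' ξ : ℂ) * b ξ) * F ξ *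
        osc ψ Λ ξ) atTop (𝓝 0) := by
    -- N = n integrations by parts suffice since n > (n−1)/2, and they are what the assumption d ≥ n
    -- + 1 pays for.
    obtain ⟨C, hC⟩ := nonstationary_phase hn0 hψ n d hd _ hs3 (fun ξ hξ hcr => by
      rcases hcrit ξ hξ hcr with (h | h) | h
      · filter_upwards [eventually_coneCutoff hθ (hlt hδ) (hlt hδ') hc0' hξ h] with x hx
        rw [hx.1, hx.2]
        simp
      · filter_upwards [eventually_coneCutoff hθn (hlt hδ') (hlt hδ) hc0 hξ h] with x hx
        rw [neg_neg] at hx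
        rw [hx.1, hx.2]
        simp
      · filter_upwards [h] with x hx
        rw [hx]
        simp) F
    exact tendsto_of_pow_mul_norm_le (by linarith [(Nat.cast_nonneg n : (0 : ℝ) ≤ n)]) hC
  have hint : ∀ {b : E n → ℂ}, HomSymb d b → ∀ Λ, Integrable fun ξ => b ξ * F ξ * osc ψ Λ ξ :=
    fun hb Λ => hb.integrable_mul hn0 hd0 F (hψ.aestronglyMeasurable_osc hn0 Λ)
      fun ξ => (norm_osc ψ Λ ξ).le
  have L := (L1.add L2).add L3
  rw [add_zero] at L
  have e1 : ((coneCutoff θ c θ : ℝ) : ℂ) = 1 := by rw [coneCutoff_self hθ (hlt hδ)]; simp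
  have e2 : ((coneCutoff (-θ) c' (-θ) : ℝ) : ℂ) = 1 := by
    rw [coneCutoff_self hθn (hlt hδ')]; simp
  simp only [e1, e2, one_mul] at L
  refine (tendsto_congr fun Λ => ?_).1 L
  rw [← mul_add, ← mul_add, ← integral_add (hint hs1 Λ) (hint hs2 Λ),
    ← integral_add (by exact (hint hs1 Λ).add (hint hs2 Λ)) (hint hs3 Λ)]
  congr 2
  funext ξ
  ring

end Cutoff

end Conormal

namespace Conormal

open scoped SchwartzMap

/-! ### Stationary phase for one homogeneous term of the amplitude -/

section Amplitude

variable {n : ℕ}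

/-- The assumptions on the phase function near the conormal direction `Θ` at `x₀`. -/
structure ConormalPhase (H : E n → ℝ) (x₀ Θ : E n) (Ω : Set (E n)) : Prop where
  two_le : 2 ≤ n
  smooth : ContDiffOn ℝ ∞ H {0}ᶜ
  hom : ∀ (t : ℝ) (ξ : E n), t ≠ 0 → ξ ≠ 0 → H (t • ξ) = t * H ξ
  norm_eq : ‖Θ‖ = 1
  grad : HasGradientAt H x₀ Θ
  isOpen : ∃ U : Set (E n), IsOpen U ∧ Ω = U ∩ Metric.sphere 0 1
  mem : Θ ∈ Ω
  small : ∀ α ∈ Ω, HasGradientAt H x₀ α → α = Θ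
  neg : ∀ α ∈ Ω, (-(hess H α)).PosDef

variable {H : E n → ℝ} {x₀ Θ : E n} {Ω : Set (E n)}

theorem ConormalPhase.ne_zero (h : ConormalPhase H x₀ Θ Ω) : Θ ≠ 0 := by
  rintro rfl
  simpa using h.norm_eq

theorem ConormalPhase.pos (h : ConormalPhase H x₀ Θ Ω) : n ≠ 0 := by
  have := h.two_le
  omega

theorem ConormalPhase.homSymb (h : ConormalPhase H x₀ Θ Ω) : HomSymb 1 (phase H x₀) :=
  homSymb_phase h.smooth h.hom

theorem ConormalPhase.fderiv_phase (h : ConormalPhase H x₀ Θ Ω) :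
    fderiv ℝ (phase H x₀) Θ = 0 :=
  (fderiv_phase_eq_zero_iff h.smooth h.ne_zero).2 h.grad

theorem ConormalPhase.fderiv_phase_neg_eq (h : ConormalPhase H x₀ Θ Ω) {ξ : E n} (hξ : ξ ≠ 0) :
    fderiv ℝ (phase H x₀) (-ξ) = fderiv ℝ (phase H x₀) ξ := by
  rw [Conormal.fderiv_phase h.smooth (neg_ne_zero.2 hξ), Conormal.fderiv_phase h.smooth hξ,
    fderiv_neg_eq h.hom hξ]

/-- A critical direction in the support of a lies in Ω or −Ω. The gradient of H is even, so in
either case the uniqueness of Θ in Ω applies to the direction or its negative. -/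
theorem ConormalPhase.critical (h : ConormalPhase H x₀ Θ Ω) {a : E n → ℂ}
    (ha : IsSmoothCompactlySupportedIn Ω a) (s : ℝ) {ξ : E n} (hξ : ξ ≠ 0)
    (hcr : fderiv ℝ (phase H x₀) ξ = 0) :
    (‖ξ‖⁻¹ • ξ = Θ ∨ ‖ξ‖⁻¹ • ξ = -Θ) ∨ amp H s a =ᶠ[𝓝 ξ] 0 := by
  obtain ⟨_, K, hK, hKΩ, haK⟩ := ha
  by_cases hmem : ‖ξ‖⁻¹ • ξ ∈ K
  · left
    have hp : 0 < ‖ξ‖⁻¹ := inv_pos.2 (norm_pos_iff.2 hξ)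
    have hne : ‖ξ‖⁻¹ • ξ ≠ 0 := smul_ne_zero hp.ne' hξ
    have h1 : fderiv ℝ (phase H x₀) (‖ξ‖⁻¹ • ξ) = 0 := by
      rw [h.homSymb.fderiv_smul hp, hcr]
    rcases hKΩ hmem with hm | hm
    · exact Or.inl (h.small _ hm ((fderiv_phase_eq_zero_iff h.smooth hne).1 h1))
    · refine Or.inr (neg_eq_iff_eq_neg.1 (h.small _ hm
        ((fderiv_phase_eq_zero_iff h.smooth (neg_ne_zero.2 hne)).1 ?_)))
      rw [h.fderiv_phase_neg_eq hne, h1]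
  · exact Or.inr (amp_eventuallyEq_zero hK haK hξ hmem)

theorem amp_of_norm {s : ℝ} {a : E n → ℂ} {θ : E n} (hθ : ‖θ‖ = 1) :
    amp H s a θ = omega H θ * a θ := by
  simp [amp, hθ]

/-- Here the normalization of ω does its work: its determinant, phase and power of 2π cancel the
constants of stationary phase exactly. -/
theorem rayTerm_amp {θ : E n} {σ D d : ℝ} (hD : D ≠ 0) {b F : E n → ℂ} {c : ℂ}
    (hb : b θ = D * omegaConst n σ * c) :
    rayTerm θ σ D d b F =
      c * ∫ t in Set.Ioi (0 : ℝ), ((t ^ (d + ((n : ℝ) - 1) / 2) : ℝ) : ℂ) * F (t • θ) := by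
  have h2 : (((2 * Real.pi) ^ (((n : ℝ) - 1) / 2) : ℝ) : ℂ) ≠ 0 := by
    exact_mod_cast (Real.rpow_pos_of_pos (by positivity) _).ne'
  have hD' : (D : ℂ) ≠ 0 := by exact_mod_cast hD
  have he : Complex.exp (-(Complex.I * σ * Real.pi * (n - 1) / 4)) *
      Complex.exp (Complex.I * σ * Real.pi * (n - 1) / 4) = 1 := by
    rw [← Complex.exp_add, neg_add_cancel, Complex.exp_zero]
  have key : ∀ e e' A I' : ℂ, e * e' = 1 → A ≠ 0 →
      (D : ℂ)⁻¹ * (A * e * (D * (e' / A) * c) * I') = c * I' := fun e e' A I' h hA => by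
    have : (D : ℂ)⁻¹ * (A * e * (D * (e' / A) * c) * I') = (e * e') * (c * I') := by
      field_simp
    rw [this, h, one_mul]
  rw [rayTerm, hb, omegaConst, Complex.ofReal_inv]
  exact key _ _ _ _ he h2

theorem ConormalPhase.tendsto_amp (h : ConormalPhase H x₀ Θ Ω) {a : E n → ℂ}
    (ha : IsSmoothCompactlySupportedIn Ω a) {s : ℝ} (hs : s ≠ 0) {m : ℕ}
    (hm : (n : ℝ) + 1 ≤ -s + m) {q : E n → ℂ} (hq : HomSymb m q)
    (hqneg : ∀ ξ, q (-ξ) = (-1) ^ m * q ξ) (F : 𝓢(E n, ℂ)) :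
    Tendsto (fun Λ : ℝ => ((Λ ^ (((n : ℝ) - 1) / 2) : ℝ) : ℂ) *
        ∫ ξ, amp H s a ξ * q ξ * F ξ * osc (phase H x₀) Λ ξ) atTop
      (𝓝 (q Θ * (a Θ * (∫ t in Set.Ioi (0 : ℝ),
          ((t ^ (-s + m + ((n : ℝ) - 1) / 2) : ℝ) : ℂ) * F (t • Θ)) +
        (-1) ^ m * a (-Θ) * ∫ t in Set.Ioi (0 : ℝ),
          ((t ^ (-s + m + ((n : ℝ) - 1) / 2) : ℝ) : ℂ) * F (t • -Θ)))) := by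
  have hn : n ≠ 0 := h.pos
  have hΘ := h.norm_eq
  have hΘn : ‖-Θ‖ = 1 := by rwa [norm_neg]
  have hne' : -Θ ≠ 0 := neg_ne_zero.2 h.ne_zero
  have hpos := posDef_hess_neg h.hom h.ne_zero (h.neg _ h.mem)
  obtain ⟨T, hT, hTd⟩ := exists_equiv_of_gram (Hyp Θ) (fderiv ℝ (fderiv ℝ H) Θ) (σ := 1)
    (Or.inl rfl) (by rw [neg_one_smul, ← hess_eq_gram]; exact h.neg _ h.mem)
  obtain ⟨T', hT', hTd'⟩ := exists_equiv_of_gram (Hyp (-Θ)) (fderiv ℝ (fderiv ℝ H) (-Θ)) (σ := -1)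
    (Or.inr rfl) (by rw [neg_neg, one_smul, ← hess_eq_gram]; exact hpos)
  rw [← hess_eq_gram] at hTd hTd'
  have hD : Real.sqrt |(hess H Θ).det| ≠ 0 := by
    have h1 := (h.neg _ h.mem).det_pos
    rw [Matrix.det_neg] at h1
    exact (Real.sqrt_pos.2 (abs_pos.2 fun h0 => by simp [h0] at h1)).ne'
  have hD' : Real.sqrt |(hess H (-Θ)).det| ≠ 0 :=
    (Real.sqrt_pos.2 (abs_pos.2 hpos.det_pos.ne')).ne'
  have key := stationary_phase h.two_le hΘ h.homSymb h.fderiv_phase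
    (by rw [h.fderiv_phase_neg_eq h.ne_zero, h.fderiv_phase]) T T'
    (by rw [fderiv_fderiv_phase h.smooth h.ne_zero]; exact hT)
    (by rw [fderiv_fderiv_phase h.smooth hne']; exact hT')
    hm ((homSymb_amp hn h.smooth h.hom h.isOpen h.neg ha hs).mul hq)
    (fun ξ hξ hcr => (h.critical ha s hξ hcr).imp_right fun h0 => by
      filter_upwards [h0] with x hx
      rw [hx]
      simp) F
  rw [hTd, hTd'] at key
  rw [rayTerm_amp (c := a Θ * q Θ) hD (by
      rw [amp_of_norm hΘ, omega_eq_of_neg hn hΘ (h.neg _ h.mem)]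
      ring),
    rayTerm_amp (c := a (-Θ) * ((-1) ^ m * q Θ)) hD' (by
      rw [amp_of_norm hΘn, omega_eq_of_pos hn hΘn hpos, hqneg]
      ring)] at key
  convert key using 2
  ring

end Amplitude

end Conormal

namespace Conormal

open scoped SchwartzMap

/-! ### Oscillatory integrals with homogeneous weights -/

section Weighted

variable {n : ℕ}

/-- Since c ≤ 1 and c ≤ t, one has 1 + t‖ξ‖ ≥ c(1 + ‖ξ‖). Uniformity in t ≥ c serves differentiation
under the integral; the explicit power of c serves the limit ε → 0. -/
theorem schwartz_decay_smul (F : 𝓢(E n, ℂ)) {p : ℝ} (hp : 0 ≤ p) :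
    ∃ C : ℝ, 0 ≤ C ∧ ∀ c t : ℝ, 0 < c → c ≤ 1 → c ≤ t → ∀ ξ,
      ‖F (t • ξ)‖ ≤ C * (c ^ (-p) * (1 + ‖ξ‖) ^ (-p)) := by
  obtain ⟨C, hC, h⟩ := exists_schwartz_decay F ⌈p⌉₊
  refine ⟨C, hC, fun c t hc hc1 hct ξ => (h _).trans (mul_le_mul_of_nonneg_left ?_ hC)⟩
  rw [norm_smul, Real.norm_of_nonneg (hc.le.trans hct), ← Real.mul_rpow hc.le (by positivity)]
  have h0 : 0 ≤ t * ‖ξ‖ := mul_nonneg (hc.le.trans hct) (norm_nonneg _)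
  calc (1 + t * ‖ξ‖) ^ (-(⌈p⌉₊ : ℝ)) ≤ (1 + t * ‖ξ‖) ^ (-p) :=
        Real.rpow_le_rpow_of_exponent_le (by linarith) (neg_le_neg (Nat.le_ceil p))
    _ ≤ (c * (1 + ‖ξ‖)) ^ (-p) := by
        refine Real.rpow_le_rpow_of_nonpos (by positivity) ?_ (neg_nonpos.2 hp)
        nlinarith [mul_le_mul_of_nonneg_right hct (norm_nonneg ξ)]

theorem integrable_norm_mul_rpow {g : E n → ℂ} (hg : LocallyIntegrable g) {C e p : ℝ}
    (h : ∀ ξ, 1 ≤ ‖ξ‖ → ‖g ξ‖ ≤ C * ‖ξ‖ ^ e) (hp : 0 ≤ p) (hep : (n : ℝ) < p - e) :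
    Integrable fun ξ => ‖g ξ‖ * (1 + ‖ξ‖) ^ (-p) := by
  have hmeas : AEStronglyMeasurable (fun ξ : E n => ‖g ξ‖ * (1 + ‖ξ‖) ^ (-p)) :=
    hg.aestronglyMeasurable.norm.mul (Measurable.aestronglyMeasurable (by fun_prop))
  rw [← integrableOn_univ, ← Set.union_compl_self (Metric.closedBall (0 : E n) 1)]
  refine IntegrableOn.union ?_ ?_
  · refine (hg.integrableOn_isCompact (isCompact_closedBall 0 1)).norm.mono' hmeas.restrict ?_
    refine Eventually.of_forall fun ξ => ?_
    rw [norm_mul, norm_norm, Real.norm_of_nonneg (by positivity)]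
    refine mul_le_of_le_one_right (norm_nonneg _) ?_
    exact Real.rpow_le_one_of_one_le_of_nonpos (by linarith [norm_nonneg ξ]) (neg_nonpos.2 hp)
  · have hint : Integrable fun ξ : E n => |C| * 2 ^ |e| * (1 + ‖ξ‖) ^ (-(p - e)) := by
      refine (integrable_one_add_norm ?_).const_mul _
      simpa using hep
    refine hint.integrableOn.mono' hmeas.restrict ?_
    refine (ae_restrict_iff' Metric.isClosed_closedBall.measurableSet.compl).2
      (Eventually.of_forall fun ξ hξ => ?_)
    have hξ1 : 1 ≤ ‖ξ‖ := by
      have : ¬ ‖ξ‖ ≤ 1 := by simpa using hξ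
      linarith
    have h2 : ‖ξ‖ ^ e ≤ 2 ^ |e| * (1 + ‖ξ‖) ^ e := by
      rcases le_total 0 e with he | he
      · calc ‖ξ‖ ^ e ≤ (1 + ‖ξ‖) ^ e := by gcongr; linarith
          _ ≤ _ := le_mul_of_one_le_left (by positivity)
              (Real.one_le_rpow one_le_two (abs_nonneg e))
      · rw [abs_of_nonpos he, Real.rpow_neg two_pos.le, ← Real.inv_rpow two_pos.le,
          ← Real.mul_rpow (by positivity) (by positivity)]
        exact Real.rpow_le_rpow_of_nonpos (by positivity) (by linarith) he
    rw [norm_mul, norm_norm, Real.norm_of_nonneg (by positivity : 0 ≤ (1 + ‖ξ‖) ^ (-p))]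
    calc ‖g ξ‖ * (1 + ‖ξ‖) ^ (-p) ≤ (|C| * (2 ^ |e| * (1 + ‖ξ‖) ^ e)) * (1 + ‖ξ‖) ^ (-p) := by
          refine mul_le_mul_of_nonneg_right ((h ξ hξ1).trans ?_) (by positivity)
          exact mul_le_mul (le_abs_self C) h2 (by positivity) (abs_nonneg C)
      _ = |C| * 2 ^ |e| * (1 + ‖ξ‖) ^ (-(p - e)) := by
          rw [neg_sub, sub_eq_add_neg, Real.rpow_add (by positivity)]
          ring

/-- L'Hôpital's rule at infinity for complex values: the mean value inequality shows that g(x) − Lx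
grows at most like ηx/2 beyond some point, for every η > 0. -/
theorem tendsto_inv_mul_of_hasDerivAt {g g' : ℝ → ℂ} {L : ℂ}
    (hg : ∀ x, 0 < x → HasDerivAt g (g' x) x) (hg' : Tendsto g' atTop (𝓝 L)) :
    Tendsto (fun x : ℝ => (x : ℂ)⁻¹ * g x) atTop (𝓝 L) := by
  rw [Metric.tendsto_atTop]
  intro η hη
  obtain ⟨X, hX⟩ := (Metric.tendsto_atTop.1 hg') (η / 2) (by linarith)
  set Y := max X 1 with hY
  have hY1 : 1 ≤ Y := le_max_right _ _
  set K := ‖g Y - L * Y‖ with hK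
  have hbd : ∀ x, Y ≤ x → ‖g x - L * x‖ ≤ K + η / 2 * (x - Y) := fun x hx => by
    have h1 : ‖(g x - L * x) - (g Y - L * Y)‖ ≤ η / 2 * ‖x - Y‖ := by
      refine Convex.norm_image_sub_le_of_norm_hasDerivWithin_le (s := Set.Ici Y)
        (f := fun x : ℝ => g x - L * x) (f' := fun x => g' x - L) (fun z hz => ?_) (fun z hz => ?_)
        (convex_Ici Y) Set.self_mem_Ici hx
      · have h2 : HasDerivAt (fun x : ℝ => L * (x : ℂ)) L z := by
          simpa using (hasDerivAt_id z).ofReal_comp.const_mul L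
        exact ((hg z (by linarith [Set.mem_Ici.1 hz])).sub h2).hasDerivWithinAt
      · rw [← dist_eq_norm]
        exact (hX z ((le_max_left _ _).trans hz)).le
    rw [Real.norm_of_nonneg (by linarith)] at h1
    have h3 := norm_le_norm_add_norm_sub' (g x - L * x) (g Y - L * Y)
    linarith
  refine ⟨max Y (2 * K / η + 1), fun x hx => ?_⟩
  have hxY : Y ≤ x := (le_max_left _ _).trans hx
  have hx2 : 2 * K / η + 1 ≤ x := (le_max_right _ _).trans hx
  have hx0 : 0 < x := by linarith
  have hx0' : (x : ℂ) ≠ 0 := by exact_mod_cast hx0.ne'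
  have he : (x : ℂ)⁻¹ * g x - L = (x : ℂ)⁻¹ * (g x - L * x) := by
    field_simp
  rw [dist_eq_norm, he, norm_mul, norm_inv, Complex.norm_real, Real.norm_of_nonneg hx0.le,
    inv_mul_lt_iff₀ hx0]
  have h4 : 2 * K / η < x := by linarith
  rw [div_lt_iff₀ hη] at h4
  nlinarith [hbd x hxY]

/-- The oscillatory integral `∫ v q e^{iψ} F(ε ξ) dξ`. -/
def oscInt (v : E n → ℂ) (ψ : E n → ℝ) (q F : E n → ℂ) (ε : ℝ) : ℂ :=
  ∫ ξ, v ξ * q ξ * osc ψ 1 ξ * F (ε • ξ)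

/-- The amplitude is locally integrable and of polynomial growth `e`. -/
structure TemperedAmplitude (v : E n → ℂ) (e : ℝ) : Prop where
  locallyIntegrable : LocallyIntegrable v
  bound : ∃ C, 0 ≤ C ∧ ∀ ξ, 1 ≤ ‖ξ‖ → ‖v ξ‖ ≤ C * ‖ξ‖ ^ e

theorem TemperedAmplitude.mul {v : E n → ℂ} {e : ℝ} (hv : TemperedAmplitude v e) {d : ℝ}
    {q : E n → ℂ} (hqc : Continuous q) (hq : HomSymb d q) :
    TemperedAmplitude (fun ξ => v ξ * q ξ) (e + d) := by
  obtain ⟨C, hC, h⟩ := hv.bound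
  obtain ⟨D, hD, hqD⟩ := hq.norm_le
  refine ⟨?_, C * D, by positivity, fun ξ hξ => ?_⟩
  · have := hv.locallyIntegrable.continuous_mul hqc
    simpa only [mul_comm] using this
  · have h0 : 0 < ‖ξ‖ := by linarith
    rw [norm_mul, Real.rpow_add h0]
    calc ‖v ξ‖ * ‖q ξ‖ ≤ (C * ‖ξ‖ ^ e) * (D * ‖ξ‖ ^ d) :=
          mul_le_mul (h ξ hξ) (hqD ξ (norm_pos_iff.1 h0)) (norm_nonneg _) (by positivity)
      _ = _ := by ring

/-- An exponent of decay that makes an amplitude of growth `e` integrable. -/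
def decayExp (n : ℕ) (e : ℝ) : ℝ := max 0 (n + e + 1)

theorem TemperedAmplitude.integrable_decay {v : E n → ℂ} {e : ℝ} (hv : TemperedAmplitude v e) :
    Integrable fun ξ => ‖v ξ‖ * (1 + ‖ξ‖) ^ (-decayExp n e) := by
  obtain ⟨C, _, h⟩ := hv.bound
  refine integrable_norm_mul_rpow hv.locallyIntegrable h (le_max_left _ _) ?_
  have := le_max_right 0 ((n : ℝ) + e + 1)
  rw [decayExp]
  linarith

theorem TemperedAmplitude.aestronglyMeasurable_mul (hn : n ≠ 0) {v : E n → ℂ} {e : ℝ}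
    (hv : TemperedAmplitude v e) {ψ : E n → ℝ} (hψ : HomSymb 1 ψ) (F : 𝓢(E n, ℂ)) (ε : ℝ) :
    AEStronglyMeasurable fun ξ => v ξ * osc ψ 1 ξ * F (ε • ξ) := by
  have hF : Continuous fun ξ : E n => F (ε • ξ) := by
    have := F.continuous
    fun_prop
  exact (hv.locallyIntegrable.aestronglyMeasurable.mul
    (hψ.aestronglyMeasurable_osc hn 1)).mul hF.aestronglyMeasurable

theorem TemperedAmplitude.exists_bound {v : E n → ℂ} {e : ℝ} (hv : TemperedAmplitude v e)
    (ψ : E n → ℝ) (F : 𝓢(E n, ℂ)) {c : ℝ} (hc : 0 < c) (hc1 : c ≤ 1) :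
    ∃ w : E n → ℝ, Integrable w ∧ ∀ t, c ≤ t → ∀ ξ, ‖v ξ * osc ψ 1 ξ * F (t • ξ)‖ ≤ w ξ := by
  obtain ⟨C, hC, h⟩ := schwartz_decay_smul F (le_max_left 0 ((n : ℝ) + e + 1))
  refine ⟨_, hv.integrable_decay.const_mul (C * c ^ (-decayExp n e)), fun t ht ξ => ?_⟩
  rw [norm_mul, norm_mul, norm_osc, mul_one]
  calc ‖v ξ‖ * ‖F (t • ξ)‖ ≤ ‖v ξ‖ * (C * (c ^ (-decayExp n e) * (1 + ‖ξ‖) ^ (-decayExp n e))) :=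
        mul_le_mul_of_nonneg_left (h c t hc hc1 ht ξ) (norm_nonneg _)
    _ = _ := by ring

theorem TemperedAmplitude.integrable (hn : n ≠ 0) {v : E n → ℂ} {e : ℝ}
    (hv : TemperedAmplitude v e) {ψ : E n → ℝ} (hψ : HomSymb 1 ψ) (F : 𝓢(E n, ℂ)) {ε : ℝ}
    (hε : 0 < ε) : Integrable fun ξ => v ξ * osc ψ 1 ξ * F (ε • ξ) := by
  obtain ⟨w, hw, hb⟩ := hv.exists_bound ψ F (c := min ε 1) (by positivity) (min_le_right _ _)
  exact hw.mono' (hv.aestronglyMeasurable_mul hn hψ F ε)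
    (Eventually.of_forall fun ξ => hb ε (min_le_left _ _) ξ)

theorem homSymb_mul_coord {m : ℕ} {q : E n → ℂ} (hq : HomSymb m q) (k : Fin n) :
    HomSymb ((m + 1 : ℕ) : ℝ) fun ξ => q ξ * (ξ k : ℂ) := by
  have h1 : HomSymb (n := n) 1 fun ξ => ((ξ k : ℝ) : ℂ) := by
    refine HomSymb.of_contDiffAt (fun ξ _ => ?_) fun t ht ξ => ?_
    · exact Complex.ofRealCLM.contDiff.contDiffAt.comp ξ
        (EuclideanSpace.proj k : E n →L[ℝ] ℝ).contDiff.contDiffAt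
    · simp
  push_cast
  exact hq.mul h1

/-- The derivative in ε falls on F(εξ) alone and gives Σ ξₖ ∂ₖF(εξ); the coordinates join the
weight, whose degree rises to m + 1. -/
theorem hasDerivAt_oscInt (hn : n ≠ 0) {v : E n → ℂ} {e : ℝ}
    (hv : TemperedAmplitude v e) {ψ : E n → ℝ} (hψ : HomSymb 1 ψ) {m : ℕ} {q : E n → ℂ}
    (hqc : Continuous q) (hq : HomSymb m q) (F : 𝓢(E n, ℂ)) {ε : ℝ} (hε : 0 < ε) :
    HasDerivAt (oscInt v ψ q F)
      (∑ k, oscInt v ψ (fun ξ => q ξ * (ξ k : ℂ)) (∂_{(stdVec k : E n)} F : 𝓢(E n, ℂ)) ε) ε := by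
  have hvq := hv.mul hqc hq
  have hqk : ∀ k : Fin n, Continuous fun ξ : E n => q ξ * (ξ k : ℂ) := fun k => by
    have : Continuous fun ξ : E n => ξ k := (EuclideanSpace.proj k : E n →L[ℝ] ℝ).continuous
    fun_prop
  have hvk : ∀ k : Fin n, TemperedAmplitude (fun ξ => v ξ * (q ξ * (ξ k : ℂ)))
      (e + ((m + 1 : ℕ) : ℝ)) := fun k => hv.mul (hqk k) (homSymb_mul_coord hq k)
  have hc : 0 < min (ε / 2) 1 := by positivity
  obtain ⟨G, hG⟩ : ∃ G : Fin n → 𝓢(E n, ℂ), ∀ k, G k = ∂_{(stdVec k : E n)} F := ⟨_, fun _ => rfl⟩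
  simp_rw [← hG]
  choose w hw hb using fun k => (hvk k).exists_bound ψ (G k) hc (min_le_right _ _)
  have hmeas : AEStronglyMeasurable
      (fun ξ : E n => ∑ k, v ξ * (q ξ * (ξ k : ℂ)) * osc ψ 1 ξ * G k (ε • ξ)) :=
    Finset.aestronglyMeasurable_fun_sum _ fun k _ =>
      (hvk k).aestronglyMeasurable_mul hn hψ (G k) ε
  have hbd : ∀ ξ : E n, ∀ t ∈ Set.Ici (ε / 2),
      ‖∑ k, v ξ * (q ξ * (ξ k : ℂ)) * osc ψ 1 ξ * G k (t • ξ)‖ ≤ ∑ k, w k ξ := fun ξ t ht =>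
    (norm_sum_le _ _).trans
      (Finset.sum_le_sum fun k _ => hb k t ((min_le_left _ _).trans ht) ξ)
  have hder : ∀ ξ : E n, ∀ t ∈ Set.Ici (ε / 2),
      HasDerivAt (fun t => v ξ * q ξ * osc ψ 1 ξ * F (t • ξ))
        (∑ k, v ξ * (q ξ * (ξ k : ℂ)) * osc ψ 1 ξ * G k (t • ξ)) t := fun ξ t _ => by
    refine ((hasDerivAt_ray F ξ t).const_mul (v ξ * q ξ * osc ψ 1 ξ)).congr_deriv ?_
    rw [fderiv_apply_eq_sum, Finset.mul_sum]
    refine Finset.sum_congr rfl fun k _ => ?_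
    rw [hG, SchwartzMap.lineDerivOp_apply_eq_fderiv]
    ring
  have key := (hasDerivAt_integral_of_dominated_loc_of_deriv_le (μ := volume) (𝕜 := ℝ)
    (F := fun t ξ => v ξ * q ξ * osc ψ 1 ξ * F (t • ξ))
    (F' := fun t ξ => ∑ k, v ξ * (q ξ * (ξ k : ℂ)) * osc ψ 1 ξ * G k (t • ξ))
    (bound := fun ξ => ∑ k, w k ξ) (x₀ := ε) (s := Set.Ici (ε / 2))
    (Ici_mem_nhds (by linarith))
    (Eventually.of_forall fun t => hvq.aestronglyMeasurable_mul hn hψ F t)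
    (hvq.integrable hn hψ F hε) hmeas (Eventually.of_forall hbd)
    (integrable_finsetSum _ fun k _ => hw k) (Eventually.of_forall hder)).2
  rw [integral_finsetSum _ fun k _ => (hvk k).integrable hn hψ (G k) hε] at key
  exact key

end Weighted

end Conormal

namespace Conormal

open scoped SchwartzMap

/-! ### The leading asymptotics -/

section RayLimit

variable {n : ℕ}

/-- The moment `∫₀^∞ t^{a-1} F(tu) dt`. -/
def rayMoment (a : ℝ) (u : E n) (F : E n → ℂ) : ℂ :=
  ∫ t in Set.Ioi (0 : ℝ), ((t ^ (a - 1) : ℝ) : ℂ) * F (t • u)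

theorem integrableOn_rayMoment (F : 𝓢(E n, ℂ)) {a : ℝ} (ha : 0 < a) {u : E n} (hu : ‖u‖ = 1) :
    IntegrableOn (fun t : ℝ => ((t ^ (a - 1) : ℝ) : ℂ) * F (t • u)) (Set.Ioi 0) := by
  simpa [expI] using integrableOn_ray F (e := a - 1) (by linarith) hu.ge 0

/-- The function t^a F(tu) vanishes at 0 and at infinity, so the integral of its derivative is zero.
-/
theorem rayMoment_lineDeriv (F : 𝓢(E n, ℂ)) {a : ℝ} (ha : 0 < a) {u : E n} (hu : ‖u‖ = 1) :
    rayMoment (a + 1) u (∂_{u} F : 𝓢(E n, ℂ)) = -a * rayMoment a u F := by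
  have hd : ∀ t ∈ Set.Ioi (0 : ℝ), HasDerivAt (fun t : ℝ => ((t ^ a : ℝ) : ℂ) * F (t • u))
      (a * (((t ^ (a - 1) : ℝ) : ℂ) * F (t • u)) +
        ((t ^ (a + 1 - 1) : ℝ) : ℂ) * (∂_{u} F : 𝓢(E n, ℂ)) (t • u)) t := fun t ht => by
    have h1 := (Real.hasDerivAt_rpow_const (p := a) (Or.inl (Set.mem_Ioi.1 ht).ne')).ofReal_comp
    refine (h1.mul (hasDerivAt_ray F u t)).congr_deriv ?_
    rw [SchwartzMap.lineDerivOp_apply_eq_fderiv, add_sub_cancel_right]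
    push_cast
    ring
  have hc : ContinuousWithinAt (fun t : ℝ => ((t ^ a : ℝ) : ℂ) * F (t • u)) (Set.Ici 0) 0 := by
    have h1 : Continuous fun t : ℝ => t ^ a := Real.continuous_rpow_const ha.le
    have h2 := F.continuous
    have h3 : Continuous fun t : ℝ => ((t ^ a : ℝ) : ℂ) * F (t • u) := by fun_prop
    exact h3.continuousWithinAt
  have hlim : Tendsto (fun t : ℝ => ((t ^ a : ℝ) : ℂ) * F (t • u)) atTop (𝓝 0) := by
    rw [tendsto_zero_iff_norm_tendsto_zero]
    refine (tendsto_rpow_mul_ray F a hu.ge).congr' ?_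
    filter_upwards [eventually_ge_atTop 0] with t ht
    rw [norm_mul, Complex.norm_real, Real.norm_of_nonneg (by positivity)]
  have i1 := (integrableOn_rayMoment F ha hu).const_mul (a : ℂ)
  have i2 := integrableOn_rayMoment (∂_{u} F) (by linarith : 0 < a + 1) hu
  have h := integral_Ioi_of_hasDerivAt_of_tendsto hc hd (i1.add i2) hlim
  rw [integral_add i1 i2, integral_const_mul, Real.zero_rpow ha.ne', Complex.ofReal_zero, zero_mul] at h
  simp only [rayMoment]
  linear_combination h

/-- The limit functional `v₊ ∫₀^∞ t^{m-κ-1} F(tΘ) dt + (-1)^m v₋ ∫₀^∞ t^{m-κ-1} F(-tΘ) dt`. -/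
def rayLimit (κ : ℝ) (vp vm : ℂ) (Θ : E n) (m : ℕ) (F : E n → ℂ) : ℂ :=
  vp * rayMoment (m - κ) Θ F + (-1) ^ m * vm * rayMoment (m - κ) (-Θ) F

theorem sum_rayMoment (F : 𝓢(E n, ℂ)) {a : ℝ} (ha : 0 < a) {u : E n} (hu : ‖u‖ = 1) :
    ∑ k, (u k : ℂ) * rayMoment a u (∂_{(stdVec k : E n)} F : 𝓢(E n, ℂ)) =
      rayMoment a u (∂_{u} F : 𝓢(E n, ℂ)) := by
  simp only [rayMoment]
  simp_rw [← integral_const_mul]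
  rw [← integral_finsetSum _ fun k _ =>
    (integrableOn_rayMoment (∂_{(stdVec k : E n)} F) ha hu).const_mul (u k : ℂ)]
  congr 1
  funext t
  rw [SchwartzMap.lineDerivOp_apply_eq_fderiv, fderiv_apply_eq_sum, Finset.mul_sum]
  refine Finset.sum_congr rfl fun k _ => ?_
  rw [SchwartzMap.lineDerivOp_apply_eq_fderiv]
  ring

/-- The limit functionals obey the recursion that differentiation of ε^{-(m-κ)} dictates. This
compatibility makes the descent in m possible. -/
theorem sum_rayLimit (F : 𝓢(E n, ℂ)) {κ : ℝ} {m : ℕ} (hm : κ < m) (vp vm : ℂ) {Θ : E n}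
    (hΘ : ‖Θ‖ = 1) :
    ∑ k, (Θ k : ℂ) * rayLimit κ vp vm Θ (m + 1) (∂_{(stdVec k : E n)} F : 𝓢(E n, ℂ)) =
      -(m - κ) * rayLimit κ vp vm Θ m F := by
  have ha : 0 < (m : ℝ) - κ := by linarith
  have ha1 : 0 < ((m + 1 : ℕ) : ℝ) - κ := by push_cast; linarith
  have hΘn : ‖-Θ‖ = 1 := by rwa [norm_neg]
  have e : ((m + 1 : ℕ) : ℝ) - κ = (m - κ) + 1 := by push_cast; ring
  have h1 := sum_rayMoment F ha1 hΘ
  have h2 := sum_rayMoment F ha1 hΘn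
  rw [e, rayMoment_lineDeriv F ha hΘ] at h1
  rw [e, rayMoment_lineDeriv F ha hΘn] at h2
  simp only [PiLp.neg_apply, Complex.ofReal_neg, neg_mul, Finset.sum_neg_distrib] at h2
  simp only [rayLimit, e]
  have h3 : ∀ k : Fin n, (Θ k : ℂ) *
      (vp * rayMoment (m - κ + 1) Θ (∂_{(stdVec k : E n)} F : 𝓢(E n, ℂ)) +
        (-1) ^ (m + 1) * vm * rayMoment (m - κ + 1) (-Θ) (∂_{(stdVec k : E n)} F : 𝓢(E n, ℂ))) =
      vp * ((Θ k : ℂ) * rayMoment (m - κ + 1) Θ (∂_{(stdVec k : E n)} F : 𝓢(E n, ℂ))) +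
        (-1) ^ (m + 1) * vm *
          ((Θ k : ℂ) * rayMoment (m - κ + 1) (-Θ) (∂_{(stdVec k : E n)} F : 𝓢(E n, ℂ))) :=
    fun k => by ring
  simp_rw [h3]
  rw [Finset.sum_add_distrib, ← Finset.mul_sum, ← Finset.mul_sum, h1]
  push_cast at h2 ⊢
  linear_combination (-1) ^ m * vm * h2

/-- The leading asymptotics of the oscillatory integrals with weights of degree `m`. -/
def HasRayLimit (v : E n → ℂ) (ψ : E n → ℝ) (κ : ℝ) (vp vm : ℂ) (Θ : E n) (m : ℕ) : Prop :=
  ∀ q : E n → ℂ, Continuous q → HomSymb m q → (∀ ξ, q (-ξ) = (-1) ^ m * q ξ) → ∀ F : 𝓢(E n, ℂ),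
    Tendsto (fun ε : ℝ => ((ε ^ ((m : ℝ) - κ) : ℝ) : ℂ) * oscInt v ψ q F ε) (𝓝[>] 0)
      (𝓝 (q Θ * rayLimit κ vp vm Θ m F))

/-- With a = m − κ > 0 the hypothesis says that the ε-derivative of the integral behaves like
−aLε^{-a-1}. As ε^{-a} blows up, integration down to ε gives Lε^{-a}, the constant of integration
being negligible. -/
theorem HasRayLimit.of_succ (hn : n ≠ 0) {v : E n → ℂ} {e : ℝ} (hv : TemperedAmplitude v e)
    {ψ : E n → ℝ} (hψ : HomSymb 1 ψ) {κ : ℝ} {vp vm : ℂ} {Θ : E n} (hΘ : ‖Θ‖ = 1) {m : ℕ}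
    (hm : κ < m) (h : HasRayLimit v ψ κ vp vm Θ (m + 1)) : HasRayLimit v ψ κ vp vm Θ m := by
  intro q hqc hq hqn F
  set a : ℝ := m - κ with ha_def
  have ha : 0 < a := by linarith
  set L := q Θ * rayLimit κ vp vm Θ m F with hL
  set g' : ℝ → ℂ := fun ε =>
    ∑ k, oscInt v ψ (fun ξ => q ξ * (ξ k : ℂ)) (∂_{(stdVec k : E n)} F : 𝓢(E n, ℂ)) ε with hg'
  have h1 : Tendsto (fun ε : ℝ => ((ε ^ (a + 1) : ℝ) : ℂ) * g' ε) (𝓝[>] 0) (𝓝 (-a * L)) := by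
    have hk : ∀ k : Fin n, Tendsto (fun ε : ℝ => ((ε ^ (a + 1) : ℝ) : ℂ) *
        oscInt v ψ (fun ξ => q ξ * (ξ k : ℂ)) (∂_{(stdVec k : E n)} F : 𝓢(E n, ℂ)) ε) (𝓝[>] 0)
        (𝓝 (q Θ * (Θ k : ℂ) *
          rayLimit κ vp vm Θ (m + 1) (∂_{(stdVec k : E n)} F : 𝓢(E n, ℂ)))) := fun k => by
      have hc : Continuous fun ξ : E n => ξ k := (EuclideanSpace.proj k : E n →L[ℝ] ℝ).continuous
      have h2 := h (fun ξ => q ξ * (ξ k : ℂ)) (by fun_prop) (homSymb_mul_coord hq k)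
        (fun ξ => by rw [hqn, PiLp.neg_apply]; push_cast; ring) (∂_{(stdVec k : E n)} F)
      have e1 : ((m + 1 : ℕ) : ℝ) - κ = a + 1 := by rw [ha_def]; push_cast; ring
      rwa [e1] at h2
    have h3 := tendsto_finsetSum Finset.univ fun k _ => hk k
    simp_rw [mul_assoc, ← Finset.mul_sum] at h3
    rw [sum_rayLimit F hm vp vm hΘ] at h3
    convert h3 using 2
    rw [hL, ha_def]
    push_cast
    ring
  -- The variable x = ε^{-a} brings this into the form of L'Hôpital's rule at infinity, with a
  -- derivative tending to L.
  have hc : Tendsto (fun x : ℝ => x ^ (-a⁻¹)) atTop (𝓝[>] 0) := by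
    refine tendsto_nhdsWithin_iff.2 ⟨tendsto_rpow_neg_atTop (inv_pos.2 ha), ?_⟩
    filter_upwards [eventually_gt_atTop 0] with x hx
    exact Real.rpow_pos_of_pos hx _
  have h4 : Tendsto (fun x : ℝ => (x : ℂ)⁻¹ * oscInt v ψ q F (x ^ (-a⁻¹))) atTop (𝓝 L) := by
    refine tendsto_inv_mul_of_hasDerivAt
      (g' := fun x => ((-a⁻¹ * x ^ (-a⁻¹ - 1) : ℝ) : ℂ) * g' (x ^ (-a⁻¹))) (fun x hx => ?_) ?_
    · have h5 := hasDerivAt_oscInt hn hv hψ hqc hq F (Real.rpow_pos_of_pos hx (-a⁻¹))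
      have h6 := h5.scomp x (Real.hasDerivAt_rpow_const (p := -a⁻¹) (Or.inl hx.ne'))
      rw [Complex.real_smul] at h6
      exact h6
    · have h7 := (h1.comp hc).const_mul (-(a : ℂ)⁻¹)
      have ha' : (a : ℂ) ≠ 0 := by exact_mod_cast ha.ne'
      have e1 : -(a : ℂ)⁻¹ * (-a * L) = L := by field_simp
      rw [e1] at h7
      refine h7.congr' ?_
      filter_upwards [eventually_gt_atTop 0] with x hx
      simp only [Function.comp_apply]
      rw [← Real.rpow_mul hx.le, ← mul_assoc]
      congr 1
      have e2 : -a⁻¹ * (a + 1) = -a⁻¹ - 1 := by field_simp; ring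
      rw [e2]
      push_cast
      ring
  have hc' : Tendsto (fun ε : ℝ => ε ^ (-a)) (𝓝[>] 0) atTop :=
    tendsto_rpow_neg_nhdsGT_zero (neg_neg_of_pos ha)
  refine (h4.comp hc').congr' ?_
  filter_upwards [self_mem_nhdsWithin] with ε hε
  have hε' : 0 < ε := hε
  simp only [Function.comp_apply]
  rw [← Real.rpow_mul hε'.le, neg_mul_neg, mul_inv_cancel₀ ha.ne', Real.rpow_one,
    Real.rpow_neg hε'.le, Complex.ofReal_inv, inv_inv]

theorem HasRayLimit.of_le (hn : n ≠ 0) {v : E n → ℂ} {e : ℝ} (hv : TemperedAmplitude v e)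
    {ψ : E n → ℝ} (hψ : HomSymb 1 ψ) {κ : ℝ} {vp vm : ℂ} {Θ : E n} (hΘ : ‖Θ‖ = 1) {m M : ℕ}
    (hm : κ < m) (hM : m ≤ M) (h : HasRayLimit v ψ κ vp vm Θ M) :
    HasRayLimit v ψ κ vp vm Θ m := by
  induction M, hM using Nat.le_induction with
  | base => exact h
  | succ M hM ih =>
    refine ih (h.of_succ hn hv hψ hΘ (hm.trans_le ?_))
    exact_mod_cast hM

end RayLimit

end Conormal

namespace Conormal

open scoped SchwartzMap

/-! ### Weights of large degree -/

section LargeDegree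

variable {n : ℕ}

/-- Choose p between n + e and a. The factor (1 + ‖ξ‖)^{-p} from the decay of F makes the amplitude
integrable at the cost of ε^{-p}, which ε^a beats. -/
theorem TemperedAmplitude.tendsto_zero {g : E n → ℂ} {e : ℝ}
    (hg : TemperedAmplitude g e) (ψ : E n → ℝ) (F : 𝓢(E n, ℂ)) {a : ℝ}
    (ha : 0 < a) (hea : n + e < a) :
    Tendsto (fun ε : ℝ => ((ε ^ a : ℝ) : ℂ) * ∫ ξ, g ξ * osc ψ 1 ξ * F (ε • ξ)) (𝓝[>] 0)
      (𝓝 0) := by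
  obtain ⟨p, hp, hp0, hpa⟩ : ∃ p : ℝ, n + e < p ∧ 0 ≤ p ∧ p < a :=
    ⟨max 0 ((n + e + a) / 2), lt_max_of_lt_right (by linarith), le_max_left _ _,
      max_lt ha (by linarith)⟩
  obtain ⟨C, hC, h⟩ := schwartz_decay_smul F hp0
  obtain ⟨D, _, hD⟩ := hg.bound
  have hint := integrable_norm_mul_rpow hg.locallyIntegrable hD hp0 (by linarith)
  set K := ∫ ξ, C * (‖g ξ‖ * (1 + ‖ξ‖) ^ (-p)) with hK
  have hlim : Tendsto (fun ε : ℝ => ε ^ (a - p) * K) (𝓝[>] 0) (𝓝 0) := by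
    have h1 := (Real.continuous_rpow_const (by linarith : 0 ≤ a - p)).tendsto 0
    rw [Real.zero_rpow (by linarith)] at h1
    simpa using (h1.mono_left nhdsWithin_le_nhds).mul_const K
  rw [tendsto_zero_iff_norm_tendsto_zero]
  refine squeeze_zero' (Eventually.of_forall fun _ => norm_nonneg _) ?_ hlim
  filter_upwards [Ioc_mem_nhdsGT (zero_lt_one' ℝ)] with ε hε
  have hb : ‖∫ ξ, g ξ * osc ψ 1 ξ * F (ε • ξ)‖ ≤ ε ^ (-p) * K := by
    rw [hK, ← integral_const_mul]
    refine norm_integral_le_of_norm_le ((hint.const_mul C).const_mul _)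
      (Eventually.of_forall fun ξ => ?_)
    rw [norm_mul, norm_mul, norm_osc, mul_one]
    calc ‖g ξ‖ * ‖F (ε • ξ)‖ ≤ ‖g ξ‖ * (C * (ε ^ (-p) * (1 + ‖ξ‖) ^ (-p))) :=
          mul_le_mul_of_nonneg_left (h ε ε hε.1 hε.2 le_rfl ξ) (norm_nonneg _)
      _ = _ := by ring
  rw [norm_mul, Complex.norm_real, Real.norm_of_nonneg (Real.rpow_nonneg hε.1.le _)]
  calc ε ^ a * ‖∫ ξ, g ξ * osc ψ 1 ξ * F (ε • ξ)‖ ≤ ε ^ a * (ε ^ (-p) * K) :=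
        mul_le_mul_of_nonneg_left hb (Real.rpow_nonneg hε.1.le _)
    _ = _ := by rw [← mul_assoc, ← Real.rpow_add hε.1, sub_eq_add_neg]

/-- The substitution ξ → ξ/ε: by homogeneity of degree one it moves ε from F into the phase as the
large parameter Λ = ε⁻¹. -/
theorem integral_osc_dilate {d : ℝ} {b : E n → ℂ} (hb : HomSymb d b) {ψ : E n → ℝ}
    (hψ : HomSymb 1 ψ) (F : E n → ℂ) {ε : ℝ} (hε : 0 < ε) :
    ((ε ^ ((n : ℝ) + d) : ℝ) : ℂ) * ∫ ξ, b ξ * osc ψ 1 ξ * F (ε • ξ) =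
      ∫ ξ, b ξ * F ξ * osc ψ ε⁻¹ ξ := by
  have h := Measure.integral_comp_smul (volume : Measure (E n))
    (fun ξ => b ξ * F ξ * osc ψ ε⁻¹ ξ) ε
  have e1 : ∀ ξ, b (ε • ξ) * F (ε • ξ) * osc ψ ε⁻¹ (ε • ξ) =
      ((ε ^ d : ℝ) : ℂ) * (b ξ * osc ψ 1 ξ * F (ε • ξ)) := fun ξ => by
    have e2 : osc ψ ε⁻¹ (ε • ξ) = osc ψ 1 ξ := by
      rw [osc, osc, hψ.hom ε hε, Real.rpow_one, smul_eq_mul, inv_mul_cancel_left₀ hε.ne', one_mul]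
    rw [e2, hb.hom ε hε, Complex.real_smul]
    ring
  simp_rw [e1] at h
  rw [integral_const_mul, finrank_euclideanSpace_fin, abs_of_pos (by positivity),
    Complex.real_smul] at h
  rw [Real.rpow_add hε, Real.rpow_natCast, Complex.ofReal_mul, mul_assoc, h, ← mul_assoc,
    ← Complex.ofReal_mul, mul_inv_cancel₀ (by positivity), Complex.ofReal_one, one_mul]

theorem HomSymb.temperedAmplitude (hn : n ≠ 0) {d : ℝ} (hd : 0 ≤ d) {b : E n → ℂ}
    (hb : HomSymb d b) : TemperedAmplitude b d := by
  obtain ⟨C, hC, h⟩ := hb.norm_le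
  refine ⟨?_, C, hC, fun ξ hξ => h ξ (norm_pos_iff.1 (by linarith))⟩
  have hc : Continuous fun ξ : E n => C * ‖ξ‖ ^ d :=
    continuous_const.mul (continuous_norm.rpow_const fun _ => Or.inr hd)
  refine hc.locallyIntegrable.mono
    (aestronglyMeasurable_of_continuousOn hn hb.smooth.continuousOn) ?_
  filter_upwards [ae_ne_zero hn] with ξ hξ
  exact (h ξ hξ).trans (le_abs_self _)

/-- Only the undifferentiated estimate of the expansion enters, evaluated at λ = ‖ξ‖ and α = ξ/‖ξ‖.
-/
theorem HasUniformExpansion.norm_sub_sum_amp_le {H : E n → ℝ} {v : E n → ℂ} {s : ℕ → ℝ}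
    {vc : ℕ → E n → ℂ} (h : HasUniformExpansion H v s vc) (J : ℕ) :
    ∃ C : ℝ, 0 ≤ C ∧ ∀ ξ : E n, 1 ≤ ‖ξ‖ →
      ‖v ξ - ∑ j ∈ Finset.range J, amp H (s j) (vc j) ξ‖ ≤ C * ‖ξ‖ ^ (-s J) := by
  obtain ⟨C, hC⟩ := h J 0 0
  refine ⟨|C|, abs_nonneg C, fun ξ hξ => ?_⟩
  have h0 : 0 < ‖ξ‖ := by linarith
  have hu := norm_unit (norm_pos_iff.1 h0)
  have h1 := hC ‖ξ‖ hξ (‖ξ‖⁻¹ • ξ) (by simpa using hu)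
  rw [norm_iteratedFDeriv_zero, iteratedDeriv_zero, hu, inv_one, one_smul, Nat.cast_zero,
    add_zero, remainder, smul_smul, mul_inv_cancel₀ h0.ne', one_smul, Finset.mul_sum] at h1
  have e : ∑ j ∈ Finset.range J, amp H (s j) (vc j) ξ = ∑ j ∈ Finset.range J,
      omega H (‖ξ‖⁻¹ • ξ) * (((‖ξ‖ ^ (-(s j)) : ℝ) : ℂ) * vc j (‖ξ‖⁻¹ • ξ)) :=
    Finset.sum_congr rfl fun j _ => by rw [amp]; ring
  rw [e]
  exact h1.trans (mul_le_mul_of_nonneg_right (le_abs_self C) (by positivity))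

theorem HasUniformExpansion.temperedAmplitude {H : E n → ℝ} {v : E n → ℂ} {s : ℕ → ℝ}
    {vc : ℕ → E n → ℂ} (h : HasUniformExpansion H v s vc) (hv : LocallyIntegrable v) :
    TemperedAmplitude v (-s 0) := by
  obtain ⟨C, hC, hb⟩ := h.norm_sub_sum_amp_le 0
  exact ⟨hv, C, hC, fun ξ hξ => by simpa using hb ξ hξ⟩

variable {H : E n → ℝ} {x₀ Θ : E n} {Ω : Set (E n)}

theorem ConormalPhase.tendsto_dilate_amp (h : ConormalPhase H x₀ Θ Ω) {a : E n → ℂ}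
    (ha : IsSmoothCompactlySupportedIn Ω a) {s κ : ℝ} (hs : s ≠ 0)
    {m : ℕ} (hm : (n : ℝ) + 1 ≤ -s + m) {q : E n → ℂ} (hq : HomSymb m q)
    (hqneg : ∀ ξ, q (-ξ) = (-1) ^ m * q ξ) (F : 𝓢(E n, ℂ)) (hκ : κ = s - ((n : ℝ) + 1) / 2) :
    Tendsto (fun ε : ℝ => ((ε ^ ((m : ℝ) - κ) : ℝ) : ℂ) *
        ∫ ξ, amp H s a ξ * q ξ * osc (phase H x₀) 1 ξ * F (ε • ξ)) (𝓝[>] 0)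
      (𝓝 (q Θ * rayLimit κ (a Θ) (a (-Θ)) Θ m F)) := by
  have hb : HomSymb (-s + m) fun ξ => amp H s a ξ * q ξ :=
    (homSymb_amp h.pos h.smooth h.hom h.isOpen h.neg ha hs).mul hq
  have hlim := (h.tendsto_amp ha hs hm hq hqneg F).comp tendsto_inv_nhdsGT_zero
  have e1 : -s + m + ((n : ℝ) - 1) / 2 = m - κ - 1 := by rw [hκ]; ring
  rw [e1] at hlim
  refine hlim.congr' ?_
  filter_upwards [self_mem_nhdsWithin] with ε hε
  have hε' : 0 < ε := hε
  simp only [Function.comp_apply]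
  rw [← integral_osc_dilate hb h.homSymb F hε', ← mul_assoc, ← Complex.ofReal_mul,
    Real.inv_rpow hε'.le, ← Real.rpow_neg hε'.le, ← Real.rpow_add hε']
  congr 3
  rw [hκ]
  ring

/-- The first term of the expansion gives the limit, the others carry an extra factor ε^{s_j − s_0},
and the remainder is negligible. -/
theorem ConormalPhase.hasRayLimit_of_large (h : ConormalPhase H x₀ Θ Ω) {v : E n → ℂ}
    (hv : LocallyIntegrable v) {s : ℕ → ℝ} (hs : StrictMono s) (hs_lim : Tendsto s atTop atTop)
    (hs0 : 0 < s 0) {vc : ℕ → E n → ℂ} (hvc : ∀ j, IsSmoothCompactlySupportedIn Ω (vc j))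
    (hexp : HasUniformExpansion H v s vc) {κ : ℝ} (hκ : κ = s 0 - ((n : ℝ) + 1) / 2) :
    ∃ M : ℕ, ∀ m, M ≤ m → HasRayLimit v (phase H x₀) κ (vc 0 Θ) (vc 0 (-Θ)) Θ m := by
  have hn := h.pos
  -- The remainder times q grows with exponent m − s_J; it is negligible against ε^{m−κ} once n + (m
  -- − s_J) < m − κ.
  obtain ⟨J, hJ0, hJ⟩ := ((eventually_ge_atTop 1).and
    (hs_lim.eventually_gt_atTop (n + κ))).exists
  -- This bound makes m − κ positive and every degree m − s_j with j < J at least n + 1, as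
  -- stationary phase requires.
  refine ⟨⌈s J + |κ| + n + 1⌉₊, fun m hm q hqc hq hqn F => ?_⟩
  have hm' : s J + |κ| + n + 1 ≤ m := (Nat.le_ceil _).trans (by exact_mod_cast hm)
  have hnn : (0 : ℝ) ≤ n := Nat.cast_nonneg n
  have hspos : ∀ j, 0 < s j := fun j => hs0.trans_le (hs.monotone (Nat.zero_le j))
  have hmκ : 0 < (m : ℝ) - κ := by linarith [le_abs_self κ, hspos J]
  have hdeg : ∀ j ∈ Finset.range J, (n : ℝ) + 1 ≤ -s j + m := fun j hj => by
    have := hs.monotone (Finset.mem_range.1 hj).le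
    linarith [abs_nonneg κ]
  have hψ := h.homSymb
  have haq : ∀ j, HomSymb (-s j + m) fun ξ => amp H (s j) (vc j) ξ * q ξ := fun j =>
    (homSymb_amp hn h.smooth h.hom h.isOpen h.neg (hvc j) (hspos j).ne').mul hq
  have hat : ∀ j ∈ Finset.range J, TemperedAmplitude (fun ξ => amp H (s j) (vc j) ξ * q ξ)
      (-s j + m) := fun j hj => (haq j).temperedAmplitude hn (by linarith [hdeg j hj])
  have hvt := (hexp.temperedAmplitude hv).mul hqc hq
  have hg : TemperedAmplitude
      (fun ξ => v ξ * q ξ - ∑ j ∈ Finset.range J, amp H (s j) (vc j) ξ * q ξ) (-s J + m) := by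
    obtain ⟨C, hC, hb⟩ := hexp.norm_sub_sum_amp_le J
    obtain ⟨D, hD, hqD⟩ := hq.norm_le
    refine ⟨?_, C * D, by positivity, fun ξ hξ => ?_⟩
    · refine hvt.locallyIntegrable.sub ?_
      have := locallyIntegrable_finsetSum (Finset.range J) fun j hj => (hat j hj).locallyIntegrable
      exact this
    · have h0 : 0 < ‖ξ‖ := by linarith
      rw [← Finset.sum_mul, ← sub_mul, norm_mul, Real.rpow_add h0]
      calc _ ≤ (C * ‖ξ‖ ^ (-s J)) * (D * ‖ξ‖ ^ (m : ℝ)) :=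
            mul_le_mul (hb ξ hξ) (hqD ξ (norm_pos_iff.1 h0)) (norm_nonneg _) (by positivity)
        _ = _ := by ring
  have hR := hg.tendsto_zero (phase H x₀) F hmκ (by linarith)
  have hA : ∀ j ∈ Finset.range J, Tendsto (fun ε : ℝ => ((ε ^ ((m : ℝ) - κ) : ℝ) : ℂ) *
      ∫ ξ, amp H (s j) (vc j) ξ * q ξ * osc (phase H x₀) 1 ξ * F (ε • ξ)) (𝓝[>] 0)
      (𝓝 (if j = 0 then q Θ * rayLimit κ (vc 0 Θ) (vc 0 (-Θ)) Θ m F else 0)) := fun j hj => by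
    split_ifs with hj0
    · subst hj0
      exact h.tendsto_dilate_amp (hvc 0) (hspos 0).ne' (hdeg 0 hj) hq hqn F hκ
    · have h1 := h.tendsto_dilate_amp (hvc j) (hspos j).ne' (hdeg j hj) hq hqn F rfl
      have hpos : 0 < s j - s 0 := sub_pos.2 (hs (Nat.pos_of_ne_zero hj0))
      have h2 : Tendsto (fun ε : ℝ => ((ε ^ (s j - s 0) : ℝ) : ℂ)) (𝓝[>] 0) (𝓝 0) := by
        have h3 := (Real.continuous_rpow_const hpos.le).tendsto 0
        rw [Real.zero_rpow hpos.ne'] at h3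
        have h4 := (Complex.continuous_ofReal.tendsto 0).comp (h3.mono_left (nhdsWithin_le_nhds (s := Set.Ioi 0)))
        simpa [Function.comp_def] using h4
      have h5 := h2.mul h1
      rw [zero_mul] at h5
      refine h5.congr' ?_
      filter_upwards [self_mem_nhdsWithin] with ε hε
      rw [← mul_assoc, ← Complex.ofReal_mul, ← Real.rpow_add hε]
      congr 3
      rw [hκ]
      ring
  have hsum := hR.add (tendsto_finsetSum _ hA)
  rw [Finset.sum_ite_eq' (Finset.range J) 0, if_pos (Finset.mem_range.2 hJ0), zero_add] at hsum
  refine hsum.congr' ?_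
  filter_upwards [self_mem_nhdsWithin] with ε hε
  have hε' : 0 < ε := hε
  have hi : ∀ j ∈ Finset.range J, Integrable fun ξ =>
      amp H (s j) (vc j) ξ * q ξ * osc (phase H x₀) 1 ξ * F (ε • ξ) := fun j hj =>
    (hat j hj).integrable hn hψ F hε'
  rw [← Finset.mul_sum, ← mul_add, ← integral_finsetSum _ hi,
    ← integral_add (hg.integrable hn hψ F hε') (integrable_finsetSum _ hi), oscInt]
  congr 2
  funext ξ
  simp only [← Finset.sum_mul]
  ring

theorem ConormalPhase.hasRayLimit (h : ConormalPhase H x₀ Θ Ω) {v : E n → ℂ}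
    (hv : LocallyIntegrable v) {s : ℕ → ℝ} (hs : StrictMono s) (hs_lim : Tendsto s atTop atTop)
    (hs0 : 0 < s 0) {vc : ℕ → E n → ℂ} (hvc : ∀ j, IsSmoothCompactlySupportedIn Ω (vc j))
    (hexp : HasUniformExpansion H v s vc) {κ : ℝ} (hκ : κ = s 0 - ((n : ℝ) + 1) / 2) {m : ℕ}
    (hm : κ < m) : HasRayLimit v (phase H x₀) κ (vc 0 Θ) (vc 0 (-Θ)) Θ m := by
  obtain ⟨M, hM⟩ := h.hasRayLimit_of_large hv hs hs_lim hs0 hvc hexp hκ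
  exact (hM (max m M) (le_max_right _ _)).of_le h.pos (hexp.temperedAmplitude hv) h.homSymb
    h.norm_eq hm (le_max_left _ _)

end LargeDegree

end Conormal

namespace Conormal

open scoped SchwartzMap FourierTransform

/-! ### The Fourier transform of test functions -/

section FourierSchwartz

variable {V : Type*} [NormedAddCommGroup V] [InnerProductSpace ℝ V] [FiniteDimensional ℝ V]
  [MeasurableSpace V] [BorelSpace V]

/-- The Fourier transform `∫ g(x) e^{-i ξ·x} dx` on Schwartz functions. -/
def fourierS : 𝓢(V, ℂ) →L[ℂ] 𝓢(V, ℂ) :=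
  (SchwartzMap.compCLMOfContinuousLinearEquiv ℂ
    (ContinuousLinearEquiv.smulLeft (Units.mk0 (2 * Real.pi)⁻¹ (by positivity)))).comp
    (SchwartzMap.fourierTransformCLM ℂ)

theorem fourierS_eq (g : 𝓢(V, ℂ)) (ξ : V) : fourierS g ξ = 𝓕 g ((2 * Real.pi)⁻¹ • ξ) := rfl

theorem fourierS_apply (g : 𝓢(V, ℂ)) (ξ : V) :
    fourierS g ξ = ∫ x, g x * Complex.exp (-(Complex.I * (⟪ξ, x⟫ : ℝ))) := by
  rw [fourierS_eq, SchwartzMap.fourier_coe, Real.fourier_eq']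
  congr 1
  funext x
  rw [smul_eq_mul, mul_comm, real_inner_smul_right, real_inner_comm]
  congr 2
  have : (Real.pi : ℂ) ≠ 0 := by exact_mod_cast Real.pi_ne_zero
  push_cast
  field_simp

theorem fourierS_lineDeriv (g : 𝓢(V, ℂ)) (u ξ : V) :
    fourierS (∂_{u} g) ξ = Complex.I * (⟪ξ, u⟫ : ℝ) * fourierS g ξ := by
  rw [fourierS_eq, SchwartzMap.fourier_lineDerivOp_eq, smul_apply,
    SchwartzMap.smulLeftCLM_apply_apply (by fun_prop), fourierS_eq, real_inner_smul_left,
    Complex.real_smul, smul_eq_mul]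
  have : (Real.pi : ℂ) ≠ 0 := by exact_mod_cast Real.pi_ne_zero
  push_cast
  field_simp

end FourierSchwartz

/-! ### Derivatives and dilations of test functions on the Fourier side -/

section TestFourier

variable {n : ℕ}

/-- A test function as a Schwartz function. -/
def toS : Test n →ₗ[ℂ] 𝓢(E n, ℂ) where
  toFun w := w.hasCompactSupport.toSchwartzMap w.contDiff
  map_add' _ _ := rfl
  map_smul' _ _ := rfl

theorem toS_apply (w : Test n) (x : E n) : toS w x = w x := rfl

theorem toS_lineDeriv (w : Test n) (u : E n) : toS (∂_{u} w) = ∂_{u} (toS w) := by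
  ext x
  rw [toS_apply, TestFunction.lineDerivOp_eq_lineDerivCLM ℂ,
    TestFunction.lineDerivCLM_apply_of_le (by simp), SchwartzMap.lineDerivOp_apply]
  rfl

/-- The Fourier transform `∫ w(x) e^{-i ξ·x} dx` of a test function. -/
theorem fourierS_toS (w : Test n) (ξ : E n) : fourierS (toS w) ξ = fourier w (-ξ) := by
  rw [fourierS_apply, fourier]
  congr 1
  funext x
  rw [toS_apply, inner_neg_left]
  push_cast
  ring_nf

theorem fourierS_iterate_lineDeriv (w : Test n) (u ξ : E n) (k : ℕ) :
    fourierS (toS ((fun h : Test n => ∂_{u} h)^[k] w)) ξ =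
      (Complex.I * (⟪ξ, u⟫ : ℝ)) ^ k * fourierS (toS w) ξ := by
  induction k with
  | zero => simp
  | succ k ih =>
    rw [Function.iterate_succ_apply', toS_lineDeriv, fourierS_lineDeriv, ih, pow_succ]
    ring

theorem fourierS_multiDeriv (ν : Fin n →₀ ℕ) (w : Test n) (ξ : E n) :
    fourierS (toS (multiDeriv ν w)) ξ =
      (∏ i, (Complex.I * (ξ i : ℂ)) ^ ν i) * fourierS (toS w) ξ := by
  rw [Fin.prod_univ_def, multiDeriv]
  induction List.finRange n with
  | nil => simp
  | cons i l ih =>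
    rw [List.foldr_cons, List.map_cons, List.prod_cons, fourierS_iterate_lineDeriv, ih,
      EuclideanSpace.inner_single_right]
    simp [mul_assoc]

theorem fourierS_polyDeriv (P : MvPolynomial (Fin n) ℂ) (w : Test n) (ξ : E n) :
    fourierS (toS (polyDeriv P w)) ξ =
      MvPolynomial.eval (fun i => Complex.I * (ξ i : ℂ)) P * fourierS (toS w) ξ := by
  rw [polyDeriv, map_sum, map_sum, sum_apply, MvPolynomial.eval_eq', Finset.sum_mul]
  refine Finset.sum_congr rfl fun ν _ => ?_
  rw [map_smul, map_smul, smul_apply, fourierS_multiDeriv, smul_eq_mul, mul_assoc]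

theorem eval_mul_of_isHomogeneous {P : MvPolynomial (Fin n) ℂ} {m : ℕ} (hP : P.IsHomogeneous m)
    (c : ℂ) (z : Fin n → ℂ) :
    MvPolynomial.eval (fun i => c * z i) P = c ^ m * MvPolynomial.eval z P := by
  rw [MvPolynomial.eval_eq, MvPolynomial.eval_eq, Finset.mul_sum]
  refine Finset.sum_congr rfl fun ν hν => ?_
  simp_rw [mul_pow]
  rw [Finset.prod_mul_distrib, Finset.prod_pow_eq_pow_sum]
  have h := hP (MvPolynomial.mem_support_iff.1 hν)
  rw [Finsupp.weight_apply, Finsupp.sum] at h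
  simp only [Pi.one_apply, smul_eq_mul, mul_one] at h
  rw [h]
  ring

theorem fourierS_dilate (x₀ : E n) {ε : ℝ} (hε : 0 < ε) (w : Test n) (ξ : E n) :
    fourierS (toS (dilate x₀ ε w)) ξ =
      Complex.exp (-(Complex.I * (⟪ξ, x₀⟫ : ℝ))) * fourierS (toS w) (ε • ξ) := by
  have h := Measure.integral_comp_smul (volume : Measure (E n))
    (fun x => toS w x * Complex.exp (-(Complex.I * (⟪ε • ξ, x⟫ : ℝ)))) ε⁻¹
  have h2 := integral_sub_right_eq_self (μ := (volume : Measure (E n)))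
    (fun x => toS w (ε⁻¹ • x) * Complex.exp (-(Complex.I * (⟪ε • ξ, ε⁻¹ • x⟫ : ℝ)))) x₀
  rw [h] at h2
  rw [finrank_euclideanSpace_fin, inv_pow, inv_inv, abs_of_pos (by positivity), Complex.real_smul] at h2
  have hne : ((ε ^ n : ℝ) : ℂ) ≠ 0 := by exact_mod_cast (pow_pos hε n).ne'
  rw [fourierS_apply, fourierS_apply, ← mul_right_inj' hne, mul_left_comm (((ε ^ n : ℝ)) : ℂ) (Complex.exp _),
    ← h2, ← integral_const_mul, ← integral_const_mul]
  congr 1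
  funext x
  rw [toS_apply, dilate_apply x₀ hε.ne', toS_apply, real_inner_smul_left, real_inner_smul_right,
    mul_inv_cancel_left₀ hε.ne', inner_sub_right, Complex.real_smul, Complex.ofReal_inv]
  have e : Complex.exp (-(Complex.I * (⟪ξ, x⟫ : ℝ))) =
      Complex.exp (-(Complex.I * (⟪ξ, x₀⟫ : ℝ))) *
        Complex.exp (-(Complex.I * ((⟪ξ, x⟫ - ⟪ξ, x₀⟫ : ℝ) : ℂ))) := by
    rw [← Complex.exp_add]
    push_cast
    ring_nf
  rw [e]
  field_simp

/-- The polynomial `P` as a function on `ℝⁿ`. -/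
def evalReal (P : MvPolynomial (Fin n) ℂ) (ξ : E n) : ℂ :=
  MvPolynomial.eval (fun i => (ξ i : ℂ)) P

theorem contDiff_evalReal (P : MvPolynomial (Fin n) ℂ) : ContDiff ℝ ∞ (evalReal P) := by
  have e : evalReal P = fun ξ : E n => ∑ ν ∈ P.support, P.coeff ν * ∏ i, (ξ i : ℂ) ^ ν i := by
    funext ξ
    rw [evalReal, MvPolynomial.eval_eq']
  rw [e]
  have hc : ∀ i : Fin n, ContDiff ℝ ∞ fun ξ : E n => (ξ i : ℂ) := fun i =>
    Complex.ofRealCLM.contDiff.comp (EuclideanSpace.proj i : E n →L[ℝ] ℝ).contDiff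
  exact ContDiff.sum fun ν _ => contDiff_const.mul (contDiff_prod fun i _ => (hc i).pow _)

theorem evalReal_smul {P : MvPolynomial (Fin n) ℂ} {m : ℕ} (hP : P.IsHomogeneous m) (t : ℝ)
    (ξ : E n) : evalReal P (t • ξ) = (t : ℂ) ^ m * evalReal P ξ := by
  rw [evalReal, evalReal, ← eval_mul_of_isHomogeneous hP]
  simp

theorem homSymb_evalReal {P : MvPolynomial (Fin n) ℂ} {m : ℕ} (hP : P.IsHomogeneous m) :
    HomSymb m (evalReal P) :=
  ⟨ContDiff.contDiffOn (contDiff_evalReal P), fun t _ ξ => by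
    rw [evalReal_smul hP, Real.rpow_natCast, Complex.real_smul]
    push_cast
    rfl⟩

/-- The derivatives become the weight iᵐP, the dilation becomes F(εξ), and the translation to x₀
contributes e^{-iξ·x₀}, which completes H to the phase ψ. -/
theorem IsOscillatoryIntegral.polyDeriv_dilate (hn : n ≠ 0) {v : E n → ℂ} {H : E n → ℝ}
    {f : Distr n} (hf : IsOscillatoryIntegral v H f) (x₀ : E n) {P : MvPolynomial (Fin n) ℂ} {m : ℕ}
    (hP : P.IsHomogeneous m) (w : Test n) {ε : ℝ} (hε : 0 < ε) :
    f (polyDeriv P (dilate x₀ ε w)) = (((2 * Real.pi) ^ n)⁻¹ : ℝ) * (Complex.I ^ m *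
      oscInt v (phase H x₀) (evalReal P) (fourierS (toS w)) ε) := by
  rw [hf, oscInt, ← integral_const_mul (Complex.I ^ m)]
  congr 1
  refine integral_congr_ae ?_
  filter_upwards [ae_ne_zero hn] with ξ hξ
  rw [← fourierS_toS, fourierS_polyDeriv, eval_mul_of_isHomogeneous hP, fourierS_dilate x₀ hε,
    evalReal, osc, phase_of_ne hξ]
  have e : Complex.exp (Complex.I * ((1 * (H ξ - ⟪ξ, x₀⟫) : ℝ) : ℂ)) =
      Complex.exp (Complex.I * (H ξ : ℝ)) * Complex.exp (-(Complex.I * (⟪ξ, x₀⟫ : ℝ))) := by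
    rw [← Complex.exp_add]
    push_cast
    ring_nf
  rw [e]
  ring

theorem ConormalPhase.tendsto_polyDeriv_dilate {H : E n → ℝ} {x₀ Θ : E n} {Ω : Set (E n)}
    (h : ConormalPhase H x₀ Θ Ω) {v : E n → ℂ}
    (hv : LocallyIntegrable v) {s : ℕ → ℝ} (hs : StrictMono s) (hs_lim : Tendsto s atTop atTop)
    (hs0 : 0 < s 0) {vc : ℕ → E n → ℂ} (hvc : ∀ j, IsSmoothCompactlySupportedIn Ω (vc j))
    (hexp : HasUniformExpansion H v s vc) {κ : ℝ} (hκ : κ = s 0 - ((n : ℝ) + 1) / 2)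
    {f : Distr n} (hf : IsOscillatoryIntegral v H f) {m : ℕ} (hm : κ < m)
    {P : MvPolynomial (Fin n) ℂ} (hP : P.IsHomogeneous m) (w : Test n) :
    Tendsto (fun ε : ℝ => ((ε ^ ((m : ℝ) - κ) : ℝ) : ℂ) * f (polyDeriv P (dilate x₀ ε w)))
      (𝓝[>] 0) (𝓝 ((((2 * Real.pi) ^ n)⁻¹ : ℝ) * (Complex.I ^ m * (evalReal P Θ *
        rayLimit κ (vc 0 Θ) (vc 0 (-Θ)) Θ m (fourierS (toS w)))))) := by
  have h1 := h.hasRayLimit hv hs hs_lim hs0 hvc hexp hκ hm (evalReal P)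
    (contDiff_evalReal P).continuous (homSymb_evalReal hP) (fun ξ => by
      have := evalReal_smul hP (-1) ξ
      rw [neg_one_smul] at this
      rw [this]
      push_cast
      rfl) (fourierS (toS w))
  refine ((h1.const_mul (Complex.I ^ m)).const_mul ((((2 * Real.pi) ^ n)⁻¹ : ℝ) : ℂ)).congr' ?_
  filter_upwards [self_mem_nhdsWithin] with ε hε
  rw [hf.polyDeriv_dilate h.pos x₀ hP w hε]
  ring

end TestFourier

end Conormal

namespace Conormal

open scoped SchwartzMap FourierTransform

/-! ### The Fourier transform of the homogeneous distributions on the line -/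

section GammaIntegral

theorem integrableOn_rpow_mul_cexp {b : ℝ} (hb : 0 < b) {z : ℂ} (hz : 0 < z.re) :
    IntegrableOn (fun t : ℝ => ((t ^ (b - 1) : ℝ) : ℂ) * Complex.exp (-(z * t))) (Set.Ioi 0) := by
  have h := integrableOn_rpow_mul_exp_neg_mul_rpow (p := 1) (s := b - 1) (by linarith) one_pos hz
  simp only [Real.rpow_one] at h
  refine h.mono' ?_ ?_
  · have h1 : Measurable fun t : ℝ => ((t ^ (b - 1) : ℝ) : ℂ) := by fun_prop
    have h2 : Continuous fun t : ℝ => Complex.exp (-(z * t)) := by fun_prop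
    exact (h1.mul h2.measurable).aestronglyMeasurable
  · refine (ae_restrict_iff' measurableSet_Ioi).2 (Eventually.of_forall fun t ht => ?_)
    rw [norm_mul, Complex.norm_real, Real.norm_of_nonneg (Real.rpow_nonneg (le_of_lt ht) _),
      Complex.norm_exp]
    simp

/-- The Laplace transform of `t^{b-1}`. -/
def laplacePow (b : ℝ) (z : ℂ) : ℂ :=
  ∫ t in Set.Ioi (0 : ℝ), ((t ^ (b - 1) : ℝ) : ℂ) * Complex.exp (-(z * t))

theorem tendsto_rpow_mul_cexp (b : ℝ) {z : ℂ} (hz : 0 < z.re) :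
    Tendsto (fun t : ℝ => ((t ^ b : ℝ) : ℂ) * Complex.exp (-(z * t))) atTop (𝓝 0) := by
  rw [tendsto_zero_iff_norm_tendsto_zero]
  refine (tendsto_rpow_mul_exp_neg_mul_atTop_nhds_zero b z.re hz).congr' ?_
  filter_upwards [eventually_ge_atTop 0] with t ht
  rw [norm_mul, Complex.norm_real, Real.norm_of_nonneg (Real.rpow_nonneg ht _), Complex.norm_exp]
  simp

theorem laplacePow_add_one {b : ℝ} (hb : 0 < b) {z : ℂ} (hz : 0 < z.re) :
    z * laplacePow (b + 1) z = b * laplacePow b z := by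
  have i1 := (integrableOn_rpow_mul_cexp hb hz).const_mul (b : ℂ)
  have i2 := (integrableOn_rpow_mul_cexp (by linarith : 0 < b + 1) hz).const_mul z
  have hd : ∀ t ∈ Set.Ioi (0 : ℝ), HasDerivAt
      (fun t : ℝ => ((t ^ b : ℝ) : ℂ) * Complex.exp (-(z * t)))
      (b * (((t ^ (b - 1) : ℝ) : ℂ) * Complex.exp (-(z * t))) -
        z * (((t ^ (b + 1 - 1) : ℝ) : ℂ) * Complex.exp (-(z * t)))) t := fun t ht => by
    have h1 := (Real.hasDerivAt_rpow_const (p := b) (Or.inl (Set.mem_Ioi.1 ht).ne')).ofReal_comp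
    have h2 : HasDerivAt (fun t : ℝ => -(z * (t : ℂ))) (-(z * 1)) t :=
      ((hasDerivAt_id t).ofReal_comp.const_mul z).neg
    refine (h1.mul h2.cexp).congr_deriv ?_
    rw [add_sub_cancel_right]
    push_cast
    ring
  have hc : ContinuousWithinAt (fun t : ℝ => ((t ^ b : ℝ) : ℂ) * Complex.exp (-(z * t)))
      (Set.Ici 0) 0 := by
    have h1 : Continuous fun t : ℝ => t ^ b := Real.continuous_rpow_const hb.le
    have h3 : Continuous fun t : ℝ => ((t ^ b : ℝ) : ℂ) * Complex.exp (-(z * t)) := by fun_prop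
    exact h3.continuousWithinAt
  have h := integral_Ioi_of_hasDerivAt_of_tendsto hc hd (i1.sub i2) (tendsto_rpow_mul_cexp b hz)
  rw [integral_sub i1 i2, integral_const_mul, integral_const_mul, Real.zero_rpow hb.ne',
    Complex.ofReal_zero, zero_mul, sub_zero] at h
  exact (sub_eq_zero.1 h).symm

theorem hasDerivAt_laplacePow {b : ℝ} (hb : 0 < b) {δ : ℝ} (hδ : 0 < δ) (p : ℝ) :
    HasDerivAt (fun p : ℝ => laplacePow b (δ + Complex.I * p))
      (-Complex.I * laplacePow (b + 1) (δ + Complex.I * p)) p := by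
  have hre : ∀ p : ℝ, 0 < ((δ : ℂ) + Complex.I * p).re := fun p => by simpa using hδ
  have hmeas : ∀ (b p : ℝ), AEStronglyMeasurable
      (fun t : ℝ => ((t ^ b : ℝ) : ℂ) * Complex.exp (-(((δ : ℂ) + Complex.I * p) * t)))
      (volume.restrict (Set.Ioi 0)) := fun b p => by
    have h1 : Measurable fun t : ℝ => ((t ^ b : ℝ) : ℂ) := by fun_prop
    have h2 : Continuous fun t : ℝ => Complex.exp (-(((δ : ℂ) + Complex.I * p) * t)) := by fun_prop
    exact (h1.mul h2.measurable).aestronglyMeasurable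
  have hb1 : 0 < b + 1 := by linarith
  have key := (hasDerivAt_integral_of_dominated_loc_of_deriv_le
    (μ := volume.restrict (Set.Ioi (0 : ℝ))) (𝕜 := ℝ)
    (F := fun (p t : ℝ) => ((t ^ (b - 1) : ℝ) : ℂ) *
      Complex.exp (-(((δ : ℂ) + Complex.I * p) * t)))
    (F' := fun (p t : ℝ) => -Complex.I * (((t ^ (b + 1 - 1) : ℝ) : ℂ) *
      Complex.exp (-(((δ : ℂ) + Complex.I * p) * t))))
    (bound := fun t => ‖((t ^ (b + 1 - 1) : ℝ) : ℂ) *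
      Complex.exp (-(((δ : ℂ) + Complex.I * (0 : ℝ)) * t))‖) (x₀ := p) (s := Set.univ) univ_mem
    (Eventually.of_forall fun p => hmeas _ p) (integrableOn_rpow_mul_cexp hb (hre p))
    ((hmeas _ p).const_mul _) (Eventually.of_forall fun t p _ => ?_)
    (integrableOn_rpow_mul_cexp hb1 (hre 0)).norm ?_).2
  · rw [integral_const_mul] at key
    exact key
  · rw [norm_mul, norm_neg, Complex.norm_I, one_mul, norm_mul, norm_mul, Complex.norm_exp,
      Complex.norm_exp]
    simp
  · refine (ae_restrict_iff' measurableSet_Ioi).2 (Eventually.of_forall fun t ht p _ => ?_)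
    have h2 : HasDerivAt (fun p : ℝ => -(((δ : ℂ) + Complex.I * p) * (t : ℂ)))
        (-((Complex.I * 1) * t)) p :=
      ((((hasDerivAt_id p).ofReal_comp.const_mul Complex.I).const_add (δ : ℂ)).mul_const _).neg
    refine (h2.cexp.const_mul _).congr_deriv ?_
    have h3 : t ^ (b + 1 - 1) = t ^ (b - 1) * t := by
      rw [← Real.rpow_add_one (Set.mem_Ioi.1 ht).ne']
      ring_nf
    rw [h3]
    push_cast
    ring

/-- By the recursion in b, the function z^b times the Laplace transform has zero derivative along
the line Re z = δ. Its constant value is read off at z = δ from the integral defining Γ. -/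
theorem laplacePow_eq {b : ℝ} (hb : 0 < b) {δ : ℝ} (hδ : 0 < δ) (p : ℝ) :
    laplacePow b (δ + Complex.I * p) = Real.Gamma b * ((δ : ℂ) + Complex.I * p) ^ (-b : ℂ) := by
  have hre : ∀ p : ℝ, 0 < ((δ : ℂ) + Complex.I * p).re := fun p => by simpa using hδ
  have hz0 : ∀ p : ℝ, (δ : ℂ) + Complex.I * p ≠ 0 := fun p h0 => by
    have := hre p
    rw [h0] at this
    simp at this
  have hd : ∀ p : ℝ, HasDerivAt
      (fun p : ℝ => ((δ : ℂ) + Complex.I * p) ^ (b : ℂ) * laplacePow b (δ + Complex.I * p)) 0 p :=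
      fun p => by
    have h1 : HasDerivAt (fun p : ℝ => (δ : ℂ) + Complex.I * p) (Complex.I * 1) p :=
      ((hasDerivAt_id p).ofReal_comp.const_mul Complex.I).const_add (δ : ℂ)
    have h2 := HasDerivAt.scomp (h := fun p : ℝ => (δ : ℂ) + Complex.I * p) p
      ((hasDerivAt_id ((δ : ℂ) + Complex.I * p)).cpow_const (c := (b : ℂ)) (Or.inl (hre p))) h1
    refine (h2.mul (hasDerivAt_laplacePow hb hδ p)).congr_deriv ?_
    have h3 := laplacePow_add_one hb (hre p)
    simp only [id, Function.comp_apply, smul_eq_mul]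
    rw [Complex.cpow_sub _ _ (hz0 p), Complex.cpow_one]
    set z := (δ : ℂ) + Complex.I * p with hz
    have h4 : laplacePow (b + 1) z = b * laplacePow b z / z := by
      rw [eq_div_iff (hz0 p), mul_comm, h3]
    rw [h4]
    ring
  have hconst := is_const_of_deriv_eq_zero (fun p => (hd p).differentiableAt)
    (fun p => (hd p).deriv) p 0
  have h0 : laplacePow b (δ + Complex.I * (0 : ℝ)) = Real.Gamma b * (δ : ℂ) ^ (-b : ℂ) := by
    rw [laplacePow, Complex.ofReal_zero, mul_zero, add_zero]
    have h5 := Complex.integral_cpow_mul_exp_neg_mul_Ioi (a := (b : ℂ)) (by simpa using hb) hδ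
    rw [Complex.Gamma_ofReal, one_div, ← Complex.ofReal_inv] at h5
    have h6 : ((δ⁻¹ : ℝ) : ℂ) ^ (b : ℂ) = (δ : ℂ) ^ (-b : ℂ) := by
      rw [← Complex.ofReal_cpow (by positivity), Real.inv_rpow hδ.le, ← Real.rpow_neg hδ.le,
        Complex.ofReal_cpow hδ.le]
      push_cast
      rfl
    rw [h6, mul_comm] at h5
    rw [← h5]
    refine setIntegral_congr_fun measurableSet_Ioi fun t ht => ?_
    rw [Complex.ofReal_cpow (le_of_lt ht)]
    push_cast
    rfl
  simp only [h0] at hconst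
  rw [Complex.ofReal_zero, mul_zero, add_zero, mul_left_comm, ← Complex.cpow_add _ _
    (by exact_mod_cast hδ.ne'), add_neg_cancel, Complex.cpow_zero, mul_one] at hconst
  rw [← hconst, mul_comm _ (laplacePow b _), mul_assoc, ← Complex.cpow_add _ _ (hz0 p),
    add_neg_cancel, Complex.cpow_zero, mul_one]

end GammaIntegral

/-! ### Homogeneous powers paired with Schwartz functions -/

section BaseFormula

theorem norm_I_mul_cpow (p a : ℝ) :
    ‖(Complex.I * (p : ℂ)) ^ (a : ℂ)‖ = |p| ^ a := by
  rw [Complex.norm_cpow_real, norm_mul, Complex.norm_I, one_mul, Complex.norm_real, Real.norm_eq_abs]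

theorem integrable_abs_rpow_mul (φ : 𝓢(ℝ, ℂ)) {a : ℝ} (ha : -1 < a) :
    Integrable fun p : ℝ => |p| ^ a * ‖φ p‖ := by
  obtain ⟨C, hC, h⟩ := exists_schwartz_decay φ (⌈a⌉₊ + 2)
  have hpos : ∀ ψ : 𝓢(ℝ, ℂ), (∀ x, ‖ψ x‖ ≤ C * (1 + ‖x‖) ^ (-((⌈a⌉₊ + 2 : ℕ) : ℝ))) →
      IntegrableOn (fun p : ℝ => |p| ^ a * ‖ψ p‖) (Set.Ioi 0) := fun ψ hψ => by
    refine ((integrableOn_rpow_mul_one_add ha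
      (?_ : a + 1 < ((⌈a⌉₊ + 2 : ℕ) : ℝ))).const_mul C).mono' ?_ ?_
    · push_cast
      linarith [Nat.le_ceil a]
    · have h1 : Measurable fun p : ℝ => |p| ^ a := by fun_prop
      have := ψ.continuous
      exact (h1.mul this.norm.measurable).aestronglyMeasurable
    · refine (ae_restrict_iff' measurableSet_Ioi).2 (Eventually.of_forall fun t ht => ?_)
      have ht' : 0 < t := ht
      have := hψ t
      rw [Real.norm_of_nonneg ht'.le] at this
      rw [norm_mul, norm_norm, Real.norm_of_nonneg (by positivity), abs_of_pos ht']
      calc t ^ a * ‖ψ t‖ ≤ t ^ a * (C * (1 + t) ^ (-((⌈a⌉₊ + 2 : ℕ) : ℝ))) := by gcongr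
        _ = _ := by ring
  set φn : 𝓢(ℝ, ℂ) := SchwartzMap.compCLMOfContinuousLinearEquiv ℂ
    (ContinuousLinearEquiv.neg ℝ) φ with hφn
  have hφn_apply : ∀ x, φn x = φ (-x) := fun x => rfl
  have h1 := hpos φ h
  have h2 := hpos φn fun x => by simpa [hφn_apply] using h (-x)
  have h3 : IntegrableOn (fun p : ℝ => |p| ^ a * ‖φ p‖) (Set.Iio 0) := by
    have h4 := (show IntegrableOn (fun p : ℝ => |p| ^ a * ‖φn p‖) (Set.Ioi (-0)) by
      rwa [neg_zero]).comp_neg_Iio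
    simpa [hφn_apply] using h4
  rw [← integrableOn_univ, ← Set.Iic_union_Ioi (a := (0 : ℝ))]
  refine IntegrableOn.union ?_ h1
  rwa [integrableOn_Iic_iff_integrableOn_Iio]

end BaseFormula

end Conormal

namespace Conormal

open scoped SchwartzMap FourierTransform

/-! ### The Fourier transform of l^(b-1) for 0 < b < 1 -/

section BaseFormula

theorem fourierS_real_apply (φ : 𝓢(ℝ, ℂ)) (l : ℝ) :
    fourierS φ l = ∫ p, φ p * Complex.exp (-(Complex.I * ((l * p : ℝ) : ℂ))) := by
  rw [fourierS_apply]
  congr 1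
  funext p
  rw [real_inner_eq_re_inner]
  simp [mul_comm]

/-- The damping e^{-δl} gives the absolute convergence that Fubini needs; the inner integral is then
the Laplace transform at δ + ip. -/
theorem integral_rpow_mul_exp_mul_fourierS (φ : 𝓢(ℝ, ℂ)) {b : ℝ} (hb : 0 < b) {δ : ℝ}
    (hδ : 0 < δ) :
    ∫ l in Set.Ioi (0 : ℝ), ((l ^ (b - 1) : ℝ) : ℂ) * Complex.exp (-((δ : ℂ) * l)) * fourierS φ l =
      ∫ p, φ p * (Real.Gamma b * ((δ : ℂ) + Complex.I * p) ^ (-b : ℂ)) := by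
  have hi : Integrable (fun z : ℝ × ℝ => (((z.1 ^ (b - 1) : ℝ) : ℂ) *
      Complex.exp (-((δ : ℂ) * z.1))) * φ z.2) ((volume.restrict (Set.Ioi 0)).prod volume) :=
    (integrableOn_rpow_mul_cexp hb (by simpa using hδ)).mul_prod φ.integrable
  have hi2 : Integrable (fun z : ℝ × ℝ => (((z.1 ^ (b - 1) : ℝ) : ℂ) *
      Complex.exp (-((δ : ℂ) * z.1))) * (φ z.2 * Complex.exp (-(Complex.I * ((z.1 * z.2 : ℝ) : ℂ)))))
      ((volume.restrict (Set.Ioi 0)).prod volume) := by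
    have hc : Continuous fun z : ℝ × ℝ => Complex.exp (-(Complex.I * ((z.1 * z.2 : ℝ) : ℂ))) := by
      fun_prop
    refine hi.norm.mono' ?_ (Eventually.of_forall fun z => ?_)
    · refine (hi.aestronglyMeasurable.mul hc.aestronglyMeasurable).congr
        (Eventually.of_forall fun z => ?_)
      simp only [Pi.mul_apply, mul_assoc]
    · have : ‖Complex.exp (-(Complex.I * ((z.1 * z.2 : ℝ) : ℂ)))‖ = 1 := by
        rw [Complex.norm_exp]
        simp
      rw [← mul_assoc, norm_mul, this, mul_one]
  have hswap := integral_integral_swap (f := fun l p => (((l ^ (b - 1) : ℝ) : ℂ) *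
    Complex.exp (-((δ : ℂ) * l))) * (φ p * Complex.exp (-(Complex.I * ((l * p : ℝ) : ℂ))))) hi2
  simp_rw [integral_const_mul, ← fourierS_real_apply] at hswap
  rw [hswap]
  congr 1
  funext p
  rw [← laplacePow_eq hb hδ, laplacePow, ← integral_const_mul]
  congr 1
  funext l
  have e : Complex.exp (-(((δ : ℂ) + Complex.I * p) * l)) =
      Complex.exp (-((δ : ℂ) * l)) * Complex.exp (-(Complex.I * ((l * p : ℝ) : ℂ))) := by
    rw [← Complex.exp_add]
    push_cast
    ring_nf
  rw [e]
  ring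

theorem integrable_rpow_fourierS (φ : 𝓢(ℝ, ℂ)) {a : ℝ} (ha : -1 < a) :
    IntegrableOn (fun l : ℝ => ((l ^ a : ℝ) : ℂ) * φ l) (Set.Ioi 0) := by
  refine (integrable_abs_rpow_mul φ ha).integrableOn.mono' ?_ ?_
  · have h1 : Measurable fun t : ℝ => ((t ^ a : ℝ) : ℂ) := by fun_prop
    exact (h1.mul φ.continuous.measurable).aestronglyMeasurable
  · refine (ae_restrict_iff' measurableSet_Ioi).2 (Eventually.of_forall fun t ht => ?_)
    have ht' : 0 < t := ht
    rw [norm_mul, Complex.norm_real, Real.norm_of_nonneg (by positivity), abs_of_pos ht']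

theorem integrable_mul_cpow (φ : 𝓢(ℝ, ℂ)) {a : ℝ} (ha : -1 < a) :
    Integrable fun p : ℝ => φ p * (Complex.I * p) ^ (a : ℂ) := by
  refine (integrable_abs_rpow_mul φ ha).mono' ?_ (Eventually.of_forall fun p => ?_)
  · have h1 : Measurable fun p : ℝ => (Complex.I * p : ℂ) ^ (a : ℂ) := by fun_prop
    exact (φ.continuous.measurable.mul h1).aestronglyMeasurable
  · rw [norm_mul, norm_I_mul_cpow, mul_comm]

/-- Let δ → 0 in the damped formula. Since |δ + ip| ≥ |p|, the right-hand side is dominated by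
|p|^{-b}|φ|, which is integrable for b < 1; b > 0 gives integrability at 0 on the left. -/
theorem integral_rpow_mul_fourierS (φ : 𝓢(ℝ, ℂ)) {b : ℝ} (hb : 0 < b) (hb1 : b < 1) :
    ∫ l in Set.Ioi (0 : ℝ), ((l ^ (b - 1) : ℝ) : ℂ) * fourierS φ l =
      Real.Gamma b * ∫ p, φ p * (Complex.I * p) ^ (((-b : ℝ) : ℂ)) := by
  have hL : Tendsto (fun δ : ℝ => ∫ l in Set.Ioi (0 : ℝ), ((l ^ (b - 1) : ℝ) : ℂ) *
      Complex.exp (-((δ : ℂ) * l)) * fourierS φ l) (𝓝[>] 0)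
      (𝓝 (∫ l in Set.Ioi (0 : ℝ), ((l ^ (b - 1) : ℝ) : ℂ) * fourierS φ l)) := by
    refine tendsto_integral_filter_of_dominated_convergence
      (fun l => ‖((l ^ (b - 1) : ℝ) : ℂ) * fourierS φ l‖) ?_ ?_
      (integrable_rpow_fourierS (fourierS φ) (by linarith)).norm ?_
    · refine Eventually.of_forall fun δ => ?_
      have h1 : Measurable fun t : ℝ => ((t ^ (b - 1) : ℝ) : ℂ) := by fun_prop
      have h2 : Continuous fun l : ℝ => Complex.exp (-((δ : ℂ) * l)) := by fun_prop
      exact ((h1.mul h2.measurable).mul (fourierS φ).continuous.measurable).aestronglyMeasurable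
    · filter_upwards [self_mem_nhdsWithin] with δ hδ
      refine (ae_restrict_iff' measurableSet_Ioi).2 (Eventually.of_forall fun l hl => ?_)
      rw [mul_right_comm, norm_mul, Complex.norm_exp]
      refine mul_le_of_le_one_right (norm_nonneg _) (Real.exp_le_one_iff.2 ?_)
      have : 0 ≤ δ * l := mul_nonneg (le_of_lt hδ) (le_of_lt hl)
      simpa using this
    · refine Eventually.of_forall fun l => ?_
      have hc : Continuous fun δ : ℝ => ((l ^ (b - 1) : ℝ) : ℂ) * Complex.exp (-((δ : ℂ) * l)) *
          fourierS φ l := by fun_prop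
      have := (hc.tendsto 0).mono_left (nhdsWithin_le_nhds (s := Set.Ioi 0))
      simpa using this
  have hR : Tendsto (fun δ : ℝ => ∫ p, φ p * (Real.Gamma b * ((δ : ℂ) + Complex.I * p) ^ (-b : ℂ)))
      (𝓝[>] 0) (𝓝 (∫ p, φ p * (Real.Gamma b * (Complex.I * p) ^ (((-b : ℝ) : ℂ))))) := by
    refine tendsto_integral_filter_of_dominated_convergence
      (fun p => |Real.Gamma b| * (|p| ^ (-b) * ‖φ p‖)) ?_ ?_
      ((integrable_abs_rpow_mul φ (by linarith : -1 < -b)).const_mul _) ?_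
    · refine Eventually.of_forall fun δ => ?_
      have h1 : Measurable fun p : ℝ => ((δ : ℂ) + Complex.I * p) ^ (-b : ℂ) := by fun_prop
      exact (φ.continuous.measurable.mul (h1.const_mul _)).aestronglyMeasurable
    · refine Eventually.of_forall fun δ => ?_
      filter_upwards [Measure.ae_ne volume (0 : ℝ)] with p hp
      have e : (-b : ℂ) = ((-b : ℝ) : ℂ) := by push_cast; rfl
      rw [e, norm_mul, norm_mul, Complex.norm_cpow_real, Complex.norm_real, Real.norm_eq_abs]
      have hle : |p| ≤ ‖(δ : ℂ) + Complex.I * p‖ := by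
        have := Complex.abs_im_le_norm ((δ : ℂ) + Complex.I * p)
        simpa using this
      have h3 : ‖(δ : ℂ) + Complex.I * p‖ ^ (-b) ≤ |p| ^ (-b) :=
        Real.rpow_le_rpow_of_nonpos (abs_pos.2 hp) hle (by linarith)
      calc ‖φ p‖ * (|Real.Gamma b| * ‖(δ : ℂ) + Complex.I * p‖ ^ (-b))
          ≤ ‖φ p‖ * (|Real.Gamma b| * |p| ^ (-b)) := by
            refine mul_le_mul_of_nonneg_left ?_ (norm_nonneg _)
            exact mul_le_mul_of_nonneg_left h3 (abs_nonneg _)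
        _ = _ := by ring
    · filter_upwards [Measure.ae_ne volume (0 : ℝ)] with p hp
      have hs : Complex.I * (p : ℂ) ∈ Complex.slitPlane := by
        rw [Complex.mem_slitPlane_iff]
        right
        simpa using hp
      have h1 : Tendsto (fun δ : ℝ => (δ : ℂ) + Complex.I * p) (𝓝[>] 0) (𝓝 (Complex.I * p)) := by
        have hc : Continuous fun δ : ℝ => (δ : ℂ) + Complex.I * p := by fun_prop
        have := (hc.tendsto 0).mono_left (nhdsWithin_le_nhds (s := Set.Ioi 0))
        simpa using this
      have h2 := ((continuousAt_cpow_const (b := (-b : ℂ)) hs).tendsto.comp h1)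
      push_cast
      exact (h2.const_mul _).const_mul _
  have hfin := tendsto_nhds_unique_of_eventuallyEq hL hR (by
    filter_upwards [self_mem_nhdsWithin] with δ hδ
    exact integral_rpow_mul_exp_mul_fourierS φ hb hδ)
  rw [hfin, ← integral_const_mul]
  congr 1
  funext p
  ring

end BaseFormula

end Conormal

namespace Conormal

open scoped SchwartzMap FourierTransform

/-! ### Hadamard's finite part -/

section FinitePart

/-- The remainder of the Taylor polynomial of degree less than `N` at the origin. -/
def taylorRem (N : ℕ) (g : ℝ → ℂ) (x : ℝ) : ℂ :=
  g x - ∑ j ∈ Finset.range N, iteratedDeriv j g 0 * (x : ℂ) ^ j / (j.factorial : ℂ)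

/-- The derivative of a Schwartz function on the line. -/
abbrev derivS (g : 𝓢(ℝ, ℂ)) : 𝓢(ℝ, ℂ) := SchwartzMap.derivCLM ℂ ℂ g

theorem coe_derivS (g : 𝓢(ℝ, ℂ)) : (derivS g : ℝ → ℂ) = deriv g := rfl

theorem hasDerivAt_taylorRem (N : ℕ) (g : 𝓢(ℝ, ℂ)) (x : ℝ) :
    HasDerivAt (taylorRem (N + 1) g) (taylorRem N (derivS g) x) x := by
  have h1 : ∀ j : ℕ, HasDerivAt (fun x : ℝ => iteratedDeriv (j + 1) g 0 * (x : ℂ) ^ (j + 1) /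
      ((j + 1).factorial : ℂ)) (iteratedDeriv j (derivS g) 0 * (x : ℂ) ^ j / (j.factorial : ℂ)) x :=
      fun j => by
    have h2 : HasDerivAt (fun x : ℝ => (x : ℂ) ^ (j + 1)) (((j + 1 : ℕ) : ℂ) * (x : ℂ) ^ j) x := by
      have := (hasDerivAt_id x).ofReal_comp.fun_pow (j + 1)
      simpa using this
    refine ((h2.const_mul (iteratedDeriv (j + 1) g 0)).div_const _).congr_deriv ?_
    rw [coe_derivS, ← iteratedDeriv_succ', Nat.factorial_succ, Nat.cast_mul]
    have h3 : ((j + 1 : ℕ) : ℂ) ≠ 0 := by exact_mod_cast Nat.succ_ne_zero j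
    have h4 : (j.factorial : ℂ) ≠ 0 := by exact_mod_cast Nat.factorial_ne_zero j
    field_simp
  have e : taylorRem (N + 1) g = fun x : ℝ => g x - (∑ j ∈ Finset.range N,
      iteratedDeriv (j + 1) g 0 * (x : ℂ) ^ (j + 1) / ((j + 1).factorial : ℂ) + g 0) := by
    funext x
    rw [taylorRem, Finset.sum_range_succ']
    simp
  rw [e]
  exact (g.hasDerivAt x).sub ((HasDerivAt.fun_sum fun j _ => h1 j).add_const _)

theorem taylorRem_zero (N : ℕ) (g : ℝ → ℂ) : taylorRem (N + 1) g 0 = 0 := by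
  rw [taylorRem, Finset.sum_range_succ']
  simp

theorem exists_taylorRem_bound (N : ℕ) : ∀ g : 𝓢(ℝ, ℂ),
    ∃ C : ℝ, 0 ≤ C ∧ ∀ x, 0 ≤ x → ‖taylorRem N g x‖ ≤ C * x ^ N := by
  induction N with
  | zero =>
    intro g
    obtain ⟨C, hC, h⟩ := exists_schwartz_decay g 0
    exact ⟨C, hC, fun x _ => by simpa [taylorRem] using h x⟩
  | succ N ih =>
    intro g
    obtain ⟨C, hC, h⟩ := ih (derivS g)
    refine ⟨C, hC, fun x hx => ?_⟩
    have h1 := Convex.norm_image_sub_le_of_norm_hasDerivWithin_le (s := Set.Icc 0 x)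
      (f := taylorRem (N + 1) g) (C := C * x ^ N)
      (fun y _ => (hasDerivAt_taylorRem N g y).hasDerivWithinAt) (fun y hy => (h y hy.1).trans (by
        have := hy.1
        have := hy.2
        gcongr)) (convex_Icc 0 x) (Set.left_mem_Icc.2 hx) (Set.right_mem_Icc.2 hx)
    rw [taylorRem_zero, sub_zero, sub_zero, Real.norm_of_nonneg hx] at h1
    calc _ ≤ _ := h1
      _ = _ := by ring

theorem continuous_taylorRem (N : ℕ) (g : 𝓢(ℝ, ℂ)) : Continuous (taylorRem N g) := by
  have := g.continuous
  unfold taylorRem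
  fun_prop

theorem integrableOn_rpow_mul_taylorRem (N : ℕ) (g : 𝓢(ℝ, ℂ)) {a : ℝ} (ha : -1 < a + N) :
    IntegrableOn (fun x : ℝ => ((x ^ a : ℝ) : ℂ) * taylorRem N g x) (Set.Ioc 0 1) := by
  obtain ⟨C, hC, h⟩ := exists_taylorRem_bound N g
  have hi : IntegrableOn (fun x : ℝ => C * x ^ (a + N)) (Set.Ioc 0 1) :=
    ((intervalIntegrable_iff_integrableOn_Ioc_of_le zero_le_one).1
      (intervalIntegral.intervalIntegrable_rpow' ha)).const_mul C
  refine hi.mono' ?_ ?_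
  · have h1 : Measurable fun t : ℝ => ((t ^ a : ℝ) : ℂ) := by fun_prop
    exact (h1.mul (continuous_taylorRem N g).measurable).aestronglyMeasurable
  · refine (ae_restrict_iff' measurableSet_Ioc).2 (Eventually.of_forall fun x hx => ?_)
    have hx0 : 0 < x := hx.1
    rw [norm_mul, Complex.norm_real, Real.norm_of_nonneg (by positivity), Real.rpow_add hx0,
      Real.rpow_natCast]
    calc x ^ a * ‖taylorRem N g x‖ ≤ x ^ a * (C * x ^ N) := by
          gcongr
          exact h x hx0.le
      _ = _ := by ring

/-- The boundary term x^{-κ} times the Taylor remainder vanishes at 0 because κ < N + 1; only the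
one at 1 survives. -/
theorem integral_Ioc_rpow_mul_taylorRem (N : ℕ) (g : 𝓢(ℝ, ℂ)) {κ : ℝ} (hκ : 0 < κ)
    (hN : κ < N + 1) :
    ∫ x in Set.Ioc (0 : ℝ) 1, ((x ^ (-(κ + 1)) : ℝ) : ℂ) * taylorRem (N + 1) g x =
      (κ : ℂ)⁻¹ * ((∫ x in Set.Ioc (0 : ℝ) 1, ((x ^ (-κ) : ℝ) : ℂ) * taylorRem N (derivS g) x) -
        taylorRem (N + 1) g 1) := by
  have i1 := (integrableOn_rpow_mul_taylorRem (N + 1) g (a := -(κ + 1))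
    (by push_cast; linarith)).const_mul (-κ : ℂ)
  have i2 := integrableOn_rpow_mul_taylorRem N (derivS g) (a := -κ) (by linarith)
  have hd : ∀ x ∈ Set.Ioo (0 : ℝ) 1, HasDerivAt
      (fun x : ℝ => ((x ^ (-κ) : ℝ) : ℂ) * taylorRem (N + 1) g x)
      (-κ * (((x ^ (-(κ + 1)) : ℝ) : ℂ) * taylorRem (N + 1) g x) +
        ((x ^ (-κ) : ℝ) : ℂ) * taylorRem N (derivS g) x) x := fun x hx => by
    have h1 := (Real.hasDerivAt_rpow_const (p := -κ) (Or.inl hx.1.ne')).ofReal_comp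
    refine (h1.mul (hasDerivAt_taylorRem N g x)).congr_deriv ?_
    have e : -κ - 1 = -(κ + 1) := by ring
    rw [e]
    push_cast
    ring
  obtain ⟨C, hC, hb⟩ := exists_taylorRem_bound (N + 1) g
  have h0 : Tendsto (fun x : ℝ => ((x ^ (-κ) : ℝ) : ℂ) * taylorRem (N + 1) g x) (𝓝[>] 0)
      (𝓝 0) := by
    rw [tendsto_zero_iff_norm_tendsto_zero]
    have hpos : 0 < (N : ℝ) + 1 - κ := by linarith
    have h2 : Tendsto (fun x : ℝ => C * x ^ ((N : ℝ) + 1 - κ)) (𝓝[>] 0) (𝓝 0) := by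
      have h3 := ((Real.continuous_rpow_const hpos.le).const_mul C).tendsto 0
      rw [Real.zero_rpow hpos.ne', mul_zero] at h3
      exact h3.mono_left nhdsWithin_le_nhds
    refine squeeze_zero' (Eventually.of_forall fun _ => norm_nonneg _) ?_ h2
    filter_upwards [self_mem_nhdsWithin] with x hx
    have hx0 : 0 < x := hx
    rw [norm_mul, Complex.norm_real, Real.norm_of_nonneg (by positivity)]
    calc x ^ (-κ) * ‖taylorRem (N + 1) g x‖ ≤ x ^ (-κ) * (C * x ^ (N + 1)) :=
          mul_le_mul_of_nonneg_left (hb x hx0.le) (by positivity)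
      _ = C * (x ^ (-κ) * x ^ ((N + 1 : ℕ) : ℝ)) := by rw [Real.rpow_natCast]; ring
      _ = _ := by
        rw [← Real.rpow_add hx0]
        push_cast
        ring_nf
  have h1 : Tendsto (fun x : ℝ => ((x ^ (-κ) : ℝ) : ℂ) * taylorRem (N + 1) g x) (𝓝[<] 1)
      (𝓝 (taylorRem (N + 1) g 1)) := by
    have h2 : ContinuousAt (fun x : ℝ => ((x ^ (-κ) : ℝ) : ℂ) * taylorRem (N + 1) g x) 1 :=
      (Complex.continuous_ofReal.continuousAt.comp
        (Real.continuousAt_rpow_const _ _ (Or.inl one_ne_zero))).mul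
        (continuous_taylorRem (N + 1) g).continuousAt
    have h3 := h2.tendsto.mono_left (nhdsWithin_le_nhds (s := Set.Iio 1))
    simpa using h3
  have key := intervalIntegral.integral_eq_sub_of_hasDerivAt_of_tendsto zero_lt_one hd
    ((intervalIntegrable_iff_integrableOn_Ioc_of_le zero_le_one).2 (i1.add i2)) h0 h1
  rw [intervalIntegral.integral_of_le zero_le_one, integral_add i1 i2, integral_const_mul] at key
  have hκ' : (κ : ℂ) ≠ 0 := by exact_mod_cast hκ.ne'
  rw [eq_inv_mul_iff_mul_eq₀ hκ']
  linear_combination -key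

theorem integrableOn_Ioi_one_rpow_mul (g : 𝓢(ℝ, ℂ)) {a : ℝ} (ha : a ≤ 0) :
    IntegrableOn (fun x : ℝ => ((x ^ a : ℝ) : ℂ) * g x) (Set.Ioi 1) := by
  refine g.integrable.norm.integrableOn.mono' ?_ ?_
  · have h1 : Measurable fun t : ℝ => ((t ^ a : ℝ) : ℂ) := by fun_prop
    exact (h1.mul g.continuous.measurable).aestronglyMeasurable
  · refine (ae_restrict_iff' measurableSet_Ioi).2 (Eventually.of_forall fun x hx => ?_)
    have hx1 : (1 : ℝ) ≤ x := le_of_lt hx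
    rw [norm_mul, Complex.norm_real, Real.norm_of_nonneg (by positivity)]
    exact mul_le_of_le_one_left (norm_nonneg _) (Real.rpow_le_one_of_one_le_of_nonpos hx1 ha)

theorem integral_Ioi_one_rpow_mul (g : 𝓢(ℝ, ℂ)) {κ : ℝ} (hκ : 0 < κ) :
    ∫ x in Set.Ioi (1 : ℝ), ((x ^ (-(κ + 1)) : ℝ) : ℂ) * g x =
      (κ : ℂ)⁻¹ * ((∫ x in Set.Ioi (1 : ℝ), ((x ^ (-κ) : ℝ) : ℂ) * derivS g x) + g 1) := by
  have i1 := (integrableOn_Ioi_one_rpow_mul g (a := -(κ + 1)) (by linarith)).const_mul (-κ : ℂ)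
  have i2 := integrableOn_Ioi_one_rpow_mul (derivS g) (a := -κ) (by linarith)
  have hd : ∀ x ∈ Set.Ici (1 : ℝ), HasDerivAt (fun x : ℝ => ((x ^ (-κ) : ℝ) : ℂ) * g x)
      (-κ * (((x ^ (-(κ + 1)) : ℝ) : ℂ) * g x) + ((x ^ (-κ) : ℝ) : ℂ) * derivS g x) x :=
      fun x hx => by
    have hx0 : x ≠ 0 := by
      have : (1 : ℝ) ≤ x := hx
      positivity
    have h1 := (Real.hasDerivAt_rpow_const (p := -κ) (Or.inl hx0)).ofReal_comp
    refine (h1.mul (g.hasDerivAt x)).congr_deriv ?_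
    have e : -κ - 1 = -(κ + 1) := by ring
    rw [e, coe_derivS]
    push_cast
    ring
  have hlim : Tendsto (fun x : ℝ => ((x ^ (-κ) : ℝ) : ℂ) * g x) atTop (𝓝 0) := by
    obtain ⟨C, hC, h⟩ := exists_schwartz_decay g 0
    rw [tendsto_zero_iff_norm_tendsto_zero]
    have h2 := (tendsto_rpow_neg_atTop hκ).mul_const C
    rw [zero_mul] at h2
    refine squeeze_zero' (Eventually.of_forall fun _ => norm_nonneg _) ?_ h2
    filter_upwards [eventually_ge_atTop 0] with x hx
    rw [norm_mul, Complex.norm_real, Real.norm_of_nonneg (by positivity)]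
    gcongr
    simpa using h x
  have key := integral_Ioi_of_hasDerivAt_of_tendsto' hd (i1.add i2) hlim
  rw [integral_add i1 i2, integral_const_mul, Real.one_rpow, Complex.ofReal_one, one_mul] at key
  have hκ' : (κ : ℂ) ≠ 0 := by exact_mod_cast hκ.ne'
  rw [eq_inv_mul_iff_mul_eq₀ hκ']
  linear_combination -key

theorem powPlus_eq (κ : ℝ) (hκ : 0 ≤ κ) (g : ℝ → ℂ) :
    powPlus (-(κ + 1)) g =
      (∫ x in Set.Ioc (0 : ℝ) 1, ((x ^ (-(κ + 1)) : ℝ) : ℂ) * taylorRem (⌊κ⌋₊ + 1) g x) +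
      (∑ j ∈ Finset.range (⌊κ⌋₊ + 1), if κ = j then 0 else
        iteratedDeriv j g 0 / ((j.factorial : ℂ) * ((j : ℂ) - κ))) +
      ∫ x in Set.Ioi (1 : ℝ), ((x ^ (-(κ + 1)) : ℝ) : ℂ) * g x := by
  have e : ⌊-(-(κ + 1))⌋₊ = ⌊κ⌋₊ + 1 := by rw [neg_neg, Nat.floor_add_one hκ]
  rw [powPlus, e]
  congr 2
  refine Finset.sum_congr rfl fun j _ => ?_
  have e2 : -(κ + 1) + j + 1 = j - κ := by ring
  rw [e2]
  by_cases h : κ = j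
  · rw [if_pos h, if_pos (by linarith)]
  · rw [if_neg h, if_neg (fun h0 => h (by linarith))]
    push_cast
    rfl

theorem powPlus_neg_eq (κ : ℝ) (g : ℝ → ℂ) :
    powPlus (-κ) g =
      (∫ x in Set.Ioc (0 : ℝ) 1, ((x ^ (-κ) : ℝ) : ℂ) * taylorRem ⌊κ⌋₊ g x) +
      (∑ j ∈ Finset.range ⌊κ⌋₊, if κ = j + 1 then 0 else
        iteratedDeriv j g 0 / ((j.factorial : ℂ) * ((j : ℂ) + 1 - κ))) +
      ∫ x in Set.Ioi (1 : ℝ), ((x ^ (-κ) : ℝ) : ℂ) * g x := by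
  rw [powPlus, neg_neg]
  congr 2
  refine Finset.sum_congr rfl fun j _ => ?_
  have e2 : -κ + j + 1 = j + 1 - κ := by ring
  rw [e2]
  by_cases h : κ = j + 1
  · rw [if_pos h, if_pos (by linarith)]
  · rw [if_neg h, if_neg (fun h0 => h (by linarith))]
    push_cast
    rfl

/-- Integration by parts for the finite part; the second term appears for integer exponents. -/
theorem powPlus_deriv (g : 𝓢(ℝ, ℂ)) {κ : ℝ} (hκ : 0 < κ) :
    powPlus (-(κ + 1)) g = (κ : ℂ)⁻¹ * (powPlus (-κ) (derivS g) +
      if κ = ⌊κ⌋₊ then iteratedDeriv ⌊κ⌋₊ g 0 / (⌊κ⌋₊.factorial : ℂ) else 0) := by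
  have hκ' : (κ : ℂ) ≠ 0 := by exact_mod_cast hκ.ne'
  have hfl : (⌊κ⌋₊ : ℝ) ≤ κ := Nat.floor_le hκ.le
  set N := ⌊κ⌋₊ with hN
  rw [powPlus_eq κ hκ.le, powPlus_neg_eq, ← hN,
    integral_Ioc_rpow_mul_taylorRem N g hκ (Nat.lt_floor_add_one κ), integral_Ioi_one_rpow_mul g hκ]
  have hR : taylorRem (N + 1) g 1 =
      g 1 - ∑ j ∈ Finset.range (N + 1), iteratedDeriv j g 0 / (j.factorial : ℂ) := by
    simp [taylorRem]
  -- The Taylor coefficients match through 1/κ + 1/(j+1−κ) = (j+1)/(κ(j+1−κ)). At κ = j + 1 the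
  -- finite part drops both singular terms, and what remains of 1/κ is the extra term for integer
  -- exponents.
  have hterm : ∀ j ∈ Finset.range N,
      (κ : ℂ)⁻¹ * (iteratedDeriv (j + 1) g 0 / ((j + 1).factorial : ℂ)) +
        (if κ = ((j + 1 : ℕ) : ℝ) then 0 else
          iteratedDeriv (j + 1) g 0 / (((j + 1).factorial : ℂ) * (((j + 1 : ℕ) : ℂ) - κ))) =
      (κ : ℂ)⁻¹ * ((if κ = j + 1 then 0 else
        iteratedDeriv j (derivS g) 0 / ((j.factorial : ℂ) * ((j : ℂ) + 1 - κ))) +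
        if j + 1 = N then (if κ = N then iteratedDeriv N g 0 / (N.factorial : ℂ) else 0) else 0) :=
      fun j hj => by
    rw [coe_derivS, ← iteratedDeriv_succ']
    push_cast
    by_cases h : κ = j + 1
    · have hjN : j + 1 = N := by
        have h1 : ((j + 1 : ℕ) : ℝ) ≤ N := by exact_mod_cast Finset.mem_range.1 hj
        have h2 : (N : ℝ) ≤ ((j + 1 : ℕ) : ℝ) := by push_cast; linarith
        exact le_antisymm (by exact_mod_cast h1) (by exact_mod_cast h2)
      rw [if_pos h, if_pos h, if_pos hjN, ← hjN, if_pos (by push_cast; exact h)]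
      ring
    · rw [if_neg h, if_neg h]
      have h0 : (if j + 1 = N then
          (if κ = N then iteratedDeriv N g 0 / (N.factorial : ℂ) else 0) else 0) = 0 := by
        split_ifs with h1 h2
        · exact absurd (by rw [h2, ← h1]; push_cast; rfl) h
        · rfl
        · rfl
      rw [h0, add_zero, Nat.factorial_succ]
      have h3 : (j : ℂ) + 1 ≠ 0 := by exact_mod_cast Nat.succ_ne_zero j
      have h4 : (j.factorial : ℂ) ≠ 0 := by exact_mod_cast Nat.factorial_ne_zero j
      have h5 : (j : ℂ) + 1 - κ ≠ 0 := fun h6 => h (by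
        have : ((j + 1 - κ : ℝ) : ℂ) = 0 := by push_cast; exact h6
        have := Complex.ofReal_eq_zero.1 this
        linarith)
      push_cast
      field_simp
      ring
  have hsum := Finset.sum_congr rfl hterm
  rw [Finset.sum_add_distrib, ← Finset.mul_sum, ← Finset.mul_sum, Finset.sum_add_distrib] at hsum
  -- The extra term is attached to the last index j = N − 1. For N = 0 the range is empty, and κ > 0
  -- excludes κ = N.
  have hcorr : ∑ j ∈ Finset.range N, (if j + 1 = N then
      (if κ = N then iteratedDeriv N g 0 / (N.factorial : ℂ) else 0) else 0) =
      if κ = N then iteratedDeriv N g 0 / (N.factorial : ℂ) else 0 := by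
    rcases Nat.eq_zero_or_pos N with h0 | h0
    · rw [h0, Finset.range_zero, Finset.sum_empty, if_neg (by simpa using hκ.ne')]
    · rw [Finset.sum_eq_single (N - 1)]
      · rw [if_pos (by omega)]
      · intro j _ hj
        rw [if_neg (by omega)]
      · intro h
        exact absurd (Finset.mem_range.2 (by omega)) h
  rw [hcorr] at hsum
  rw [hR, Finset.sum_range_succ' _ N, Finset.sum_range_succ' _ N, if_neg (by simpa using hκ.ne')]
  simp only [Nat.factorial_zero, Nat.cast_one, Nat.cast_zero, div_one, one_mul, zero_sub]
  have e0 : iteratedDeriv 0 g 0 / (-(κ : ℂ)) = -(κ : ℂ)⁻¹ * iteratedDeriv 0 g 0 := by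
    rw [div_neg, div_eq_inv_mul, neg_mul]
  rw [e0]
  linear_combination hsum

end FinitePart

end Conormal

namespace Conormal

open scoped SchwartzMap FourierTransform

/-! ### Raising the exponent by integration by parts -/

section HomogeneousFourier

/-- The reflection `p ↦ φ(-p)`. -/
def reflectS : 𝓢(ℝ, ℂ) →L[ℂ] 𝓢(ℝ, ℂ) :=
  SchwartzMap.compCLMOfContinuousLinearEquiv ℂ (ContinuousLinearEquiv.neg ℝ)

theorem reflectS_apply (φ : 𝓢(ℝ, ℂ)) (p : ℝ) : reflectS φ p = φ (-p) := rfl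

theorem powMinus_eq (a : ℝ) (g : 𝓢(ℝ, ℂ)) : powMinus a g = powPlus a (reflectS g) := rfl

theorem fourierS_reflectS (φ : 𝓢(ℝ, ℂ)) : fourierS (reflectS φ) = reflectS (fourierS φ) := by
  ext l
  rw [reflectS_apply, fourierS_real_apply, fourierS_real_apply, ← integral_neg_eq_self]
  congr 1
  funext p
  rw [reflectS_apply, neg_neg]
  push_cast
  ring_nf

/-- Multiplication by `-ip`. -/
def mulNegI (φ : 𝓢(ℝ, ℂ)) : 𝓢(ℝ, ℂ) :=
  (-Complex.I) • SchwartzMap.smulLeftCLM ℂ (fun p : ℝ => ⟪p, (1 : ℝ)⟫) φ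

theorem mulNegI_apply (φ : 𝓢(ℝ, ℂ)) (p : ℝ) : mulNegI φ p = -(Complex.I * p) * φ p := by
  rw [mulNegI, smul_apply, SchwartzMap.smulLeftCLM_apply_apply (by fun_prop), real_inner_eq_re_inner]
  simp [mul_assoc]

theorem derivS_fourierS (φ : 𝓢(ℝ, ℂ)) : derivS (fourierS φ) = fourierS (mulNegI φ) := by
  ext l
  have h1 : HasDerivAt (fun l : ℝ => (2 * Real.pi)⁻¹ • l) (2 * Real.pi)⁻¹ l := by
    simpa using (hasDerivAt_id l).const_mul (2 * Real.pi)⁻¹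
  have h2 := ((𝓕 φ).hasDerivAt ((2 * Real.pi)⁻¹ • l)).scomp l h1
  have h3 : deriv (𝓕 φ : 𝓢(ℝ, ℂ)) ((2 * Real.pi)⁻¹ • l) =
      (∂_{(1 : ℝ)} (𝓕 φ) : 𝓢(ℝ, ℂ)) ((2 * Real.pi)⁻¹ • l) := by
    rw [SchwartzMap.lineDerivOp_apply_eq_fderiv, fderiv_eq_smul_deriv, one_smul]
  have h4 : (derivS (fourierS φ)) l =
      (2 * Real.pi)⁻¹ • deriv (𝓕 φ : 𝓢(ℝ, ℂ)) ((2 * Real.pi)⁻¹ • l) := h2.deriv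
  rw [h4, h3, SchwartzMap.lineDerivOp_fourier_eq, fourierS_eq, mulNegI, FourierTransform.fourier_smul,
    FourierTransform.fourier_smul, smul_apply, smul_apply, Complex.real_smul, smul_eq_mul,
    smul_eq_mul]
  have : (Real.pi : ℂ) ≠ 0 := by exact_mod_cast Real.pi_ne_zero
  push_cast
  field_simp
  rw [smul_eq_mul, neg_mul]

theorem derivS_reflectS (g : 𝓢(ℝ, ℂ)) : derivS (reflectS g) = -reflectS (derivS g) := by
  ext l
  have h : HasDerivAt (fun l : ℝ => g (-l)) (-deriv g (-l)) l := by
    simpa [Function.comp_def] using (g.hasDerivAt (-l)).scomp l (hasDerivAt_neg l)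
  exact h.deriv

theorem powPlus_of_lt_one {b : ℝ} (hb : 0 < b) (g : 𝓢(ℝ, ℂ)) :
    powPlus (b - 1) g = ∫ l in Set.Ioi (0 : ℝ), ((l ^ (b - 1) : ℝ) : ℂ) * g l := by
  have e : ⌊-(b - 1)⌋₊ = 0 := Nat.floor_eq_zero.2 (by linarith)
  have hi := integrable_rpow_fourierS g (a := b - 1) (by linarith)
  rw [powPlus, e, ← Set.Ioc_union_Ioi_eq_Ioi zero_le_one, setIntegral_union Set.Ioc_disjoint_Ioi_same
    measurableSet_Ioi (hi.mono_set Set.Ioc_subset_Ioi_self)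
    (hi.mono_set (Set.Ioi_subset_Ioi zero_le_one))]
  simp

theorem I_mul_cpow_succ {p : ℝ} (hp : p ≠ 0) (κ : ℝ) :
    (Complex.I * (p : ℂ)) ^ (κ : ℂ) = (Complex.I * p) * (Complex.I * p) ^ (((κ - 1 : ℝ)) : ℂ) := by
  have h : Complex.I * (p : ℂ) ≠ 0 := mul_ne_zero Complex.I_ne_zero (by exact_mod_cast hp)
  nth_rewrite 2 [← Complex.cpow_one (Complex.I * (p : ℂ))]
  rw [← Complex.cpow_add _ _ h]
  push_cast
  ring_nf

/-- Start from −1 < κ < 0. Each integration by parts raises κ by one, turns the derivative of the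
transform into multiplication by −ip, and matches Γ(1 − κ) = −κΓ(−κ). The open intervals avoid
integers, so no extra term appears. -/
theorem powPlus_fourierS (N : ℕ) : ∀ κ : ℝ, (N : ℝ) - 1 < κ → κ < N → ∀ φ : 𝓢(ℝ, ℂ),
    powPlus (-(κ + 1)) (fourierS φ) =
      Real.Gamma (-κ) * ∫ p, φ p * (Complex.I * p) ^ (κ : ℂ) := by
  induction N with
  | zero =>
    intro κ h1 h2 φ
    have e : -(κ + 1) = -κ - 1 := by ring
    simp only [Nat.cast_zero] at h1 h2
    rw [e, powPlus_of_lt_one (by linarith), integral_rpow_mul_fourierS φ (by linarith) (by linarith),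
      neg_neg]
  | succ N ih =>
    intro κ h1 h2 φ
    push_cast at h1 h2
    have hκ : 0 < κ := lt_of_le_of_lt (by simp) h1
    have hfl : ¬ κ = ⌊κ⌋₊ := fun h => by
      rw [h] at h1 h2
      have h3 : N < ⌊κ⌋₊ := by
        have : (N : ℝ) < ⌊κ⌋₊ := by linarith
        exact_mod_cast this
      have h4 : ⌊κ⌋₊ < N + 1 := by exact_mod_cast h2
      omega
    have e : -κ = -(κ - 1 + 1) := by ring
    have hκ' : (κ : ℂ) ≠ 0 := by exact_mod_cast hκ.ne'
    have hG : Real.Gamma (-(κ - 1)) = -κ * Real.Gamma (-κ) := by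
      rw [← Real.Gamma_add_one (neg_ne_zero.2 hκ.ne')]
      ring_nf
    have hint : ∫ p, mulNegI φ p * (Complex.I * p) ^ (((κ - 1 : ℝ)) : ℂ) =
        -∫ p, φ p * (Complex.I * p) ^ (κ : ℂ) := by
      rw [← integral_neg]
      refine integral_congr_ae ?_
      filter_upwards [Measure.ae_ne volume (0 : ℝ)] with p hp
      rw [I_mul_cpow_succ hp κ, mulNegI_apply]
      ring
    rw [powPlus_deriv _ hκ, if_neg hfl, add_zero, derivS_fourierS, e,
      ih (κ - 1) (by linarith) (by linarith), hint, hG, ← e]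
    push_cast
    field_simp

/-- The finite part pairing that is independent of the regularization for integer `k`. -/
def oddPart (k : ℕ) (g : 𝓢(ℝ, ℂ)) : ℂ :=
  powPlus (-((k : ℝ) + 1)) g + (-1) ^ (k + 1) * powMinus (-((k : ℝ) + 1)) g

theorem powPlus_neg (a : ℝ) (g : 𝓢(ℝ, ℂ)) : powPlus a (-g : 𝓢(ℝ, ℂ)) = -powPlus a g := by
  have h : ∀ j, iteratedDeriv j (-g : 𝓢(ℝ, ℂ)) 0 = -iteratedDeriv j g 0 := fun j => by
    have : ((-g : 𝓢(ℝ, ℂ)) : ℝ → ℂ) = -g := rfl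
    rw [this, iteratedDeriv_neg]
  have e : ∀ x, (-g : 𝓢(ℝ, ℂ)) x = -g x := fun _ => rfl
  simp only [powPlus, h, e, mul_neg, integral_neg, neg_mul, neg_div, Finset.sum_neg_distrib]
  have h1 : ∀ x : ℝ, -g x - -∑ j ∈ Finset.range ⌊-a⌋₊, iteratedDeriv j g 0 * (x : ℂ) ^ j /
      (j.factorial : ℂ) = -(g x - ∑ j ∈ Finset.range ⌊-a⌋₊, iteratedDeriv j g 0 * (x : ℂ) ^ j /
      (j.factorial : ℂ)) := fun x => by ring
  have h2 : ∀ j : ℕ, (if a + j + 1 = 0 then (0 : ℂ) else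
      -(iteratedDeriv j g 0 / ((j.factorial : ℂ) * ((a + j + 1 : ℝ) : ℂ)))) =
      -(if a + j + 1 = 0 then (0 : ℂ) else
        iteratedDeriv j g 0 / ((j.factorial : ℂ) * ((a + j + 1 : ℝ) : ℂ))) := fun j => by
    split_ifs <;> simp
  simp only [h1, h2, mul_neg, integral_neg, Finset.sum_neg_distrib]
  ring

/-- The extra term of the reflected part has sign (−1)^{k+1} from the parity of the derivative and
(−1)^{k+2} from its coefficient, so the two extra terms cancel. -/
theorem oddPart_succ (k : ℕ) (g : 𝓢(ℝ, ℂ)) :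
    oddPart (k + 1) g = ((k + 1 : ℕ) : ℂ)⁻¹ * oddPart k (derivS g) := by
  have hk : (0 : ℝ) < ((k + 1 : ℕ) : ℝ) := by positivity
  have h0 : iteratedDeriv (k + 1) (reflectS g) 0 = (-1) ^ (k + 1) * iteratedDeriv (k + 1) g 0 := by
    have : (reflectS g : ℝ → ℂ) = fun x => g (-x) := rfl
    rw [this, iteratedDeriv_comp_neg]
    simp
  have hs : ((-1 : ℂ)) ^ (k + 1) * (-1) ^ (k + 1) = 1 := by
    rw [← mul_pow]
    simp
  rw [oddPart, oddPart, powMinus_eq, powMinus_eq, powPlus_deriv g hk,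
    powPlus_deriv (reflectS g) hk, Nat.floor_natCast, if_pos rfl, if_pos rfl, derivS_reflectS,
    powPlus_neg, h0]
  push_cast
  have e : (-1 : ℂ) ^ (k + 1 + 1) = -(-1) ^ (k + 1) := by rw [pow_succ]; ring
  rw [e]
  linear_combination -((k : ℂ) + 1)⁻¹ *
    (iteratedDeriv (k + 1) g 0 / (((k + 1).factorial : ℕ) : ℂ)) * hs

end HomogeneousFourier

end Conormal

namespace Conormal

open scoped SchwartzMap FourierTransform

/-! ### Integer exponents: the parity combination -/

section FirstAssertion

theorem I_mul_cpow_of_pos {p : ℝ} (hp : 0 < p) (a : ℝ) :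
    (Complex.I * (p : ℂ)) ^ (a : ℂ) =
      ((p ^ a : ℝ) : ℂ) * Complex.exp (Complex.I * a * (Real.pi / 2)) := by
  have h : Complex.I * (p : ℂ) ≠ 0 := mul_ne_zero Complex.I_ne_zero (by exact_mod_cast hp.ne')
  rw [Complex.cpow_def_of_ne_zero h, mul_comm Complex.I, Complex.log_ofReal_mul hp Complex.I_ne_zero,
    Complex.log_I, Real.rpow_def_of_pos hp, Complex.ofReal_exp, ← Complex.exp_add]
  push_cast
  ring_nf

theorem I_mul_cpow_of_neg {p : ℝ} (hp : p < 0) (a : ℝ) :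
    (Complex.I * (p : ℂ)) ^ (a : ℂ) =
      (((-p) ^ a : ℝ) : ℂ) * Complex.exp (-(Complex.I * a * (Real.pi / 2))) := by
  have h : Complex.I * (p : ℂ) ≠ 0 := mul_ne_zero Complex.I_ne_zero (by exact_mod_cast hp.ne)
  have hp' : 0 < -p := by linarith
  have e : Complex.I * (p : ℂ) = ((-p : ℝ) : ℂ) * -Complex.I := by push_cast; ring
  rw [Complex.cpow_def_of_ne_zero h, e, Complex.log_ofReal_mul hp' (neg_ne_zero.2 Complex.I_ne_zero),
    Complex.log_neg_I, Real.rpow_def_of_pos hp', Complex.ofReal_exp, ← Complex.exp_add]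
  push_cast
  ring_nf

theorem integral_reflectS (φ : 𝓢(ℝ, ℂ)) (a : ℝ) :
    ∫ p, reflectS φ p * (Complex.I * p) ^ (a : ℂ) =
      ∫ p, φ p * (Complex.I * ((-p : ℝ) : ℂ)) ^ (a : ℂ) := by
  rw [← integral_neg_eq_self]
  simp only [reflectS_apply, neg_neg]

theorem I_mul_cpow_sub {p : ℝ} (hp : p ≠ 0) (a : ℝ) :
    (Complex.I * (p : ℂ)) ^ (a : ℂ) - (Complex.I * ((-p : ℝ) : ℂ)) ^ (a : ℂ) =
      2 * Complex.I * (Real.sin (a * (Real.pi / 2)) : ℂ) *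
        ((|p| ^ a * Real.sign p : ℝ) : ℂ) := by
  have hs : Complex.exp (Complex.I * a * (Real.pi / 2)) - Complex.exp (-(Complex.I * a * (Real.pi / 2)))
      = 2 * Complex.I * (Real.sin (a * (Real.pi / 2)) : ℂ) := by
    rw [Complex.ofReal_sin, Complex.sin]
    have e1 : Complex.I * a * (Real.pi / 2) = ((a * (Real.pi / 2) : ℝ) : ℂ) * Complex.I := by
      push_cast; ring
    rw [e1, neg_mul]
    linear_combination (-Complex.exp (-(((a * (Real.pi / 2) : ℝ) : ℂ) * Complex.I)) +
      Complex.exp (((a * (Real.pi / 2) : ℝ) : ℂ) * Complex.I)) * Complex.I_sq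
  rcases lt_or_gt_of_ne hp with h | h
  · rw [I_mul_cpow_of_neg h, I_mul_cpow_of_pos (by linarith : 0 < -p), abs_of_neg h,
      Real.sign_of_neg h]
    push_cast at hs ⊢
    linear_combination -(((-p) ^ a : ℝ) : ℂ) * hs
  · rw [I_mul_cpow_of_pos h, I_mul_cpow_of_neg (by linarith : -p < 0), neg_neg, abs_of_pos h,
      Real.sign_of_pos h]
    push_cast at hs ⊢
    linear_combination ((p ^ a : ℝ) : ℂ) * hs

theorem measurable_sign : Measurable Real.sign := by
  unfold Real.sign
  exact Measurable.ite measurableSet_Iio measurable_const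
    (Measurable.ite measurableSet_Ioi measurable_const measurable_const)

theorem abs_sign_le (p : ℝ) : |Real.sign p| ≤ 1 := by
  rcases Real.sign_apply_eq p with h | h | h <;> simp [h]

theorem integrableOn_inv_mul_odd {g : 𝓢(ℝ, ℂ)} (h0 : g 0 = 0) :
    IntegrableOn (fun x : ℝ => ((x ^ (-1 : ℝ) : ℝ) : ℂ) * g x) (Set.Ioi 0) := by
  have e : taylorRem 1 g = g := by
    funext x
    simp [taylorRem, h0]
  have h1 := integrableOn_rpow_mul_taylorRem 1 g (a := -1) (by norm_num)
  rw [e] at h1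
  rw [← Set.Ioc_union_Ioi_eq_Ioi zero_le_one]
  exact h1.union (integrableOn_Ioi_one_rpow_mul g (by norm_num))

/-- The odd part g(x) − g(−x) vanishes at 0, so the finite parts combine to an absolutely convergent
integral, a principal value. -/
theorem oddPart_zero_eq (g : 𝓢(ℝ, ℂ)) :
    oddPart 0 g = ∫ x in Set.Ioi (0 : ℝ), ((x ^ (-1 : ℝ) : ℝ) : ℂ) * (g - reflectS g) x := by
  have h0 : (g - reflectS g) 0 = 0 := by rw [sub_apply, reflectS_apply, neg_zero, sub_self]
  have hi := integrableOn_inv_mul_odd h0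
  have hR : ∀ g : 𝓢(ℝ, ℂ), IntegrableOn
      (fun x : ℝ => ((x ^ (-1 : ℝ) : ℝ) : ℂ) * taylorRem 1 g x) (Set.Ioc 0 1) := fun g =>
    integrableOn_rpow_mul_taylorRem 1 g (by norm_num)
  have hI : ∀ g : 𝓢(ℝ, ℂ), IntegrableOn
      (fun x : ℝ => ((x ^ (-1 : ℝ) : ℝ) : ℂ) * g x) (Set.Ioi 1) := fun g =>
    integrableOn_Ioi_one_rpow_mul g (by norm_num)
  have hp : ∀ g : 𝓢(ℝ, ℂ), powPlus (-(((0 : ℕ) : ℝ) + 1)) g =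
      (∫ x in Set.Ioc (0 : ℝ) 1, ((x ^ (-1 : ℝ) : ℝ) : ℂ) * taylorRem 1 g x) +
        ∫ x in Set.Ioi (1 : ℝ), ((x ^ (-1 : ℝ) : ℝ) : ℂ) * g x := fun g => by
    rw [powPlus_eq _ (by simp)]
    simp
  rw [oddPart, powMinus_eq, hp, hp, ← Set.Ioc_union_Ioi_eq_Ioi zero_le_one,
    setIntegral_union Set.Ioc_disjoint_Ioi_same measurableSet_Ioi
      (hi.mono_set Set.Ioc_subset_Ioi_self) (hi.mono_set (Set.Ioi_subset_Ioi zero_le_one))]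
  have e1 : ∫ x in Set.Ioc (0 : ℝ) 1, ((x ^ (-1 : ℝ) : ℝ) : ℂ) * (g - reflectS g) x =
      (∫ x in Set.Ioc (0 : ℝ) 1, ((x ^ (-1 : ℝ) : ℝ) : ℂ) * taylorRem 1 g x) -
        ∫ x in Set.Ioc (0 : ℝ) 1, ((x ^ (-1 : ℝ) : ℝ) : ℂ) * taylorRem 1 (reflectS g) x := by
    rw [← integral_sub (hR _) (hR _)]
    congr 1
    funext x
    simp [taylorRem, reflectS_apply]
    ring
  have e2 : ∫ x in Set.Ioi (1 : ℝ), ((x ^ (-1 : ℝ) : ℝ) : ℂ) * (g - reflectS g) x =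
      (∫ x in Set.Ioi (1 : ℝ), ((x ^ (-1 : ℝ) : ℝ) : ℂ) * g x) -
        ∫ x in Set.Ioi (1 : ℝ), ((x ^ (-1 : ℝ) : ℝ) : ℂ) * reflectS g x := by
    rw [← integral_sub (hI _) (hI _)]
    congr 1
    funext x
    rw [sub_apply]
    ring
  rw [e1, e2]
  ring

theorem tendsto_integral_rpow_sub_one {g : 𝓢(ℝ, ℂ)} (h0 : g 0 = 0) :
    Tendsto (fun b : ℝ => ∫ x in Set.Ioi (0 : ℝ), ((x ^ (b - 1) : ℝ) : ℂ) * g x) (𝓝[>] 0)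
      (𝓝 (∫ x in Set.Ioi (0 : ℝ), ((x ^ (-1 : ℝ) : ℝ) : ℂ) * g x)) := by
  refine tendsto_integral_filter_of_dominated_convergence
    (fun x => ‖((x ^ (-1 : ℝ) : ℝ) : ℂ) * g x‖ + ‖g x‖) ?_ ?_
    ((integrableOn_inv_mul_odd h0).norm.add g.integrable.norm.integrableOn) ?_
  · refine Eventually.of_forall fun b => ?_
    have h1 : Measurable fun t : ℝ => ((t ^ (b - 1) : ℝ) : ℂ) := by fun_prop
    exact (h1.mul g.continuous.measurable).aestronglyMeasurable
  · filter_upwards [Ioc_mem_nhdsGT (zero_lt_one' ℝ)] with b hb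
    refine (ae_restrict_iff' measurableSet_Ioi).2 (Eventually.of_forall fun x hx => ?_)
    have hx0 : 0 < x := hx
    rw [norm_mul, norm_mul, Complex.norm_real, Complex.norm_real, Real.norm_of_nonneg (by positivity),
      Real.norm_of_nonneg (by positivity)]
    rcases le_total x 1 with h | h
    · have h2 : x ^ (b - 1) ≤ x ^ (-1 : ℝ) :=
        Real.rpow_le_rpow_of_exponent_ge hx0 h (by linarith [hb.1])
      calc x ^ (b - 1) * ‖g x‖ ≤ x ^ (-1 : ℝ) * ‖g x‖ :=
            mul_le_mul_of_nonneg_right h2 (norm_nonneg _)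
        _ ≤ _ := le_add_of_nonneg_right (norm_nonneg _)
    · have h2 : x ^ (b - 1) ≤ 1 := Real.rpow_le_one_of_one_le_of_nonpos h (by linarith [hb.2])
      calc x ^ (b - 1) * ‖g x‖ ≤ 1 * ‖g x‖ := mul_le_mul_of_nonneg_right h2 (norm_nonneg _)
        _ ≤ _ := by
          rw [one_mul]
          exact le_add_of_nonneg_left (by positivity)
  · refine (ae_restrict_iff' measurableSet_Ioi).2 (Eventually.of_forall fun x hx => ?_)
    have hx0 : 0 < x := hx
    have hc : Continuous fun b : ℝ => ((x ^ (b - 1) : ℝ) : ℂ) * g x := by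
      have : Continuous fun b : ℝ => x ^ (b - 1) :=
        Continuous.rpow continuous_const (by fun_prop) fun _ => Or.inl hx0.ne'
      fun_prop
    have := (hc.tendsto 0).mono_left (nhdsWithin_le_nhds (s := Set.Ioi 0))
    simpa using this

/-- The pole of Γ at 0 cancels the zero of the sine: Γ(b) = Γ(b+1)/b. -/
theorem tendsto_Gamma_mul_sin :
    Tendsto (fun b : ℝ => Real.Gamma b * Real.sin (b * (Real.pi / 2))) (𝓝[>] 0)
      (𝓝 (Real.pi / 2)) := by
  have h1 : Tendsto (fun b : ℝ => Real.Gamma (b + 1)) (𝓝[>] 0) (𝓝 1) := by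
    have hc : ContinuousAt (fun b : ℝ => Real.Gamma (b + 1)) 0 := by
      have h2 : ContinuousAt Real.Gamma (0 + 1) := by
        rw [zero_add]
        exact (Real.differentiableAt_Gamma fun m => by linarith [(Nat.cast_nonneg m : (0 : ℝ) ≤ m)]).continuousAt
      exact ContinuousAt.comp (f := fun b : ℝ => b + 1) h2 (by fun_prop)
    have := hc.tendsto.mono_left (nhdsWithin_le_nhds (s := Set.Ioi 0))
    simpa using this
  have h2 : Tendsto (fun b : ℝ => b⁻¹ * Real.sin (b * (Real.pi / 2))) (𝓝[>] 0)
      (𝓝 (Real.pi / 2)) := by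
    have h3 : HasDerivAt (fun b : ℝ => Real.sin (b * (Real.pi / 2))) (Real.pi / 2) 0 := by
      have := ((hasDerivAt_id (0 : ℝ)).mul_const (Real.pi / 2)).sin
      simpa using this
    have h4 := h3.tendsto_slope_zero_right
    simpa using h4
  have h3 := h1.mul h2
  rw [one_mul] at h3
  refine h3.congr' ?_
  filter_upwards [self_mem_nhdsWithin] with b hb
  have hb' : b ≠ 0 := ne_of_gt hb
  rw [Real.Gamma_add_one hb']
  field_simp

theorem integrable_sign_mul (φ : 𝓢(ℝ, ℂ)) {a : ℝ} (ha : -1 < a) :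
    Integrable fun p : ℝ => φ p * ((|p| ^ a * Real.sign p : ℝ) : ℂ) := by
  refine (integrable_abs_rpow_mul φ ha).mono' ?_ (Eventually.of_forall fun p => ?_)
  · have h1 : Measurable fun p : ℝ => |p| ^ a * Real.sign p :=
      Measurable.mul (by fun_prop) measurable_sign
    exact (φ.continuous.measurable.mul (Complex.measurable_ofReal.comp h1)).aestronglyMeasurable
  · rw [norm_mul, Complex.norm_real, norm_mul, Real.norm_of_nonneg (by positivity), mul_comm,
      Real.norm_eq_abs]
    refine mul_le_mul_of_nonneg_right ?_ (norm_nonneg _)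
    exact mul_le_of_le_one_right (by positivity) (abs_sign_le p)

theorem tendsto_integral_abs_rpow_sign (φ : 𝓢(ℝ, ℂ)) :
    Tendsto (fun b : ℝ => ∫ p, φ p * ((|p| ^ (-b) * Real.sign p : ℝ) : ℂ)) (𝓝[>] 0)
      (𝓝 (∫ p, φ p * (Real.sign p : ℂ))) := by
  refine tendsto_integral_filter_of_dominated_convergence
    (fun p => |p| ^ (-(1 / 2) : ℝ) * ‖φ p‖ + ‖φ p‖) ?_ ?_
    ((integrable_abs_rpow_mul φ (by norm_num)).add φ.integrable.norm) ?_
  · filter_upwards [Ioo_mem_nhdsGT (zero_lt_one' ℝ)] with b hb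
    exact (integrable_sign_mul φ (by linarith [hb.2])).aestronglyMeasurable
  · filter_upwards [Ioc_mem_nhdsGT (one_half_pos (α := ℝ))] with b hb
    filter_upwards [Measure.ae_ne volume (0 : ℝ)] with p hp
    have hp' : 0 < |p| := abs_pos.2 hp
    have h1 : |p| ^ (-b) ≤ |p| ^ (-(1 / 2) : ℝ) + 1 := by
      rcases le_total |p| 1 with h | h
      · have := Real.rpow_le_rpow_of_exponent_ge hp' h (neg_le_neg hb.2)
        linarith
      · have := Real.rpow_le_one_of_one_le_of_nonpos h (by linarith [hb.1] : -b ≤ 0)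
        have : 0 ≤ |p| ^ (-(1 / 2) : ℝ) := by positivity
        linarith
    rw [norm_mul, Complex.norm_real, norm_mul, Real.norm_of_nonneg (by positivity), mul_comm,
      Real.norm_eq_abs, ← add_one_mul]
    refine mul_le_mul_of_nonneg_right ?_ (norm_nonneg _)
    exact (mul_le_of_le_one_right (by positivity) (abs_sign_le p)).trans h1
  · filter_upwards [Measure.ae_ne volume (0 : ℝ)] with p hp
    have hc : Continuous fun b : ℝ => φ p * ((|p| ^ (-b) * Real.sign p : ℝ) : ℂ) := by
      have : Continuous fun b : ℝ => |p| ^ (-b) :=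
        Continuous.rpow continuous_const (by fun_prop) fun _ => Or.inl (abs_pos.2 hp).ne'
      fun_prop
    have := (hc.tendsto 0).mono_left (nhdsWithin_le_nhds (s := Set.Ioi 0))
    simpa using this

/-- Approach the exponent −1 by b − 1 with b → 0+. On odd parts the formula for 0 < b < 1 contains
(ip)^{-b} − (−ip)^{-b}, proportional to sin(bπ/2), which tames the factor Γ(b). -/
theorem oddPart_zero_fourierS (φ : 𝓢(ℝ, ℂ)) :
    oddPart 0 (fourierS φ) = -Complex.I * Real.pi * ∫ p, φ p * (Real.sign p : ℂ) := by
  have h0 : (fourierS φ - reflectS (fourierS φ)) 0 = 0 := by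
    rw [sub_apply, reflectS_apply, neg_zero, sub_self]
  have hL := tendsto_integral_rpow_sub_one h0
  rw [← oddPart_zero_eq] at hL
  have hR := ((Complex.continuous_ofReal.tendsto _).comp tendsto_Gamma_mul_sin).mul
    ((tendsto_integral_abs_rpow_sign φ).const_mul (-(2 * Complex.I)))
  have e : Complex.ofReal (Real.pi / 2) * (-(2 * Complex.I) * ∫ p, φ p * (Real.sign p : ℂ)) =
      -Complex.I * Real.pi * ∫ p, φ p * (Real.sign p : ℂ) := by
    push_cast
    ring
  rw [e] at hR
  refine tendsto_nhds_unique_of_eventuallyEq hL hR ?_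
  filter_upwards [Ioo_mem_nhdsGT (zero_lt_one' ℝ)] with b hb
  have hi : ∀ φ : 𝓢(ℝ, ℂ), Integrable fun p : ℝ => φ p * (Complex.I * p) ^ (((-b : ℝ)) : ℂ) :=
    fun φ => integrable_mul_cpow φ (by linarith [hb.2])
  have hi2 : Integrable fun p : ℝ => φ p * (Complex.I * ((-p : ℝ) : ℂ)) ^ (((-b : ℝ)) : ℂ) := by
    have := (hi (reflectS φ)).comp_neg
    simpa only [reflectS_apply, neg_neg] using this
  have e2 : fourierS φ - reflectS (fourierS φ) = fourierS (φ - reflectS φ) := by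
    rw [map_sub, fourierS_reflectS]
  rw [e2, integral_rpow_mul_fourierS _ hb.1 hb.2]
  have e3 : ∫ p, (φ - reflectS φ) p * (Complex.I * p) ^ (((-b : ℝ)) : ℂ) =
      ∫ p, 2 * Complex.I * (Real.sin (-b * (Real.pi / 2)) : ℂ) *
        (φ p * ((|p| ^ (-b) * Real.sign p : ℝ) : ℂ)) := by
    simp only [sub_apply, sub_mul]
    rw [integral_sub (hi φ) (hi (reflectS φ)), integral_reflectS, ← integral_sub (hi φ) hi2]
    refine integral_congr_ae ?_
    filter_upwards [Measure.ae_ne volume (0 : ℝ)] with p hp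
    rw [← mul_sub, I_mul_cpow_sub hp]
    ring
  rw [e3, integral_const_mul, neg_mul, Real.sin_neg]
  simp only [Function.comp_apply]
  push_cast
  ring

theorem oddPart_fourierS (k : ℕ) : ∀ φ : 𝓢(ℝ, ℂ), oddPart k (fourierS φ) =
    (-Complex.I) ^ (k + 1) * Real.pi / (k.factorial : ℂ) *
      ∫ p, φ p * ((p ^ k * Real.sign p : ℝ) : ℂ) := by
  induction k with
  | zero =>
    intro φ
    rw [oddPart_zero_fourierS]
    simp
  | succ k ih =>
    intro φ
    rw [oddPart_succ, derivS_fourierS, ih]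
    have e : ∫ p, mulNegI φ p * ((p ^ k * Real.sign p : ℝ) : ℂ) =
        -Complex.I * ∫ p, φ p * ((p ^ (k + 1) * Real.sign p : ℝ) : ℂ) := by
      rw [← integral_const_mul]
      congr 1
      funext p
      rw [mulNegI_apply]
      push_cast
      ring
    have h1 : ((k + 1 : ℕ) : ℂ) ≠ 0 := by exact_mod_cast Nat.succ_ne_zero k
    have h2 : (k.factorial : ℂ) ≠ 0 := by exact_mod_cast Nat.factorial_ne_zero k
    rw [e, Nat.factorial_succ, Nat.cast_mul]
    field_simp
    ring

end FirstAssertion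

end Conormal

namespace Conormal

open scoped SchwartzMap FourierTransform

/-! ### The inverse Fourier transform of `μ̃` -/

section InverseFourierMu

theorem fourierInv₁_eq (φ : 𝓢(ℝ, ℂ)) :
    fourierInv₁ φ = fourierS ((((2 * Real.pi)⁻¹ : ℝ) : ℂ) • φ) := by
  funext l
  rw [map_smul, smul_apply, fourierS_real_apply, fourierInv₁, smul_eq_mul]
  simp only [neg_mul]

/-- Euler's reflection Γ(−κ)Γ(1+κ) = −π/sin(πκ) matches the constants. For p > 0 the power (ip)^κ is
q₁p^κ and (−ip)^κ is p^κ/q₁; for p < 0 the roles are exchanged. -/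
theorem f0NonInt_eq (n : ℕ) {κ : ℝ} (hκ : 0 ≤ κ) (hk : ∀ k : ℕ, κ ≠ k) (vp vm : ℂ) (p : ℝ) :
    f0NonInt n κ vp vm p = ((((2 * Real.pi) ^ (n - 1))⁻¹ : ℝ) : ℂ) * (((2 * Real.pi)⁻¹ : ℝ) : ℂ) *
      Real.Gamma (-κ) * (vp * (Complex.I * p) ^ (κ : ℂ) +
        vm * (Complex.I * ((-p : ℝ) : ℂ)) ^ (κ : ℂ)) := by
  have hκ0 : κ ≠ 0 := by simpa using hk 0
  have hκ0' : (κ : ℂ) ≠ 0 := by exact_mod_cast hκ0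
  have hsin : Real.sin (Real.pi * κ) ≠ 0 := fun h => by
    obtain ⟨m, hm⟩ := Real.sin_eq_zero_iff.1 h
    have hm' : κ = m := by
      have := mul_left_cancel₀ Real.pi_ne_zero ((mul_comm _ _).trans hm)
      exact this.symm
    have hm0 : 0 ≤ m := by
      rw [hm'] at hκ
      exact_mod_cast hκ
    lift m to ℕ using hm0
    exact hk m (by simpa using hm')
  have hG : Real.Gamma (κ + 1) ≠ 0 := (Real.Gamma_pos_of_pos (by linarith)).ne'
  have hr : (2 * Real.pi)⁻¹ * Real.Gamma (-κ) =
      -1 / (2 * Real.sin (Real.pi * κ) * Real.Gamma (κ + 1)) := by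
    have h := Real.Gamma_mul_Gamma_one_sub (-κ)
    rw [sub_neg_eq_add, add_comm 1 κ, mul_neg, Real.sin_neg] at h
    have hpi := Real.pi_ne_zero
    have h' : Real.Gamma (-κ) = Real.pi / -Real.sin (Real.pi * κ) / Real.Gamma (κ + 1) := by
      rw [← h]
      field_simp
    rw [h']
    field_simp
  have hc : -1 / ((2 * (2 * Real.pi) ^ (n - 1) * Real.sin (Real.pi * κ) * Real.Gamma (κ + 1) : ℝ) : ℂ)
      = ((((2 * Real.pi) ^ (n - 1))⁻¹ : ℝ) : ℂ) * (((2 * Real.pi)⁻¹ : ℝ) : ℂ) *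
      Real.Gamma (-κ) := by
    rw [mul_assoc ((((2 * Real.pi) ^ (n - 1))⁻¹ : ℝ) : ℂ), ← Complex.ofReal_mul (2 * Real.pi)⁻¹, hr,
      ← Complex.ofReal_mul]
    have : ((2 * Real.pi) ^ (n - 1) : ℝ) ≠ 0 := by positivity
    rw [show (-1 : ℂ) = ((-1 : ℝ) : ℂ) by simp, ← Complex.ofReal_div]
    congr 1
    field_simp
  rw [f0NonInt, hc, div_eq_mul_inv vm, div_eq_mul_inv vp, ← Complex.exp_neg]
  congr 1
  rcases lt_trichotomy p 0 with hp | rfl | hp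
  · rw [I_mul_cpow_of_neg hp, I_mul_cpow_of_pos (neg_pos.2 hp), max_eq_right hp.le,
      max_eq_left (neg_pos.2 hp).le, Real.zero_rpow hκ0]
    push_cast
    ring
  · simp [Real.zero_rpow hκ0, Complex.zero_cpow hκ0']
  · rw [I_mul_cpow_of_pos hp, I_mul_cpow_of_neg (neg_lt_zero.2 hp), max_eq_left hp.le,
      max_eq_right (neg_lt_zero.2 hp).le, Real.zero_rpow hκ0, neg_neg]
    push_cast
    ring

/-- For non-integer exponent, `f₀` is the inverse Fourier transform of `μ̃`. -/
theorem integral_f0NonInt_mul (n : ℕ) {κ : ℝ} (hκ : 0 ≤ κ) (hk : ∀ k : ℕ, κ ≠ k) (vp vm : ℂ)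
    (φ : 𝓢(ℝ, ℂ)) :
    ∫ p, f0NonInt n κ vp vm p * φ p = muTilde n κ vp vm (fourierInv₁ φ) := by
  have h1 : ((⌊κ⌋₊ + 1 : ℕ) : ℝ) - 1 < κ := by
    push_cast
    rw [add_sub_cancel_right]
    exact lt_of_le_of_ne (Nat.floor_le hκ) (hk _).symm
  have h2 : κ < ((⌊κ⌋₊ + 1 : ℕ) : ℝ) := by
    push_cast
    exact Nat.lt_floor_add_one κ
  have hκ1 : -1 < κ := by linarith
  have i1 := integrable_mul_cpow φ hκ1
  have i2 : Integrable fun p : ℝ => φ p * (Complex.I * ((-p : ℝ) : ℂ)) ^ (κ : ℂ) := by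
    have := (integrable_mul_cpow (reflectS φ) hκ1).comp_neg
    simpa only [reflectS_apply, neg_neg] using this
  rw [muTilde, fourierInv₁_eq, powMinus_eq, ← fourierS_reflectS, powPlus_fourierS _ κ h1 h2,
    powPlus_fourierS _ κ h1 h2, integral_reflectS]
  simp only [smul_apply, smul_eq_mul, mul_assoc ((((2 * Real.pi)⁻¹ : ℝ) : ℂ))]
  rw [integral_const_mul, integral_const_mul]
  have e : ∀ p, f0NonInt n κ vp vm p * φ p =
      ((((2 * Real.pi) ^ (n - 1))⁻¹ : ℝ) : ℂ) * (((2 * Real.pi)⁻¹ : ℝ) : ℂ) * Real.Gamma (-κ) *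
        (vp * (φ p * (Complex.I * p) ^ (κ : ℂ)) +
          vm * (φ p * (Complex.I * ((-p : ℝ) : ℂ)) ^ (κ : ℂ))) := fun p => by
    rw [f0NonInt_eq n hκ hk]
    ring
  simp_rw [e]
  rw [integral_const_mul, integral_add (i1.const_mul vp) (i2.const_mul vm), integral_const_mul,
    integral_const_mul]
  ring

/-- For integer exponent and `v₋ = (-1)^{k+1} v₊`, `f₀` is the inverse Fourier transform of `μ̃`. -/
theorem integral_f0Int_mul (n k : ℕ) (vp : ℂ) (φ : 𝓢(ℝ, ℂ)) :
    ∫ p, f0Int n k vp p * φ p = muTilde n k vp ((-1) ^ (k + 1) * vp) (fourierInv₁ φ) := by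
  have h : muTilde n k vp ((-1) ^ (k + 1) * vp) (fourierInv₁ φ) =
      ((((2 * Real.pi) ^ (n - 1))⁻¹ : ℝ) : ℂ) * (vp *
        oddPart k (fourierS ((((2 * Real.pi)⁻¹ : ℝ) : ℂ) • φ))) := by
    rw [muTilde, fourierInv₁_eq, oddPart]
    ring
  rw [h, oddPart_fourierS]
  simp only [smul_apply, smul_eq_mul, mul_assoc ((((2 * Real.pi)⁻¹ : ℝ) : ℂ))]
  rw [integral_const_mul]
  have e : ∀ p, f0Int n k vp p * φ p =
      vp / (2 * (2 * Real.pi : ℂ) ^ (n - 1) * Complex.I ^ (k + 1) * (k.factorial : ℂ)) *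
        (φ p * ((p ^ k * Real.sign p : ℝ) : ℂ)) := fun p => by
    rw [f0Int]
    ring
  simp_rw [e]
  rw [integral_const_mul]
  have hI : (-Complex.I) ^ (k + 1) = (Complex.I ^ (k + 1))⁻¹ := by
    rw [← Complex.inv_I, inv_pow]
  have hpi : (Real.pi : ℂ) ≠ 0 := by exact_mod_cast Real.pi_ne_zero
  have hf : (k.factorial : ℂ) ≠ 0 := by exact_mod_cast Nat.factorial_ne_zero k
  have hI0 : Complex.I ^ (k + 1) ≠ 0 := pow_ne_zero _ Complex.I_ne_zero
  have hpn : (2 * Real.pi : ℂ) ^ (n - 1) ≠ 0 := pow_ne_zero _ (mul_ne_zero two_ne_zero hpi)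
  rw [hI]
  push_cast
  field_simp

theorem measurable_f0NonInt (n : ℕ) (κ : ℝ) (vp vm : ℂ) : Measurable (f0NonInt n κ vp vm) := by
  unfold f0NonInt
  fun_prop

/-- Ensures local integrability of f₀(x·θ), so that it defines a distribution; likewise in the
integer case. -/
theorem exists_f0NonInt_bound (n : ℕ) {κ : ℝ} (hκ : 0 ≤ κ) (hk : ∀ k : ℕ, κ ≠ k) (vp vm : ℂ) :
    ∃ C : ℝ, ∀ p, ‖f0NonInt n κ vp vm p‖ ≤ C * |p| ^ κ := by
  refine ⟨‖((((2 * Real.pi) ^ (n - 1))⁻¹ : ℝ) : ℂ) * (((2 * Real.pi)⁻¹ : ℝ) : ℂ) *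
      Real.Gamma (-κ)‖ * (‖vp‖ + ‖vm‖), fun p => ?_⟩
  rw [f0NonInt_eq n hκ hk, norm_mul, mul_assoc ‖_‖ (_ + _)]
  refine mul_le_mul_of_nonneg_left ?_ (norm_nonneg _)
  refine (norm_add_le _ _).trans ?_
  rw [norm_mul, norm_mul, norm_I_mul_cpow, norm_I_mul_cpow, abs_neg, add_mul]

theorem measurable_f0Int (n k : ℕ) (vp : ℂ) : Measurable (f0Int n k vp) := by
  have h : Measurable fun p : ℝ => p ^ k * Real.sign p := (measurable_id.pow_const k).mul measurable_sign
  exact (Complex.measurable_ofReal.comp h).const_mul _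

theorem exists_f0Int_bound (n k : ℕ) (vp : ℂ) :
    ∃ C : ℝ, ∀ p, ‖f0Int n k vp p‖ ≤ C * |p| ^ (k : ℝ) := by
  refine ⟨‖vp / (2 * (2 * Real.pi : ℂ) ^ (n - 1) * Complex.I ^ (k + 1) * (k.factorial : ℂ))‖,
    fun p => ?_⟩
  rw [f0Int, norm_mul, Complex.norm_real, Real.norm_eq_abs, abs_mul, abs_pow, Real.rpow_natCast]
  exact mul_le_mul_of_nonneg_left (mul_le_of_le_one_right (by positivity) (abs_sign_le p))
    (norm_nonneg _)

end InverseFourierMu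

end Conormal

namespace Conormal

open scoped SchwartzMap FourierTransform

/-! ### The Radon transform -/

section RadonTransform

variable {n : ℕ}

theorem norm_le_norm_smul_add {θ : E n} (p : ℝ) (y : Hyp θ) : ‖y‖ ≤ ‖p • θ + (y : E n)‖ := by
  have h : ‖p • θ + (y : E n)‖ * ‖p • θ + (y : E n)‖ =
      ‖p • θ‖ * ‖p • θ‖ + ‖(y : E n)‖ * ‖(y : E n)‖ := by
    refine norm_add_sq_eq_norm_sq_add_norm_sq_real ?_
    rw [real_inner_smul_left, inner_hyp, mul_zero]
  have h2 : ‖(y : E n)‖ * ‖(y : E n)‖ ≤ ‖p • θ + (y : E n)‖ * ‖p • θ + (y : E n)‖ := by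
    rw [h]
    exact le_add_of_nonneg_left (by positivity)
  exact (mul_self_le_mul_self_iff (norm_nonneg _) (norm_nonneg _)).2 h2

/-- Continuity is needed for Fourier inversion to hold at every point when the Radon transform is
identified with a Schwartz function. -/
theorem continuous_radon (F : 𝓢(E n, ℂ)) (θ : E n) : Continuous (radon F θ) := by
  obtain ⟨C, hC, h⟩ := exists_schwartz_decay F (Module.finrank ℝ (Hyp θ) + 1)
  have hi := (integrable_one_add_norm (E := Hyp θ) (μ := volume)
    (r := ((Module.finrank ℝ (Hyp θ) + 1 : ℕ) : ℝ)) (by push_cast; linarith)).const_mul C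
  refine continuous_of_dominated (fun p => ?_) (fun p => Eventually.of_forall fun y => ?_) hi
    (Eventually.of_forall fun y => ?_)
  · have := F.continuous
    exact Continuous.aestronglyMeasurable (by fun_prop)
  · refine (h _).trans (mul_le_mul_of_nonneg_left ?_ hC)
    exact Real.rpow_le_rpow_of_nonpos (by positivity)
      (by linarith [norm_le_norm_smul_add (θ := θ) p y])
      (neg_nonpos.2 (Nat.cast_nonneg _))
  · have := F.continuous
    fun_prop

theorem inner_smul_add_hyp {θ : E n} (hθ : ‖θ‖ = 1) (p : ℝ) (y : Hyp θ) :
    ⟪p • θ + (y : E n), θ⟫ = p := by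
  rw [inner_add_left, real_inner_smul_left, real_inner_self_eq_norm_sq, hθ,
    real_inner_comm, inner_hyp]
  ring

theorem integral_mul_comp_inner {θ : E n} (hθ : ‖θ‖ = 1) (F : E n → ℂ) (g : ℝ → ℂ)
    (hi : Integrable fun x : E n => F x * g ⟪x, θ⟫) :
    ∫ x, F x * g ⟪x, θ⟫ = ∫ p, g p * radon F θ p := by
  rw [integral_split hθ hi]
  congr 1
  funext p
  simp only [inner_smul_add_hyp hθ]
  rw [integral_mul_const, mul_comm, radon]

/-- The Radon transform of a Schwartz function is a Schwartz function, and its Fourier transform is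
the restriction of the Fourier transform to a line. -/
theorem exists_radon_schwartz (F : 𝓢(E n, ℂ)) {θ : E n} (hθ : ‖θ‖ = 1) :
    ∃ ρ : 𝓢(ℝ, ℂ), (ρ : ℝ → ℂ) = radon F θ ∧ ∀ l : ℝ, fourierS ρ l = fourierS F (l • θ) := by
  -- The map l ↦ lθ is isometric, so restricting the Fourier transform to this line gives a Schwartz
  -- function; its inverse transform is the Radon transform.
  have hanti : AntilipschitzWith 1 fun l : ℝ => l • θ := by
    refine AntilipschitzWith.of_le_mul_dist fun a b => ?_
    rw [dist_eq_norm, dist_eq_norm, ← sub_smul, norm_smul, hθ]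
    simp
  have htemp : Function.HasTemperateGrowth fun l : ℝ => l • θ := by fun_prop
  set G : 𝓢(ℝ, ℂ) := SchwartzMap.compCLMOfAntilipschitz ℂ htemp hanti (𝓕 F) with hG
  have hGapp : ∀ l, G l = 𝓕 (F : E n → ℂ) (l • θ) := fun l => by
    rw [hG, ← SchwartzMap.fourier_coe]
    rfl
  have hint : Integrable (radon F θ) := (integrable_split hθ F.integrable).integral_prod_left
  have hF : 𝓕 (radon F θ) = G := by
    funext l
    have hmul : Integrable fun x : E n => F x *
        (fun p : ℝ => Complex.exp (((-2 * Real.pi * (l * p) : ℝ) : ℂ) * Complex.I)) ⟪x, θ⟫ := by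
      refine F.integrable.mul_bdd (c := 1) ?_ (Eventually.of_forall fun x => ?_)
      · exact Continuous.aestronglyMeasurable (by fun_prop)
      · exact (Complex.norm_exp_ofReal_mul_I _).le
    rw [hGapp, Real.fourier_eq', Real.fourier_eq']
    have h := integral_mul_comp_inner hθ F
      (fun p : ℝ => Complex.exp (((-2 * Real.pi * (l * p) : ℝ) : ℂ) * Complex.I)) hmul
    have e1 : ∀ p : ℝ, Complex.exp (((-2 * Real.pi * ⟪p, l⟫ : ℝ) : ℂ) * Complex.I) • radon F θ p =
        Complex.exp (((-2 * Real.pi * (l * p) : ℝ) : ℂ) * Complex.I) * radon F θ p := fun p => by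
      rw [smul_eq_mul]
      simp
    have e2 : ∀ x : E n, Complex.exp (((-2 * Real.pi * ⟪x, l • θ⟫ : ℝ) : ℂ) * Complex.I) • F x =
        F x * Complex.exp (((-2 * Real.pi * (l * ⟪x, θ⟫) : ℝ) : ℂ) * Complex.I) := fun x => by
      rw [smul_eq_mul, real_inner_smul_right, mul_comm]
    simp_rw [e1, e2]
    exact h.symm
  have hρ : ((𝓕⁻ G : 𝓢(ℝ, ℂ)) : ℝ → ℂ) = radon F θ := by
    rw [SchwartzMap.fourierInv_coe, ← hF]
    exact (continuous_radon F θ).fourierInv_fourier_eq hint (hF ▸ G.integrable)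
  refine ⟨𝓕⁻ G, hρ, fun l => ?_⟩
  rw [fourierS_eq, FourierTransform.fourier_fourierInv_eq, hGapp, fourierS_eq,
    SchwartzMap.fourier_coe, smul_smul, smul_eq_mul]

theorem fourierS_injective : Function.Injective (fourierS : 𝓢(ℝ, ℂ) → 𝓢(ℝ, ℂ)) := by
  intro f g h
  have h1 : (𝓕 f : 𝓢(ℝ, ℂ)) = 𝓕 g := by
    ext l
    have h2 := DFunLike.congr_fun h ((2 * Real.pi) • l)
    rw [fourierS_eq, fourierS_eq, smul_smul, inv_mul_cancel₀ (by positivity), one_smul] at h2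
    exact h2
  have h3 := congrArg (fun φ : 𝓢(ℝ, ℂ) => (𝓕⁻ φ : 𝓢(ℝ, ℂ))) h1
  simpa using h3

theorem coe_iterate_derivS (m : ℕ) (ρ : 𝓢(ℝ, ℂ)) : (derivS^[m] ρ : ℝ → ℂ) = iteratedDeriv m ρ := by
  induction m with
  | zero => simp
  | succ m ih => rw [Function.iterate_succ_apply', coe_derivS, ih, iteratedDeriv_succ]

theorem fourierS_iterate_derivS (m : ℕ) (ρ : 𝓢(ℝ, ℂ)) (l : ℝ) :
    fourierS (derivS^[m] ρ) l = (Complex.I * l) ^ m * fourierS ρ l := by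
  induction m with
  | zero => simp
  | succ m ih =>
    have h : ∀ ψ : 𝓢(ℝ, ℂ), derivS ψ = ∂_{(1 : ℝ)} ψ := fun ψ => by
      ext x
      rw [SchwartzMap.lineDerivOp_apply_eq_fderiv, fderiv_eq_smul_deriv, one_smul]
      rfl
    rw [Function.iterate_succ_apply', h, fourierS_lineDeriv, ih, pow_succ]
    simp
    ring

/-- Both sides are Schwartz functions of p. By the slice theorem their Fourier transforms are P(ilθ)
and (il)ᵐP(θ) times the same function, and these agree by homogeneity. -/
theorem radon_polyDeriv {θ : E n} (hθ : ‖θ‖ = 1) {P : MvPolynomial (Fin n) ℂ} {m : ℕ}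
    (hP : P.IsHomogeneous m) (w : Test n) (p : ℝ) :
    radon (polyDeriv P w) θ p = evalReal P θ * iteratedDeriv m (radon w θ) p := by
  obtain ⟨ρ, hρ, hρf⟩ := exists_radon_schwartz (toS w) hθ
  obtain ⟨σ, hσ, hσf⟩ := exists_radon_schwartz (toS (polyDeriv P w)) hθ
  have h : σ = evalReal P θ • derivS^[m] ρ := by
    refine fourierS_injective ?_
    ext l
    have e1 : fourierS (evalReal P θ • derivS^[m] ρ) l =
        evalReal P θ * fourierS (derivS^[m] ρ) l := by
      rw [map_smul]
      rfl
    rw [hσf, e1, fourierS_iterate_derivS, hρf, fourierS_polyDeriv,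
      eval_mul_of_isHomogeneous hP]
    have e := evalReal_smul hP l θ
    rw [evalReal] at e
    rw [e]
    ring
  have h1 : radon w θ = ρ := hρ.symm
  have h2 : radon (polyDeriv P w) θ = σ := hσ.symm
  rw [h1, h2, h, smul_apply, coe_iterate_derivS, smul_eq_mul]

end RadonTransform

end Conormal

namespace Conormal

open scoped SchwartzMap FourierTransform

/-! ### The leading singularity -/

section LeadingSingularity

variable {n : ℕ}

theorem iteratedDeriv_pow_mul_zero (j : ℕ) : ∀ m : ℕ, j < m → ∀ h : ℝ → ℂ, ContDiff ℝ ∞ h →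
    iteratedDeriv j (fun x : ℝ => (x : ℂ) ^ m * h x) 0 = 0 := by
  induction j with
  | zero =>
    intro m hm h _
    simp [hm.ne']
  | succ j ih =>
    intro m hm h hh
    obtain ⟨m, rfl⟩ : ∃ m', m = m' + 1 := ⟨m - 1, by omega⟩
    have hd : deriv (fun x : ℝ => (x : ℂ) ^ (m + 1) * h x) =
        fun x : ℝ => (x : ℂ) ^ m * ((m + 1 : ℂ) * h x + x * deriv h x) := by
      funext x
      have h1 : HasDerivAt (fun x : ℝ => (x : ℂ) ^ (m + 1)) (((m + 1 : ℕ) : ℂ) * (x : ℂ) ^ m) x := by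
        simpa using (hasDerivAt_id x).ofReal_comp.fun_pow (m + 1)
      have h2 : HasDerivAt h (deriv h x) x := (hh.differentiable (by simp) x).hasDerivAt
      rw [(h1.fun_mul h2).deriv]
      push_cast
      ring
    rw [iteratedDeriv_succ', hd]
    refine ih m (by omega) _ ?_
    have h3 : ContDiff ℝ ∞ (deriv h) := ((contDiff_infty_iff_deriv).1 hh).2
    exact (contDiff_const.mul hh).add (Complex.ofRealCLM.contDiff.mul h3)

/-- With a vanishing jet there is nothing to subtract, and the finite part is an ordinary integral.
-/
theorem powPlus_of_iteratedDeriv_eq_zero {κ : ℝ} (hκ : 0 ≤ κ) (g : 𝓢(ℝ, ℂ))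
    (h : ∀ j < ⌊κ⌋₊ + 1, iteratedDeriv j g 0 = 0) :
    powPlus (-(κ + 1)) g = ∫ x in Set.Ioi (0 : ℝ), ((x ^ (-(κ + 1)) : ℝ) : ℂ) * g x := by
  have e : taylorRem (⌊κ⌋₊ + 1) g = g := by
    funext x
    rw [taylorRem, Finset.sum_eq_zero, sub_zero]
    intro j hj
    rw [h j (Finset.mem_range.1 hj)]
    simp
  have i1 := integrableOn_rpow_mul_taylorRem (⌊κ⌋₊ + 1) g (a := -(κ + 1))
    (by push_cast; linarith [Nat.lt_floor_add_one κ])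
  rw [e] at i1
  rw [powPlus_eq κ hκ, e, Finset.sum_eq_zero, add_zero, ← Set.Ioc_union_Ioi_eq_Ioi zero_le_one,
    setIntegral_union Set.Ioc_disjoint_Ioi_same measurableSet_Ioi i1
    (integrableOn_Ioi_one_rpow_mul g (by linarith))]
  intro j hj
  rw [h j (Finset.mem_range.1 hj)]
  simp

theorem powPlus_eq_rayMoment {κ : ℝ} (hκ : 0 ≤ κ) {m : ℕ} (hm : ⌊κ⌋₊ + 1 ≤ m) (F : E n → ℂ)
    (u : E n) (c : ℂ) (g ρ : 𝓢(ℝ, ℂ)) (hρ : ∀ l : ℝ, ρ l = F (l • u))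
    (hg : ∀ l : ℝ, g l = (l : ℂ) ^ m * (c * ρ l)) :
    powPlus (-(κ + 1)) g = c * rayMoment (m - κ) u F := by
  have hg' : (g : ℝ → ℂ) = fun l : ℝ => (l : ℂ) ^ m * (c * ρ l) := funext hg
  rw [powPlus_of_iteratedDeriv_eq_zero hκ g fun j hj => by
    rw [hg']
    exact iteratedDeriv_pow_mul_zero j m (by omega) _ (contDiff_const.mul (ρ.smooth ⊤)),
    rayMoment, ← integral_const_mul]
  refine setIntegral_congr_fun measurableSet_Ioi fun x hx => ?_
  have e : x ^ ((m : ℝ) - κ - 1) = x ^ (-(κ + 1)) * x ^ m := by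
    rw [← Real.rpow_natCast, ← Real.rpow_add (Set.mem_Ioi.1 hx)]
    ring_nf
  rw [hg, hρ, e]
  push_cast
  ring

/-- The m derivatives become the factor (il)ᵐ, whose zero of order m > κ removes the regularization.
The remaining integrals over the two half lines are the moments in `rayLimit`; reflection produces
the sign (−1)ᵐ. -/
theorem muTilde_fourierInv₁ (hn : n ≠ 0) {κ : ℝ} (hκ : 0 ≤ κ) {m : ℕ} (hm : ⌊κ⌋₊ + 1 ≤ m)
    (vp vm : ℂ) (θ : E n) (F : 𝓢(E n, ℂ)) (ρ : 𝓢(ℝ, ℂ))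
    (hρ : ∀ l : ℝ, fourierS ρ l = fourierS F (l • θ)) :
    muTilde n κ vp vm (fourierInv₁ (derivS^[m] ρ)) =
      ((((2 * Real.pi) ^ n)⁻¹ : ℝ) : ℂ) *
        (Complex.I ^ m * rayLimit κ vp vm θ m (fourierS F)) := by
  set c : ℂ := (((2 * Real.pi)⁻¹ : ℝ) : ℂ) with hc
  set g : 𝓢(ℝ, ℂ) := fourierS (c • derivS^[m] ρ) with hg
  have hgl : ∀ l : ℝ, g l = (l : ℂ) ^ m * (c * Complex.I ^ m * fourierS ρ l) := fun l => by
    have e1 : g l = c * fourierS (derivS^[m] ρ) l := by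
      rw [hg, map_smul]
      rfl
    rw [e1, fourierS_iterate_derivS, mul_pow]
    ring
  have hp := powPlus_eq_rayMoment hκ hm (fourierS F) θ _ g (fourierS ρ) hρ hgl
  have hm' := powPlus_eq_rayMoment hκ hm (fourierS F) (-θ) ((-1) ^ m * (c * Complex.I ^ m))
    (reflectS g) (reflectS (fourierS ρ))
    (fun l => by rw [reflectS_apply, hρ, smul_neg, neg_smul]) (fun l => by
      rw [reflectS_apply, reflectS_apply, hgl]
      push_cast
      rw [neg_pow]
      ring)
  have hpow : ((((2 * Real.pi) ^ n)⁻¹ : ℝ) : ℂ) = ((((2 * Real.pi) ^ (n - 1))⁻¹ : ℝ) : ℂ) * c := by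
    obtain ⟨k, rfl⟩ := Nat.exists_eq_succ_of_ne_zero hn
    rw [hc, ← Complex.ofReal_mul, ← mul_inv, ← pow_succ]
    rfl
  rw [muTilde, fourierInv₁_eq, ← hc, ← hg, powMinus_eq, hp, hm', rayLimit, hpow]
  ring

theorem locallyIntegrable_comp_inner {f₀ : ℝ → ℂ} (hf₀ : Measurable f₀) {κ C : ℝ} (hκ : 0 ≤ κ)
    (hC : ∀ p, ‖f₀ p‖ ≤ C * |p| ^ κ) (θ : E n) :
    LocallyIntegrable fun x : E n => f₀ ⟪x, θ⟫ := by
  have h1 : Continuous fun x : E n => C * |⟪x, θ⟫| ^ κ :=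
    continuous_const.mul (Continuous.rpow_const (by fun_prop) fun _ => Or.inr hκ)
  refine (h1.locallyIntegrable (μ := volume)).mono ?_ (Eventually.of_forall fun x => ?_)
  · have h2 : Continuous fun x : E n => ⟪x, θ⟫ := by fun_prop
    exact (hf₀.comp h2.measurable).aestronglyMeasurable
  · exact (hC _).trans (le_abs_self _)

/-- The function f₀ enters only through measurability, a growth bound and the identity with 𝓕⁻¹μ̃,
so integer and non-integer exponents are treated together. Applying that identity to the m-th
derivative of the Radon transform yields assertion 2, and slicing yields assertion 3. -/
theorem ConormalPhase.leadingSingularityGivenBy {H : E n → ℝ} {x₀ Θ : E n} {Ω : Set (E n)}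
    (h : ConormalPhase H x₀ Θ Ω) {v : E n → ℂ}
    (hv : LocallyIntegrable v) {s : ℕ → ℝ} (hs : StrictMono s) (hs_lim : Tendsto s atTop atTop)
    (hs0 : 0 < s 0) {vc : ℕ → E n → ℂ} (hvc : ∀ j, IsSmoothCompactlySupportedIn Ω (vc j))
    (hexp : HasUniformExpansion H v s vc) {κ : ℝ} (hκ : κ = s 0 - ((n : ℝ) + 1) / 2) (hκ0 : 0 ≤ κ)
    {f : Distr n} (hf : IsOscillatoryIntegral v H f) {f₀ : ℝ → ℂ} (hf₀ : Measurable f₀)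
    (hC : ∃ C : ℝ, ∀ p, ‖f₀ p‖ ≤ C * |p| ^ κ)
    (hμ : ∀ φ : 𝓢(ℝ, ℂ), ∫ p, f₀ p * φ p = muTilde n κ (vc 0 Θ) (vc 0 (-Θ)) (fourierInv₁ φ)) :
    LeadingSingularityGivenBy f x₀ Θ κ (vc 0 Θ) (vc 0 (-Θ)) f₀ := by
  obtain ⟨C, hC⟩ := hC
  have key : ∀ m : ℕ, ⌊κ⌋₊ + 1 ≤ m → ∀ P : MvPolynomial (Fin n) ℂ, P.IsHomogeneous m →
      ∀ w : Test n,
      Tendsto (fun ε : ℝ => ((ε ^ ((m : ℝ) - κ) : ℝ) : ℂ) * f (polyDeriv P (dilate x₀ ε w)))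
        (𝓝[>] 0) (𝓝 (∫ p : ℝ, f₀ p * (evalReal P Θ * iteratedDeriv m (radon w Θ) p))) := by
    intro m hm P hP w
    have hm' : κ < m := (Nat.lt_floor_add_one κ).trans_le (by exact_mod_cast hm)
    obtain ⟨ρ, hρ, hρf⟩ := exists_radon_schwartz (toS w) h.norm_eq
    have hρ' : radon w Θ = ρ := hρ.symm
    have e : ∫ p : ℝ, f₀ p * (evalReal P Θ * iteratedDeriv m (radon w Θ) p) =
        ((((2 * Real.pi) ^ n)⁻¹ : ℝ) : ℂ) * (Complex.I ^ m * (evalReal P Θ *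
          rayLimit κ (vc 0 Θ) (vc 0 (-Θ)) Θ m (fourierS (toS w)))) := by
      rw [hρ', ← coe_iterate_derivS]
      simp_rw [mul_left_comm _ (evalReal P Θ)]
      rw [integral_const_mul, hμ, muTilde_fourierInv₁ h.pos hκ0 hm _ _ Θ (toS w) ρ hρf]
    rw [e]
    exact h.tendsto_polyDeriv_dilate hv hs hs_lim hs0 hvc hexp hκ hf hm' hP w
  refine ⟨hμ, key, ⌊κ⌋₊ + 1, fun m hm P hP w => ?_⟩
  have hloc := locallyIntegrable_comp_inner hf₀ hκ0 hC Θ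
  have hi : Integrable fun x : E n => polyDeriv P w x * f₀ ⟪x, Θ⟫ :=
    hloc.integrable_smul_left_of_hasCompactSupport (polyDeriv P w).contDiff.continuous
      (polyDeriv P w).hasCompactSupport
  rw [distrOfFun_apply hloc, integral_mul_comp_inner h.norm_eq _ _ hi]
  simp_rw [radon_polyDeriv h.norm_eq hP]
  exact key m hm P hP w

end LeadingSingularity

end Conormal

end

/-! ### The theorem, in its two cases -/

theorem mainTheorem6 (n : ℕ) (hn : 2 ≤ n)
    -- the phase function
    (H : Conormal.E n → ℝ)
    (hH_smooth : ContDiffOn ℝ ∞ H {0}ᶜ)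
    (hH_hom : ∀ (t : ℝ) (ξ : Conormal.E n), t ≠ 0 → ξ ≠ 0 → H (t • ξ) = t * H ξ)
    -- the base point and the conormal direction
    (x₀ ξ₀ Θ₀ : Conormal.E n) (hξ₀ : ξ₀ ≠ 0) (hΘ₀ : Θ₀ = ‖ξ₀‖⁻¹ • ξ₀)
    (hHx₀ : HasGradientAt H x₀ ξ₀)
    -- the small neighborhood of the conormal direction on the unit sphere
    (Ω : Set (Conormal.E n))
    (hΩ_open : ∃ U : Set (Conormal.E n), IsOpen U ∧ Ω = U ∩ Metric.sphere 0 1)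
    (hΩ_mem : Θ₀ ∈ Ω)
    (hΩ_small : ∀ α ∈ Ω, HasGradientAt H x₀ α → α = Θ₀)
    (hH_neg : ∀ α ∈ Ω, (-(Conormal.hess H α)).PosDef)
    -- the amplitude
    (v : Conormal.E n → ℂ)
    (hv_smooth : ContDiffOn ℝ ∞ v {0}ᶜ)
    (hv_int : LocallyIntegrable v volume)
    (s : ℕ → ℝ) (hs_mono : StrictMono s) (hs_lim : Tendsto s atTop atTop)
    (hs₀ : ((n : ℝ) + 1) / 2 ≤ s 0)
    (vc : ℕ → Conormal.E n → ℂ)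
    (hvc : ∀ j, Conormal.IsSmoothCompactlySupportedIn Ω (vc j))
    (hv_exp : Conormal.HasUniformExpansion H v s vc)
    -- the distribution
    (f : Conormal.Distr n) (hf : Conormal.IsOscillatoryIntegral v H f)
    (κ₁ : ℝ) (hκ₁ : κ₁ = s 0 - ((n : ℝ) + 1) / 2) :
    ((∀ k : ℕ, κ₁ ≠ k) →
      Conormal.LeadingSingularityGivenBy f x₀ Θ₀ κ₁ (vc 0 Θ₀) (vc 0 (-Θ₀))
        (Conormal.f0NonInt n κ₁ (vc 0 Θ₀) (vc 0 (-Θ₀)))) ∧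
    (∀ k : ℕ, κ₁ = k → vc 0 (-Θ₀) = (-1) ^ (k + 1) * vc 0 Θ₀ →
      Conormal.LeadingSingularityGivenBy f x₀ Θ₀ κ₁ (vc 0 Θ₀) (vc 0 (-Θ₀))
        (Conormal.f0Int n k (vc 0 Θ₀))) := by
  have hnorm : ‖Θ₀‖ = 1 := by
    rw [hΘ₀, norm_smul, norm_inv, norm_norm, inv_mul_cancel₀ (norm_ne_zero_iff.2 hξ₀)]
  have hΘ_ne : Θ₀ ≠ 0 := by
    rintro rfl
    simp at hnorm
  have hgrad : HasGradientAt H x₀ Θ₀ := by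
    -- The gradient of H has degree 0, so the condition at ξ₀ passes to the unit vector Θ₀.
    rw [← Conormal.fderiv_phase_eq_zero_iff hH_smooth hΘ_ne, hΘ₀,
      (Conormal.homSymb_phase hH_smooth hH_hom).fderiv_smul (inv_pos.2 (norm_pos_iff.2 hξ₀))]
    exact (Conormal.fderiv_phase_eq_zero_iff hH_smooth hξ₀).2 hHx₀
  have h : Conormal.ConormalPhase H x₀ Θ₀ Ω :=
    ⟨hn, hH_smooth, hH_hom, hnorm, hgrad, hΩ_open, hΩ_mem, hΩ_small, hH_neg⟩
  have hκ0 : 0 ≤ κ₁ := by linarith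
  have hs0 : 0 < s 0 := lt_of_lt_of_le (by positivity) hs₀
  constructor
  · intro hk
    exact h.leadingSingularityGivenBy hv_int hs_mono hs_lim hs0 hvc hv_exp hκ₁ hκ0 hf
      (Conormal.measurable_f0NonInt _ _ _ _) (Conormal.exists_f0NonInt_bound n hκ0 hk _ _)
      (Conormal.integral_f0NonInt_mul n hκ0 hk _ _)
  · rintro k hk hvm
    refine h.leadingSingularityGivenBy hv_int hs_mono hs_lim hs0 hvc hv_exp hκ₁ hκ0 hf
      (Conormal.measurable_f0Int _ _ _) ?_ fun φ => ?_
    · rw [hk]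
      exact Conormal.exists_f0Int_bound n k _
    · rw [hvm, hk]
      exact Conormal.integral_f0Int_mul n k _ φ
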